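/- Let $\Omega\subset\mathbb{C}$ be a bounded open set whose boundary has zero area (for instance, $\partial\Omega$ locally a Lipschitz graph), and let $\mathbb{P}$ be the Riemann sphere. For $z,w\in\mathbb{C}$ put $$E(z,w)=\exp\Big[-\frac1\pi\int_\Omega\frac{dA(\zeta)}{(\zeta-z)(\bar\zeta-\bar w)}\Big],$$ where $E(z,z)=0$ if the integral diverges, put $E(z,w)=1$ if $z=\infty$ or $w=\infty$, and let $$H(z,w)=-\frac{\partial^2E(z,w)}{\partial\bar z\,\partial w},\qquad z,w\in\Omega.$$ Let $\mathcal{O}(\mathbb{P}\setminus\Omega)_0$ be the space of (germs of) functions that are analytic in a neighbourhood of $\mathbb{P}\setminus\Omega$ and vanish at $\infty$, with the inner product $$\langle f,g\rangle_{\mathcal{O}}=\frac1{4\pi^2}\int_{\partial\Omega}\int_{\partial\Omega}H(z,w)f(z)\overline{g(w)}\,dz\,d\bar w=\frac1{\pi^2}\int_\Omega\int_\Omega H(z,w)\frac{\partial\tilde f}{\partial\bar z}(z)\,\overline{\frac{\partial\tilde g}{\partial\bar w}(w)}\,dA(z)\,dA(w).$$ Here the boundary integrals are taken along an exhaustion of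 $\Omega$ from inside, and $\tilde f,\tilde g$ are any extensions of $f,g$ to smooth functions on $\mathbb{C}$, obtained by modifying $f,g$ only in a compact subset of $\Omega$; the right-hand member does not depend on their choice and serves as the definition. Theorem. The space $\mathcal{O}(\mathbb{P}\setminus\Omega)_0$ has a completion $\overline{\mathcal{O}}(\mathbb{P}\setminus\Omega)_0$ with respect to $\langle\cdot,\cdot\rangle_{\mathcal{O}}$ (elements at distance zero being identified) which is a Hilbert space of functions on $\mathbb{P}\setminus\overline\Omega$ with continuous point evaluations, every $f\in\mathcal{O}(\mathbb{P}\setminus\Omega)_0$ being represented by its restriction to $\mathbb{P}\setminus\overline\Omega$. For every $w\in\mathbb{P}\setminus\overline\Omega$ the function $$L_w(z)=\frac1{E(z,w)}-1\qquad(z\in\mathbb{P}\setminus\overline\Omega)$$ belongs to $\overline{\mathcal{O}}(\mathbb{P}\setminus\Omega)_0$ and has the reproducing property $$f(w)=\langle f,L_w\rangle_{\mathcal{O}}\qquad\text{for all } f\in\overline{\mathcal{O}}(\mathbb{P}\setminus\Omega)_0.$$ -/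

import Mathlib

open MeasureTheory Filter Topology
open scoped ContDiff ComplexConjugate

noncomputable section

/-- The Wirtinger derivative `∂f/∂z̄ = (f_x + i f_y) / 2`. -/
def wirtingerBar (f : ℂ → ℂ) (z : ℂ) : ℂ :=
  (fderiv ℝ f z 1 + Complex.I * fderiv ℝ f z Complex.I) / 2

/-- The Wirtinger derivative `∂f/∂z = (f_x - i f_y) / 2`. -/
def wirtinger (f : ℂ → ℂ) (z : ℂ) : ℂ :=
  (fderiv ℝ f z 1 - Complex.I * fderiv ℝ f z Complex.I) / 2

open Classical in
/-- The exponential transform of `Ω` at finite points,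
`E(z, w) = exp (-(1/π) ∫_Ω dA(ζ) / ((ζ - z) (ζ̄ - w̄)))`.
For bounded `Ω` the integral can diverge only if `z = w`; the integrand is then nonnegative,
the integral is `+∞`, and `E(z, z) = exp (-∞) = 0`. -/
def expTransform (Ω : Set ℂ) (z w : ℂ) : ℂ :=
  if IntegrableOn (fun ζ : ℂ => 1 / ((ζ - z) * (conj ζ - conj w))) Ω volume then
    Complex.exp (-(1 / (Real.pi : ℂ)) * ∫ ζ in Ω, 1 / ((ζ - z) * (conj ζ - conj w)))
  else 0

/-- The exponential transform on the Riemann sphere: `E(z, w) = 1` if `z = ∞` or `w = ∞`. -/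
def expTransformSphere (Ω : Set ℂ) (z w : OnePoint ℂ) : ℂ :=
  z.elim 1 (fun a => w.elim 1 (fun b => expTransform Ω a b))

/-- The inner exponential transform `H(z, w) = -∂²E(z, w) / ∂z̄ ∂w`, used for `z, w ∈ Ω`. -/
def innerExpTransform (Ω : Set ℂ) (z w : ℂ) : ℂ :=
  -wirtingerBar (fun z' => wirtinger (fun w' => expTransform Ω z' w') w) z

/-- The space of analytic functions on (a neighbourhood of) `ℙ ∖ Ω` that vanish at infinity.
A germ of such functions is given by a representative that has been modified in a compact
subset of `Ω` so as to be smooth on the whole plane. An analytic function near infinity which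
tends to `0` there is analytic at infinity with value `0`. The inner product below does not see
the choice of the smooth extension. -/
def ExtAnalytic (Ω : Set ℂ) : Submodule ℂ (ℂ → ℂ) where
  carrier := {f | ContDiff ℝ ∞ f ∧ (∀ z, z ∉ Ω → AnalyticAt ℂ f z) ∧
    Tendsto f (cocompact ℂ) (𝓝 0)}
  zero_mem' := ⟨contDiff_const, fun _ _ => analyticAt_const, tendsto_const_nhds⟩
  add_mem' := fun {f g} hf hg => ⟨hf.1.add hg.1, fun z hz => (hf.2.1 z hz).add (hg.2.1 z hz), by
    have h := hf.2.2.add hg.2.2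
    rw [add_zero] at h
    exact h⟩
  smul_mem' := fun c f hf => ⟨contDiff_const.smul hf.1,
    fun z hz => analyticAt_const.smul (hf.2.1 z hz), by
    have h := hf.2.2.const_smul c
    rw [smul_zero] at h
    exact h⟩

/-- The inner product on the analytic functions on `ℙ ∖ Ω`,
`⟨f, g⟩ = (1/π²) ∫_Ω ∫_Ω H(z, w) (∂f/∂z̄)(z) conj ((∂g/∂z̄)(w)) dA(w) dA(z)`.
Here `∂f/∂z̄` and `∂g/∂z̄` have compact support in `Ω`. By Stokes' formula this is
`(1/4π²) ∫_{∂D} ∫_{∂D} H(z, w) f(z) conj (g(w)) dz dw̄` for every smoothly bounded `D ⋐ Ω` that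
contains these supports, i.e. the integral over `∂Ω × ∂Ω` taken along an exhaustion of `Ω`.
It is linear in `f` and conjugate-linear in `g`. -/
def innerO {Ω : Set ℂ} (f g : ExtAnalytic Ω) : ℂ :=
  (1 / (Real.pi : ℂ) ^ 2) * ∫ z in Ω, ∫ w in Ω,
    innerExpTransform Ω z w * wirtingerBar f.1 z * conj (wirtingerBar g.1 w)

/-- The points of the Riemann sphere outside the closure of `Ω` (for bounded `Ω`). -/
abbrev Exterior (Ω : Set ℂ) : Type :=
  {z : OnePoint ℂ // z ∉ ((↑) : ℂ → OnePoint ℂ) '' closure Ω}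

/-- The restriction of `f` to `ℙ ∖ closure Ω`, with value `0` at infinity. -/
def exteriorValue {Ω : Set ℂ} (f : ExtAnalytic Ω) (z : Exterior Ω) : ℂ :=
  z.1.elim 0 f.1

/-- `K` is the completion of the space of analytic functions on `ℙ ∖ Ω` vanishing at infinity, as
a Hilbert space of functions on `ℙ ∖ closure Ω`. The class `RKHS` says that the elements of `K`
are functions (an element is determined by its values) and that point evaluations are
continuous. In Mathlib `inner ℂ x y` is linear in the second variable, hence `⟨f, g⟩` is
`inner ℂ g f`. -/
def IsCompletionO (Ω : Set ℂ) (K : Type*) [NormedAddCommGroup K] [InnerProductSpace ℂ K]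
    [CompleteSpace K] [RKHS ℂ K (Exterior Ω) ℂ] : Prop :=
  ∃ ι : ExtAnalytic Ω →ₗ[ℂ] K, DenseRange ι ∧
    (∀ f g : ExtAnalytic Ω, inner ℂ (ι g) (ι f) = innerO f g) ∧
    ∀ (f : ExtAnalytic Ω) (z : Exterior Ω), ι f z = exteriorValue f z

end

/-! Write P for the exponent, P(z,w) = (1/π) ∫_Ω dA(ζ)/((ζ − z)(ζ̄ − w̄)), so that the asserted
kernel is 1/E − 1 = e^P − 1. P is the Gram kernel of the Cauchy kernels in L²(Ω), hence positive
semidefinite; by Schur's product theorem so is e^P − 1, and Moore's theorem (`exists_rkhs_kernel`)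
gives a Hilbert space H of functions with this kernel. It remains to place the analytic functions in
H, isometrically for `innerO` and with dense image.

Isometry. Replace Ω by a closed bounded W containing its closure. For z interior to W, E_W(v,z)
vanishes like |v − z|² at v = z, so E_W(v,z)/|v − z|² has no singularity; its ∂̄ in v lives outside
W. Stokes' formula over the plane, applied to the product with e^{P_W(v,w)}(v̄ − w̄), picks up the
residue at infinity and expresses the conjugate of 1/(w − z) as an integral of e^{P_W(v,w)} over v
outside W (`stokes_pole`). An analytic f is the Cauchy transform of ∂̄f, hence the conjugate of f(w)
equals ∫ ψ(v)(e^{P_W(v,w)} − 1) dA(v) with a density ψ of integral zero outside W. So f is the Riesz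
vector of h ↦ ∫ ψh in the space of W, and `stokes_bounded` turns ∫ ψg into the form that defines the
inner product, with W in place of Ω (`exists_mem_rkhs`). The functional is bounded if e^{P_W(v,v)/2}
is integrable against (1 + |v|)⁻³ outside W; sets W cut out by finitely many discs have this
property (`exists_hull`).

Now let W shrink to the closure of Ω. As the boundary has zero area, the forms and kernels of W
converge to those of Ω. Cauchy–Schwarz in the space of W passes to the limit and bounds the norm of
f in H from above; the kernel grows with the set, so restriction from H to the space of W is a
contraction, which gives the bound from below (`exists_embedding`).

Density. For smooth densities g ≤ 1_Ω supported compactly in Ω, e^{P_g(·,w)} − 1 is analytic on ℙ ∖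
Ω and tends in H to the kernel function at w as g tends to 1_Ω (`exists_seq_tendsto_kerVec`). Any
other completion carries the same inner product on analytic functions, so the same sequence
converges there, and its limit is L_w. -/

noncomputable section

/-! ### Scalar reproducing kernels: membership, density, Moore's theorem -/

section AbstractRKHS

open scoped ComplexOrder

variable {X : Type*} {K : Type*} [NormedAddCommGroup K] [InnerProductSpace ℂ K] [CompleteSpace K]
  [RKHS ℂ K X ℂ]

/-- The scalar kernel function at a point of a reproducing kernel Hilbert space. -/
def kerVec (K : Type*) [NormedAddCommGroup K] [InnerProductSpace ℂ K] [CompleteSpace K]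
    [RKHS ℂ K X ℂ] (x : X) : K := RKHS.kerFun K x 1

theorem inner_kerVec (x : X) (f : K) : inner ℂ (kerVec K x) f = f x := by
  simp [kerVec]

theorem inner_kerVec_right (x : X) (f : K) : inner ℂ f (kerVec K x) = conj (f x) := by
  rw [← inner_conj_symm, inner_kerVec]

/-- A function is in the space as soon as its pairing with combinations of kernel functions
is bounded. -/
theorem exists_rkhs_of_bound (F : X → ℂ) (M : ℝ) (hM : 0 ≤ M)
    (h : ∀ c : X →₀ ℂ, ‖c.sum fun x a => a * conj (F x)‖ ≤
      M * ‖c.sum fun x a => a • kerVec K x‖) :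
    ∃ f : K, (∀ x, f x = F x) ∧ ‖f‖ ≤ M := by
  let T : (X →₀ ℂ) →ₗ[ℂ] K := Finsupp.linearCombination ℂ (kerVec K)
  let l : (X →₀ ℂ) →ₗ[ℂ] ℂ := Finsupp.linearCombination ℂ (fun x => conj (F x))
  have hb : ∀ c, ‖l c‖ ≤ M * ‖T c‖ := fun c => by
    simpa [T, l, Finsupp.linearCombination_apply] using h c
  -- The bound makes `l` factor through `T`. The resulting functional on the span of the kernel
  -- functions has norm at most `M`; Hahn–Banach extends it, and the Riesz vector of the extension
  -- is the required element.
  have hker : LinearMap.ker T ≤ LinearMap.ker l := by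
    intro c hc
    rw [LinearMap.mem_ker] at hc ⊢
    have := hb c
    rw [hc, norm_zero, mul_zero] at this
    exact norm_le_zero_iff.1 this
  obtain ⟨T', hT'⟩ : ∃ T' : LinearMap.range T → (X →₀ ℂ), ∀ y, T (T' y) = y :=
    ⟨fun y => y.2.choose, fun y => y.2.choose_spec⟩
  have hl : ∀ c c', T c = T c' → l c = l c' := by
    intro c c' hcc
    have : c - c' ∈ LinearMap.ker l := hker (by simp [hcc])
    simpa [sub_eq_zero] using this
  let m : LinearMap.range T →ₗ[ℂ] ℂ :=
    { toFun := fun y => l (T' y)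
      map_add' := fun y z => by
        rw [← map_add]; apply hl; simp [hT']
      map_smul' := fun a y => by
        rw [RingHom.id_apply, ← map_smul]; apply hl; simp [hT'] }
  let m' : StrongDual ℂ (LinearMap.range T) := m.mkContinuous M (fun y => by
    have := hb (T' y)
    rw [hT'] at this
    exact this)
  obtain ⟨g, hg, hgn⟩ := exists_extension_norm_eq (𝕜 := ℂ) (LinearMap.range T) m'
  refine ⟨(InnerProductSpace.toDual ℂ K).symm g, fun x => ?_, ?_⟩
  · rw [← inner_kerVec, ← inner_conj_symm, InnerProductSpace.toDual_symm_apply]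
    have h1 : T (Finsupp.single x 1) = kerVec K x := by simp [T]
    have h2 : g (T (Finsupp.single x 1)) = conj (F x) := by
      have h3 := hg ⟨T (Finsupp.single x 1), LinearMap.mem_range_self _ _⟩
      rw [show g (T (Finsupp.single x 1)) = _ from h3]
      change l (T' _) = _
      rw [hl (T' _) (Finsupp.single x 1) (hT' _)]
      simp [l]
    rw [← h1, h2]; simp
  · rw [LinearIsometryEquiv.norm_map, hgn]
    exact LinearMap.mkContinuous_norm_le _ hM _

/-- A vector orthogonal to every kernel function has all its values equal to zero, so it vanishes as
an element of a space of functions. -/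
theorem dense_span_kerVec {S : Submodule ℂ K} (h : ∀ x, kerVec K x ∈ S.topologicalClosure) :
    Dense (S : Set K) := by
  rw [Submodule.dense_iff_topologicalClosure_eq_top, Submodule.topologicalClosure_eq_top_iff,
    Submodule.eq_bot_iff]
  intro f hf
  rw [← Submodule.orthogonal_closure] at hf
  refine RKHS.ext fun x => ?_
  rw [← inner_kerVec, (Submodule.mem_orthogonal _ _).1 hf _ (h x)]
  simp

/-- Moore's theorem for scalar kernels. -/
theorem exists_rkhs_kernel {X : Type} (D : Matrix X X ℂ) (hD : D.PosSemidef) :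
    ∃ (K : Type) (_ : NormedAddCommGroup K) (_ : InnerProductSpace ℂ K) (_ : CompleteSpace K)
      (_ : RKHS ℂ K X ℂ), ∀ x y, inner ℂ (kerVec K x) (kerVec K y) = D x y := by
  let M : Matrix X X (ℂ →L[ℂ] ℂ) :=
    Matrix.of fun x y => ContinuousLinearMap.toSpanSingleton ℂ (D x y)
  have hM : M.PosSemidef := by
    have hiff := (RKHS.posSemidef_tfae (K := M)).out 0 2
    refine hiff.2 ⟨?_, fun v => ?_⟩
    · refine Matrix.IsHermitian.ext fun x y => ?_
      refine ContinuousLinearMap.ext_ring (ext_inner_right ℂ fun w => ?_)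
      rw [ContinuousLinearMap.star_eq_adjoint, ContinuousLinearMap.adjoint_inner_left]
      have := hD.1.apply x y
      simp [M, ← this]; try ring
    · have := hD.2 v
      have h2 := (Complex.nonneg_iff.1 this).1
      refine h2.trans_eq ?_
      change _ = Complex.re _
      -- The two double sums agree after conjugation and an exchange of the summations, which leaves
      -- the real part unchanged.
      rw [← Complex.conj_re]
      congr 1
      simp only [Finsupp.sum, map_sum]
      rw [Finset.sum_comm]
      refine Finset.sum_congr rfl fun x _ => Finset.sum_congr rfl fun y _ => ?_
      simp [M]; ring
  have : Fact M.PosSemidef := ⟨hM⟩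
  refine ⟨RKHS.OfKernel M, inferInstance, inferInstance, inferInstance, inferInstance, ?_⟩
  intro x y
  rw [inner_kerVec, kerVec, RKHS.kerFun_apply, RKHS.OfKernel.kernel_ofKernel]
  simp [M]

end AbstractRKHS

/-! ### Integrability of 1/|ζ| and uniform majorants -/

section CauchyKernel

theorem integrableOn_inv_norm_ball (R : ℝ) :
    IntegrableOn (fun ζ : ℂ => ‖ζ‖⁻¹) (Metric.ball 0 R) := by
  refine (integrableOn_fun_norm_addHaar (f := fun y : ℝ => y⁻¹) volume).2 ?_
  have h : IntegrableOn (fun _ : ℝ => (1 : ℝ)) (Set.Ioo 0 R) := by simp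
  refine h.congr_fun (fun y hy => ?_) measurableSet_Ioo
  have : y ≠ 0 := hy.1.ne'
  simp [Complex.finrank_real_complex, this]

/-- A bound for the integrals of `1 / |ζ - v|` over the disc of radius `R` about `0`. -/
def cauchyBound (R : ℝ) : ℝ :=
  (∫ ζ in Metric.ball (0 : ℂ) 1, ‖ζ‖⁻¹) + volume.real (Metric.ball (0 : ℂ) R)

theorem cauchyBound_nonneg (R : ℝ) : 0 ≤ cauchyBound R :=
  add_nonneg (integral_nonneg fun _ => by positivity) (by positivity)

/-- An integrable majorant for `1 / |ζ - v|` on the disc of radius `R` about `0`. -/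
def cauchyMajorant (R : ℝ) (v ζ : ℂ) : ℝ :=
  (Metric.ball (0 : ℂ) 1).indicator (fun ζ => ‖ζ‖⁻¹) (ζ - v) +
    (Metric.ball (0 : ℂ) R).indicator (fun _ => 1) ζ

theorem integrable_cauchyMajorant (R : ℝ) (v : ℂ) : Integrable (cauchyMajorant R v) := by
  have h := ((integrable_indicator_iff Metric.isOpen_ball.measurableSet).2
    (integrableOn_inv_norm_ball 1)).comp_sub_right v
  exact h.add ((integrable_indicator_iff Metric.isOpen_ball.measurableSet).2
    (integrableOn_const Metric.isBounded_ball.measure_lt_top.ne))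

/-- Translation invariance removes `v`: every later bound on an exponent depends on the pole only
through its distance to the other pole or to the density. -/
theorem integral_cauchyMajorant (R : ℝ) (v : ℂ) :
    ∫ ζ, cauchyMajorant R v ζ = cauchyBound R := by
  have h := ((integrable_indicator_iff Metric.isOpen_ball.measurableSet).2
    (integrableOn_inv_norm_ball 1))
  unfold cauchyMajorant
  rw [integral_add (h.comp_sub_right v)
    ((integrable_indicator_iff Metric.isOpen_ball.measurableSet).2
      (integrableOn_const Metric.isBounded_ball.measure_lt_top.ne)),
    integral_sub_right_eq_self (fun ζ : ℂ => (Metric.ball (0 : ℂ) 1).indicator (fun ζ => ‖ζ‖⁻¹) ζ) v,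
    integral_indicator Metric.isOpen_ball.measurableSet,
    integral_indicator Metric.isOpen_ball.measurableSet]
  simp [cauchyBound]

theorem inv_norm_le_cauchyMajorant {R : ℝ} {v ζ : ℂ} (hζ : ‖ζ‖ < R) :
    ‖ζ - v‖⁻¹ ≤ cauchyMajorant R v ζ := by
  unfold cauchyMajorant
  have h1 : ζ ∈ Metric.ball (0 : ℂ) R := by simpa using hζ
  rw [Set.indicator_of_mem h1]
  by_cases h : ζ - v ∈ Metric.ball (0 : ℂ) 1
  · rw [Set.indicator_of_mem h]; linarith
  · rw [Set.indicator_of_notMem h]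
    have : 1 ≤ ‖ζ - v‖ := by simpa using h
    simpa using inv_le_one_of_one_le₀ this

theorem cauchyMajorant_nonneg (R : ℝ) (v ζ : ℂ) : 0 ≤ cauchyMajorant R v ζ :=
  add_nonneg (Set.indicator_nonneg (fun _ _ => by positivity) _)
    (Set.indicator_nonneg (fun _ _ => by positivity) _)

theorem locallyIntegrable_inv : LocallyIntegrable (fun ζ : ℂ => ζ⁻¹) := by
  intro x
  refine ⟨Metric.ball 0 (‖x‖ + 1), Metric.isOpen_ball.mem_nhds (by simp), ?_⟩
  refine (integrableOn_inv_norm_ball (‖x‖ + 1)).mono' (by fun_prop) ?_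
  exact .of_forall fun ζ => by simp

/-- The mass of the approximate identity behind ∂̄(1/z) = πδ. The radial integrand has the
antiderivative −1/(2(1 + y²)). -/
theorem integral_one_add_norm_sq : ∫ ζ : ℂ, ((1 + ‖ζ‖ ^ 2) ^ 2)⁻¹ = Real.pi := by
  rw [integral_fun_norm_addHaar volume (fun y : ℝ => ((1 + y ^ 2) ^ 2)⁻¹)]
  have hball : volume.real (Metric.ball (0 : ℂ) 1) = Real.pi := by
    simp [measureReal_def, Complex.volume_ball]
  have h : ∫ y in Set.Ioi (0 : ℝ), y ^ (Module.finrank ℝ ℂ - 1) • ((1 + y ^ 2) ^ 2)⁻¹ = 1 / 2 := by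
    have hd : ∀ y ∈ Set.Ici (0 : ℝ), HasDerivAt (fun y : ℝ => -(1 / 2) * (1 + y ^ 2)⁻¹)
        (y ^ (Module.finrank ℝ ℂ - 1) • ((1 + y ^ 2) ^ 2)⁻¹) y := by
      intro y _
      have h1 : HasDerivAt (fun y : ℝ => 1 + y ^ 2) (2 * y) y := by
        simpa using (hasDerivAt_pow 2 y).const_add 1
      have h2 := (h1.inv (by positivity)).const_mul (-(1 / 2))
      refine h2.congr_deriv ?_
      simp [Complex.finrank_real_complex]
      field_simp
    have ht : Tendsto (fun y : ℝ => -(1 / 2) * (1 + y ^ 2)⁻¹) atTop (𝓝 0) := by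
      have : Tendsto (fun y : ℝ => 1 + y ^ 2) atTop atTop :=
        tendsto_atTop_add_const_left _ _ (tendsto_pow_atTop two_ne_zero)
      have h2 := (tendsto_inv_atTop_zero.comp this).const_mul (-(1 / 2))
      rwa [mul_zero] at h2
    rw [integral_Ioi_of_hasDerivAt_of_nonneg' hd (fun y hy => ?_) ht]
    · norm_num
    · have : (0 : ℝ) < y := hy
      positivity
  rw [h, hball]
  simp [Complex.finrank_real_complex]
  ring

end CauchyKernel

/-! ### Calculus of the ∂̄-derivative -/

section Dbar

/-- `f` is real differentiable at `z` with `∂f/∂z̄ = d`. -/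
def HasDbarAt (f : ℂ → ℂ) (d z : ℂ) : Prop :=
  DifferentiableAt ℝ f z ∧ wirtingerBar f z = d

theorem HasDbarAt.congr_dbar {f : ℂ → ℂ} {d d' z : ℂ} (h : HasDbarAt f d z) (e : d = d') :
    HasDbarAt f d' z := e ▸ h

theorem HasDbarAt.congr_of_eventuallyEq {f g : ℂ → ℂ} {d z : ℂ} (h : HasDbarAt f d z)
    (e : g =ᶠ[𝓝 z] f) : HasDbarAt g d z :=
  ⟨h.1.congr_of_eventuallyEq e, by rw [← h.2, wirtingerBar, wirtingerBar, e.fderiv_eq]⟩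

theorem HasDbarAt.add {f g : ℂ → ℂ} {d e z : ℂ} (hf : HasDbarAt f d z) (hg : HasDbarAt g e z) :
    HasDbarAt (fun z => f z + g z) (d + e) z := by
  refine ⟨hf.1.add hg.1, ?_⟩
  rw [← hf.2, ← hg.2]
  simp only [wirtingerBar]
  rw [fderiv_fun_add hf.1 hg.1]
  simp; ring

theorem HasDbarAt.mul {f g : ℂ → ℂ} {d e z : ℂ} (hf : HasDbarAt f d z) (hg : HasDbarAt g e z) :
    HasDbarAt (fun z => f z * g z) (d * g z + f z * e) z := by
  refine ⟨hf.1.mul hg.1, ?_⟩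
  rw [← hf.2, ← hg.2]
  simp only [wirtingerBar]
  rw [fderiv_fun_mul hf.1 hg.1]
  simp; ring

/-- The chain rule for an outer holomorphic function. -/
theorem HasDbarAt.comp_holo {f g : ℂ → ℂ} {d g' z : ℂ} (hg : HasDerivAt g g' (f z))
    (hf : HasDbarAt f d z) : HasDbarAt (fun z => g (f z)) (g' * d) z := by
  have h1 : HasFDerivAt (fun z => g (f z)) _ z :=
    (hg.hasFDerivAt.restrictScalars ℝ).comp z hf.1.hasFDerivAt
  refine ⟨h1.differentiableAt, ?_⟩
  rw [wirtingerBar, h1.fderiv, ← hf.2, wirtingerBar]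
  simp; ring

theorem hasDbarAt_of_holo {f : ℂ → ℂ} {z : ℂ} (hf : DifferentiableAt ℂ f z) :
    HasDbarAt f 0 z := by
  refine ⟨hf.restrictScalars ℝ, ?_⟩
  rw [wirtingerBar, hf.fderiv_restrictScalars ℝ]
  have : fderiv ℂ f z Complex.I = Complex.I * fderiv ℂ f z 1 := by
    rw [← smul_eq_mul, ← map_smul]; simp
  simp [this, ← mul_assoc]

theorem hasDbarAt_conj (z : ℂ) : HasDbarAt (fun z => conj z) 1 z := by
  have h : HasFDerivAt (fun z : ℂ => conj z) (Complex.conjCLE : ℂ →L[ℝ] ℂ) z :=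
    Complex.conjCLE.hasFDerivAt
  refine ⟨h.differentiableAt, ?_⟩
  rw [wirtingerBar, h.fderiv]
  simp

theorem hasDbarAt_const (c z : ℂ) : HasDbarAt (fun _ => c) 0 z :=
  hasDbarAt_of_holo (differentiableAt_const c)

theorem HasDbarAt.neg {f : ℂ → ℂ} {d z : ℂ} (hf : HasDbarAt f d z) :
    HasDbarAt (fun z => -f z) (-d) z := by
  have := (hasDbarAt_const (-1) z).mul hf
  simpa using this

/-- Real differentiability and the Cauchy-Riemann equation give complex differentiability. -/
theorem HasDbarAt.differentiableAt_complex {f : ℂ → ℂ} {z : ℂ} (hf : HasDbarAt f 0 z) :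
    DifferentiableAt ℂ f z := by
  rw [differentiableAt_complex_iff_differentiableAt_real]
  refine ⟨hf.1, ?_⟩
  have h := hf.2
  rw [wirtingerBar, div_eq_zero_iff] at h
  have h2 := h.resolve_right two_ne_zero
  rw [smul_eq_mul]
  linear_combination (-Complex.I) * h2 + (fderiv ℝ f z Complex.I) * Complex.I_sq

theorem wirtinger_eq_conj {f : ℂ → ℂ} {z d : ℂ} (hf : HasDbarAt (fun z => conj (f z)) d z) :
    wirtinger f z = conj d := by
  have h1 : HasFDerivAt (fun z => conj (f z)) _ z := hf.1.hasFDerivAt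
  have h2 : HasFDerivAt f ((Complex.conjCLE : ℂ →L[ℝ] ℂ).comp
      (fderiv ℝ (fun z => conj (f z)) z)) z := by
    have := (Complex.conjCLE : ℂ →L[ℝ] ℂ).hasFDerivAt.comp z h1
    refine this.congr_of_eventuallyEq (.of_forall fun z => by simp)
  rw [wirtinger, h2.fderiv, ← hf.2, wirtingerBar]
  simp [map_ofNat]
  ring

theorem continuous_wirtingerBar {f : ℂ → ℂ} (hf : ContDiff ℝ 1 f) :
    Continuous (wirtingerBar f) := by
  have h := hf.continuous_fderiv one_ne_zero
  unfold wirtingerBar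
  fun_prop

theorem wirtingerBar_eq_zero_of_notMem_tsupport {f : ℂ → ℂ} {z : ℂ} (hz : z ∉ tsupport f) :
    wirtingerBar f z = 0 := by
  have : fderiv ℝ f z = 0 := by
    by_contra h
    exact hz (support_fderiv_subset ℝ h)
  simp [wirtingerBar, this]

theorem hasCompactSupport_wirtingerBar {f : ℂ → ℂ} (hf : HasCompactSupport f) :
    HasCompactSupport (wirtingerBar f) :=
  hf.mono' fun z hz => by
    by_contra h
    exact hz (wirtingerBar_eq_zero_of_notMem_tsupport h)

theorem integral_wirtingerBar_eq_zero {f : ℂ → ℂ} (hf : ContDiff ℝ 1 f)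
    (hc : HasCompactSupport f) : ∫ z, wirtingerBar f z = 0 := by
  have hcont := hf.continuous_fderiv one_ne_zero
  have hint : ∀ v, Integrable (fun z => fderiv ℝ f z v) := fun v =>
    (by fun_prop : Continuous fun z => fderiv ℝ f z v).integrable_of_hasCompactSupport
      (hc.fderiv_apply (𝕜 := ℝ) v)
  have h : ∀ v, ∫ z, fderiv ℝ f z v = 0 := fun v => by
    have := integral_mul_fderiv_eq_neg_fderiv_mul_of_integrable (μ := volume) (v := v)
      (f := fun _ : ℂ => (1 : ℂ)) (g := f) (by simp) (by simpa using hint v)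
      (by simpa using hf.continuous.integrable_of_hasCompactSupport hc)
      (fun x _ => by fun_prop) (fun x _ => (hf.differentiable one_ne_zero).differentiableAt)
    simpa using this
  simp only [wirtingerBar]
  rw [integral_div, integral_add (hint 1) ((hint _).const_mul _), integral_const_mul, h, h]
  simp

end Dbar

/-! ### The Cauchy–Pompeiu formula and the Cauchy transform -/

section CauchyTransform

theorem hasDbarAt_of_contDiff {h : ℂ → ℂ} (hh : ContDiff ℝ 1 h) (z : ℂ) :
    HasDbarAt h (wirtingerBar h z) z :=
  ⟨(hh.differentiable one_ne_zero).differentiableAt, rfl⟩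

theorem mul_conj_add_ne_zero (ε : ℝ) (hε : 0 < ε) (z : ℂ) : z * conj z + (ε : ℂ) ^ 2 ≠ 0 := by
  rw [Complex.mul_conj]
  norm_cast
  have := Complex.normSq_nonneg z
  positivity

/-- The smooth regularization `ζ̄ / (|ζ|² + ε²)` of `1 / ζ`. -/
def regKernel (ε : ℝ) (z : ℂ) : ℂ := conj z * (z * conj z + (ε : ℂ) ^ 2)⁻¹

theorem contDiff_regKernel {ε : ℝ} (hε : 0 < ε) : ContDiff ℝ ∞ (regKernel ε) := by
  have h1 : ContDiff ℝ ∞ (fun z : ℂ => conj z) := Complex.conjCLE.contDiff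
  exact h1.mul (((contDiff_id.mul h1).add contDiff_const).inv
    (fun z => mul_conj_add_ne_zero ε hε z))

/-- The derivative is ε²/(|z|² + ε²)², a dilate of (1 + |z|²)⁻² that concentrates at 0 as ε → 0 with
its mass preserved. -/
theorem hasDbarAt_regKernel {ε : ℝ} (hε : 0 < ε) (z : ℂ) :
    HasDbarAt (regKernel ε) (ε ^ 2 * ((z * conj z + (ε : ℂ) ^ 2) ^ 2)⁻¹) z := by
  have hne := mul_conj_add_ne_zero ε hε z
  have h1 := ((hasDbarAt_of_holo (differentiableAt_id (x := z))).mul (hasDbarAt_conj z)).add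
    (hasDbarAt_const ((ε : ℂ) ^ 2) z)
  have h2 := (hasDbarAt_conj z).mul (HasDbarAt.comp_holo (hasDerivAt_inv hne) h1)
  refine HasDbarAt.congr_dbar h2 ?_
  simp only [id]
  field_simp
  ring

theorem norm_regKernel_le {ε : ℝ} (hε : 0 < ε) (z : ℂ) : ‖regKernel ε z‖ ≤ ‖z⁻¹‖ := by
  rcases eq_or_ne z 0 with rfl | hz
  · simp [regKernel]
  have h1 : z * conj z + (ε : ℂ) ^ 2 = ((‖z‖ ^ 2 + ε ^ 2 : ℝ) : ℂ) := by
    rw [Complex.mul_conj, Complex.normSq_eq_norm_sq]; push_cast; ring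
  have hz' : 0 < ‖z‖ := norm_pos_iff.2 hz
  rw [regKernel, h1, norm_mul, norm_inv, norm_inv, RCLike.norm_conj, Complex.norm_real,
    Real.norm_of_nonneg (by positivity), ← div_eq_mul_inv, div_le_iff₀ (by positivity),
    inv_mul_eq_div, le_div_iff₀ hz']
  nlinarith [sq_nonneg ε]

/-- The Cauchy-Pompeiu formula for compactly supported functions. -/
theorem integral_wirtingerBar_mul_inv {h : ℂ → ℂ} (hh : ContDiff ℝ 1 h)
    (hc : HasCompactSupport h) : ∫ z, wirtingerBar h z * z⁻¹ = -Real.pi * h 0 := by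
  let e : ℕ → ℝ := fun n => 1 / ((n : ℝ) + 1)
  have he : ∀ n, 0 < e n := fun n => by positivity
  have he0 : Tendsto e atTop (𝓝 0) := tendsto_one_div_add_atTop_nhds_zero_nat
  have hcd := continuous_wirtingerBar hh
  have hint0 : Integrable (fun z => wirtingerBar h z * z⁻¹) := by
    have := locallyIntegrable_inv.integrable_smul_left_of_hasCompactSupport hcd
      (hasCompactSupport_wirtingerBar hc)
    simpa using this
  have hcont : ∀ n, Continuous (regKernel (e n)) := fun n => (contDiff_regKernel (he n)).continuous
  have hL : Tendsto (fun n => ∫ z, wirtingerBar h z * regKernel (e n) z) atTop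
      (𝓝 (∫ z, wirtingerBar h z * z⁻¹)) := by
    refine tendsto_integral_of_dominated_convergence (fun z => ‖wirtingerBar h z * z⁻¹‖)
      (fun n => (hcd.mul (hcont n)).aestronglyMeasurable) hint0.norm (fun n => .of_forall fun z => ?_)
      (.of_forall fun z => ?_)
    · rw [norm_mul, norm_mul]
      exact mul_le_mul_of_nonneg_left (norm_regKernel_le (he n) z) (norm_nonneg _)
    · refine Tendsto.const_mul _ ?_
      rcases eq_or_ne z 0 with rfl | hz
      · simp [regKernel]
      have hz2 : z * conj z ≠ 0 := by simpa using hz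
      have h1 : Tendsto (fun n => z * conj z + ((e n : ℝ) : ℂ) ^ 2) atTop (𝓝 (z * conj z)) := by
        have := ((Complex.continuous_ofReal.tendsto 0).comp he0).pow 2
        simpa using this.const_add (z * conj z)
      have h2 := (h1.inv₀ hz2).const_mul (conj z)
      refine h2.congr' (.of_forall fun n => rfl) |>.trans_eq ?_
      congr 1
      have : conj z ≠ 0 := by simpa using hz
      field_simp
  -- Integrate ∂̄(h · `regKernel`), whose integral over the plane is zero, and rescale z by `e n` in
  -- the term in which the kernel is differentiated.
  have hR : ∀ n, ∫ z, wirtingerBar h z * regKernel (e n) z =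
      -∫ z, h ((e n : ℝ) • z) * ((((1 + ‖z‖ ^ 2) ^ 2)⁻¹ : ℝ) : ℂ) := by
    intro n
    have hsm : ContDiff ℝ 1 (fun z => h z * regKernel (e n) z) :=
      hh.mul ((contDiff_regKernel (he n)).of_le (by norm_cast))
    have h0 := integral_wirtingerBar_eq_zero hsm hc.mul_right
    have hd : ∀ z, wirtingerBar (fun z => h z * regKernel (e n) z) z =
        wirtingerBar h z * regKernel (e n) z +
          h z * ((e n : ℂ) ^ 2 * ((z * conj z + (e n : ℂ) ^ 2) ^ 2)⁻¹) := fun z =>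
      ((hasDbarAt_of_contDiff hh z).mul (hasDbarAt_regKernel (he n) z)).2
    have hcont2 : Continuous fun z : ℂ => ((e n : ℂ) ^ 2 * ((z * conj z + (e n : ℂ) ^ 2) ^ 2)⁻¹) := by
      refine continuous_const.mul (Continuous.inv₀ (by fun_prop) fun z => ?_)
      exact pow_ne_zero _ (mul_conj_add_ne_zero _ (he n) z)
    simp only [hd] at h0
    have i1 : Integrable fun z => wirtingerBar h z * regKernel (e n) z :=
      (hcd.mul (hcont n)).integrable_of_hasCompactSupport
        (hasCompactSupport_wirtingerBar hc).mul_right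
    have i2 : Integrable fun z : ℂ =>
        h z * ((e n : ℂ) ^ 2 * ((z * conj z + (e n : ℂ) ^ 2) ^ 2)⁻¹) :=
      (hh.continuous.mul hcont2).integrable_of_hasCompactSupport hc.mul_right
    rw [integral_add i1 i2] at h0
    rw [eq_neg_of_add_eq_zero_left h0]
    congr 1
    have hs := Measure.integral_comp_smul (volume : Measure ℂ)
      (fun z => h z * ((e n : ℂ) ^ 2 * ((z * conj z + (e n : ℂ) ^ 2) ^ 2)⁻¹)) (e n)
    have hen := (he n).ne'
    have hen' : (e n : ℂ) ≠ 0 := by exact_mod_cast hen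
    rw [Complex.finrank_real_complex, abs_of_nonneg (by positivity)] at hs
    have hs2 := congrArg (fun w : ℂ => (e n ^ 2 : ℝ) • w) hs
    simp only [smul_smul] at hs2
    rw [mul_inv_cancel₀ (by positivity), one_smul] at hs2
    rw [← hs2, ← integral_smul]
    refine integral_congr_ae (.of_forall fun z => ?_)
    simp only [Complex.real_smul, map_mul, Complex.conj_ofReal]
    have h1 : (e n : ℂ) * z * (e n * conj z) + (e n : ℂ) ^ 2 =
        (e n : ℂ) ^ 2 * (1 + (‖z‖ : ℂ) ^ 2) := by
      have : z * conj z = (‖z‖ : ℂ) ^ 2 := by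
        rw [Complex.mul_conj, Complex.normSq_eq_norm_sq]; push_cast; ring
      linear_combination (e n : ℂ) ^ 2 * this
    have h3 : (1 + (‖z‖ : ℂ) ^ 2) ≠ 0 := by
      norm_cast; positivity
    rw [h1]
    push_cast
    field_simp
  have hlim : Tendsto (fun n => -∫ z, h ((e n : ℝ) • z) * ((((1 + ‖z‖ ^ 2) ^ 2)⁻¹ : ℝ) : ℂ)) atTop
      (𝓝 (-∫ z : ℂ, h 0 * ((((1 + ‖z‖ ^ 2) ^ 2)⁻¹ : ℝ) : ℂ))) := by
    obtain ⟨C, hC⟩ := hc.exists_bound_of_continuous hh.continuous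
    have hI : Integrable (fun z : ℂ => ((1 + ‖z‖ ^ 2) ^ 2)⁻¹) := by
      refine Integrable.of_integral_ne_zero ?_
      rw [integral_one_add_norm_sq]; exact Real.pi_ne_zero
    refine (tendsto_integral_of_dominated_convergence (fun z => C * ((1 + ‖z‖ ^ 2) ^ 2)⁻¹)
      (fun n => ?_) (hI.const_mul C) (fun n => .of_forall fun z => ?_) (.of_forall fun z => ?_)).neg
    · have : Continuous fun z : ℂ => ((((1 + ‖z‖ ^ 2) ^ 2)⁻¹ : ℝ) : ℂ) := by
        refine Complex.continuous_ofReal.comp (Continuous.inv₀ (by fun_prop) fun z => ?_)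
        positivity
      exact ((hh.continuous.comp (by fun_prop)).mul this).aestronglyMeasurable
    · rw [norm_mul, Complex.norm_real, Real.norm_of_nonneg (by positivity)]
      exact mul_le_mul_of_nonneg_right (hC _) (by positivity)
    · refine Tendsto.mul_const _ ?_
      have h1 : Tendsto (fun n => (e n) • z) atTop (𝓝 0) := by
        simpa using he0.smul_const z
      exact (hh.continuous.tendsto 0).comp h1
  have := tendsto_nhds_unique hL (hlim.congr fun n => (hR n).symm)
  have h3 : ∫ z : ℂ, ((((1 + ‖z‖ ^ 2) ^ 2)⁻¹ : ℝ) : ℂ) = Real.pi := by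
    rw [integral_complex_ofReal, integral_one_add_norm_sq]
  rw [this, integral_const_mul, h3]
  ring

/-- The Cauchy transform `v ↦ (1/π) ∫ h(ζ) / (v - ζ) dA(ζ)`. -/
def cauchyT (h : ℂ → ℂ) (v : ℂ) : ℂ := (1 / (Real.pi : ℂ)) * ∫ ζ, h ζ * (v - ζ)⁻¹

theorem cauchyT_eq_convolution (h : ℂ → ℂ) :
    cauchyT h = fun v => (1 / (Real.pi : ℂ)) *
      (convolution (fun ζ : ℂ => ζ⁻¹) h (ContinuousLinearMap.mul ℝ ℂ) volume) v := by
  funext v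
  rw [cauchyT, convolution_eq_swap]
  simp [mul_comm]

theorem contDiff_cauchyT {h : ℂ → ℂ} (hh : ContDiff ℝ ∞ h) (hc : HasCompactSupport h) :
    ContDiff ℝ ∞ (cauchyT h) := by
  rw [cauchyT_eq_convolution]
  exact contDiff_const.mul (hc.contDiff_convolution_right _ locallyIntegrable_inv hh)

/-- In the convolution with 1/ζ the derivative falls on `h`. What remains is the Cauchy–Pompeiu
integral of s ↦ h(v − s), evaluated at s = 0. -/
theorem wirtingerBar_cauchyT {h : ℂ → ℂ} (hh : ContDiff ℝ ∞ h) (hc : HasCompactSupport h)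
    (v : ℂ) : wirtingerBar (cauchyT h) v = h v := by
  have hh1 : ContDiff ℝ 1 h := hh.of_le (by norm_cast)
  have hd := (hc.hasFDerivAt_convolution_right (ContinuousLinearMap.mul ℝ ℂ)
    locallyIntegrable_inv hh1 v).const_mul (1 / (Real.pi : ℂ))
  have hcf := hh1.continuous_fderiv one_ne_zero
  have hcs : HasCompactSupport (fderiv ℝ h) := hc.fderiv ℝ
  have hval : ∀ e : ℂ, fderiv ℝ (cauchyT h) v e =
      (1 / (Real.pi : ℂ)) * ∫ t, t⁻¹ * fderiv ℝ h (v - t) e := by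
    intro e
    rw [cauchyT_eq_convolution, hd.fderiv, smul_apply,
      convolution_precompR_apply _ locallyIntegrable_inv hcs hcf]
    simp [convolution]
  have hint : ∀ e : ℂ, Integrable fun t : ℂ => t⁻¹ * fderiv ℝ h (v - t) e := by
    intro e
    have hc1 : HasCompactSupport fun t => fderiv ℝ h (v - t) e :=
      (hc.fderiv_apply (𝕜 := ℝ) e).comp_homeomorph (Homeomorph.subLeft v)
    have := locallyIntegrable_inv.integrable_smul_right_of_hasCompactSupport
      (g := fun t => fderiv ℝ h (v - t) e) (by fun_prop) hc1
    simpa using this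
  have hk : ContDiff ℝ 1 (fun s => h (v - s)) := hh1.comp (by fun_prop)
  have hkc : HasCompactSupport (fun s => h (v - s)) := hc.comp_homeomorph (Homeomorph.subLeft v)
  have hcp := integral_wirtingerBar_mul_inv hk hkc
  have hkd : ∀ s, wirtingerBar (fun s => h (v - s)) s = -wirtingerBar h (v - s) := by
    intro s
    have : HasFDerivAt (fun s => h (v - s)) _ s :=
      ((hh1.differentiable one_ne_zero).differentiableAt (x := v - s)).hasFDerivAt.comp s
        ((hasFDerivAt_id s).const_sub v)
    rw [wirtingerBar, this.fderiv]
    simp [wirtingerBar]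
    ring
  rw [wirtingerBar, hval, hval]
  have hsum : (∫ t, t⁻¹ * fderiv ℝ h (v - t) 1) +
      Complex.I * ∫ t, t⁻¹ * fderiv ℝ h (v - t) Complex.I = 2 * (Real.pi * h v) := by
    rw [← integral_const_mul, ← integral_add (hint 1) ((hint _).const_mul _)]
    simp only [hkd, sub_zero, neg_mul, integral_neg, neg_inj] at hcp
    rw [← hcp, ← integral_const_mul]
    refine integral_congr_ae (.of_forall fun t => ?_)
    simp [wirtingerBar]
    ring
  have hpi : (Real.pi : ℂ) ≠ 0 := by exact_mod_cast Real.pi_ne_zero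
  have : 1 / (Real.pi : ℂ) * (∫ t, t⁻¹ * fderiv ℝ h (v - t) 1) + Complex.I *
      (1 / (Real.pi : ℂ) * ∫ t, t⁻¹ * fderiv ℝ h (v - t) Complex.I) = 2 * h v := by
    have h2 := congrArg (fun w => 1 / (Real.pi : ℂ) * w) hsum
    simp only [mul_add] at h2
    rw [mul_left_comm Complex.I, h2]
    field_simp
  rw [this]; ring

/-- Away from the support of the density the Cauchy transform is analytic. -/
theorem analyticAt_cauchyT {h : ℂ → ℂ} (hi : Integrable h) {v₀ : ℂ} (h0 : h =ᶠ[𝓝 v₀] 0) :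
    AnalyticAt ℂ (cauchyT h) v₀ := by
  obtain ⟨δ, hδ, hb⟩ := Metric.eventually_nhds_iff_ball.1 h0
  have key : ∀ v ∈ Metric.ball v₀ (δ / 2), DifferentiableAt ℂ (cauchyT h) v := by
    intro v hv
    have hfar : ∀ x ∈ Metric.ball v₀ (δ / 2), ∀ ζ, h ζ ≠ 0 → δ / 2 ≤ ‖x - ζ‖ := by
      intro x hx ζ hζ
      have h1 : δ ≤ dist ζ v₀ := by
        by_contra hlt
        exact hζ (hb ζ (by simpa using hlt))
      have h2 : dist ζ v₀ ≤ dist ζ x + dist x v₀ := dist_triangle _ _ _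
      rw [Metric.mem_ball] at hx
      rw [← dist_eq_norm, dist_comm]
      linarith
    have hmeas : ∀ x, AEStronglyMeasurable (fun ζ => h ζ * (x - ζ)⁻¹) := fun x =>
      hi.aestronglyMeasurable.mul (by fun_prop : Measurable fun ζ : ℂ => (x - ζ)⁻¹).aestronglyMeasurable
    have hD := (hasDerivAt_integral_of_dominated_loc_of_deriv_le (μ := volume)
      (F := fun x ζ => h ζ * (x - ζ)⁻¹) (F' := fun x ζ => h ζ * (-((x - ζ) ^ 2)⁻¹)) (x₀ := v)
      (s := Metric.ball v₀ (δ / 2)) (bound := fun ζ => ‖h ζ‖ * ((δ / 2) ^ 2)⁻¹)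
      (Metric.isOpen_ball.mem_nhds hv) (.of_forall fun x => hmeas x) ?_ ?_ ?_ ?_ ?_).2
    · exact (hD.const_mul (1 / (Real.pi : ℂ))).differentiableAt
    · refine (hi.norm.mul_const (δ / 2)⁻¹).mono' (hmeas v) (.of_forall fun ζ => ?_)
      rw [norm_mul, norm_inv]
      by_cases hζ : h ζ = 0
      · simp [hζ]
      · exact mul_le_mul_of_nonneg_left
          (inv_anti₀ (by positivity) (hfar v hv ζ hζ)) (norm_nonneg _)
    · exact hi.aestronglyMeasurable.mul
        (by fun_prop : Measurable fun ζ : ℂ => -((v - ζ) ^ 2)⁻¹).aestronglyMeasurable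
    · refine .of_forall fun ζ x hx => ?_
      rw [norm_mul, norm_neg, norm_inv, norm_pow]
      by_cases hζ : h ζ = 0
      · simp [hζ]
      · exact mul_le_mul_of_nonneg_left (inv_anti₀ (by positivity)
          (pow_le_pow_left₀ (by positivity) (hfar x hx ζ hζ) 2)) (norm_nonneg _)
    · exact hi.norm.mul_const _
    · refine .of_forall fun ζ x hx => ?_
      by_cases hζ : h ζ = 0
      · simpa [hζ] using hasDerivAt_const x (0 : ℂ)
      · have hne : x - ζ ≠ 0 := by
          have := hfar x hx ζ hζ
          rw [← norm_pos_iff]; linarith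
        have h1 : HasDerivAt (fun x => x - ζ) 1 x := (hasDerivAt_id x).sub_const ζ
        have h2 := (h1.inv hne).const_mul (h ζ)
        refine h2.congr_deriv ?_
        rw [neg_div, one_div]
  refine DifferentiableOn.analyticAt (s := Metric.ball v₀ (δ / 2))
    (fun v hv => (key v hv).differentiableWithinAt) (Metric.isOpen_ball.mem_nhds ?_)
  simp [hδ]

theorem integrable_mul_cauchyKernel {h : ℂ → ℂ} (hh : Continuous h) (hc : HasCompactSupport h)
    (v : ℂ) : Integrable fun ζ => h ζ * (v - ζ)⁻¹ := by
  have := locallyIntegrable_inv.integrable_smul_right_of_hasCompactSupport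
    (g := fun t => h (v - t)) (by fun_prop) (hc.comp_homeomorph (Homeomorph.subLeft v))
  have h2 := this.comp_sub_left v
  simpa [mul_comm] using h2

/-- The Cauchy transform solves the `∂̄`-equation where the density is smooth. -/
theorem cauchyT_local {h : ℂ → ℂ} (hi : Integrable h) {v₀ : ℂ} {r : ℝ} (hr : 0 < r)
    (hs : ContDiffOn ℝ ∞ h (Metric.ball v₀ r))
    (hk : ∀ᶠ v in 𝓝 v₀, Integrable fun ζ => h ζ * (v - ζ)⁻¹) :
    ContDiffAt ℝ ∞ (cauchyT h) v₀ ∧ wirtingerBar (cauchyT h) v₀ = h v₀ := by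
  -- Split h = χh + (h − χh). The first part is smooth with compact support; the second vanishes
  -- near `v₀`, so its Cauchy transform is analytic there and contributes nothing to ∂̄.
  let χ : ContDiffBump v₀ := ⟨r / 4, r / 2, by positivity, by linarith⟩
  have hsub : tsupport χ ⊆ Metric.ball v₀ r := by
    rw [χ.tsupport_eq]
    exact Metric.closedBall_subset_ball (by simp [χ]; linarith)
  let h₁ : ℂ → ℂ := fun ζ => (χ ζ : ℂ) * h ζ
  have hχ : ContDiff ℝ ∞ (fun ζ => ((χ ζ : ℝ) : ℂ)) := Complex.ofRealCLM.contDiff.comp χ.contDiff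
  have h1 : ContDiff ℝ ∞ h₁ := by
    rw [contDiff_iff_contDiffAt]
    intro ζ
    by_cases hζ : ζ ∈ tsupport χ
    · exact hχ.contDiffAt.mul ((hs ζ (hsub hζ)).contDiffAt (Metric.isOpen_ball.mem_nhds (hsub hζ)))
    · have : h₁ =ᶠ[𝓝 ζ] fun _ => 0 := by
        filter_upwards [(isClosed_tsupport χ).isOpen_compl.mem_nhds hζ] with x hx
        simp [h₁, image_eq_zero_of_notMem_tsupport hx]
      exact contDiffAt_const.congr_of_eventuallyEq this
  have hc1 : HasCompactSupport h₁ := by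
    refine HasCompactSupport.mul_right ?_
    exact χ.hasCompactSupport.comp_left (g := fun x : ℝ => (x : ℂ)) (by simp)
  have hi1 : Integrable h₁ := h1.continuous.integrable_of_hasCompactSupport hc1
  have hk1 := integrable_mul_cauchyKernel h1.continuous hc1
  have hA : AnalyticAt ℂ (cauchyT fun ζ => h ζ - h₁ ζ) v₀ := by
    refine analyticAt_cauchyT (hi.sub hi1) ?_
    filter_upwards [χ.eventuallyEq_one] with ζ hζ
    simp [h₁, hζ]
  have hsplit : cauchyT h =ᶠ[𝓝 v₀]
      fun v => cauchyT h₁ v + cauchyT (fun ζ => h ζ - h₁ ζ) v := by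
    filter_upwards [hk] with v hk
    simp only [cauchyT, ← mul_add, sub_mul]
    have i2 : Integrable fun ζ => h ζ * (v - ζ)⁻¹ - h₁ ζ * (v - ζ)⁻¹ := hk.sub (hk1 v)
    rw [← integral_add (hk1 v) i2]
    congr 1
    exact integral_congr_ae (.of_forall fun ζ => by ring)
  have hd1 : HasDbarAt (cauchyT h₁) (h₁ v₀) v₀ :=
    ⟨((contDiff_cauchyT h1 hc1).differentiable (by simp)).differentiableAt,
      wirtingerBar_cauchyT h1 hc1 v₀⟩
  refine ⟨((contDiff_cauchyT h1 hc1).contDiffAt.add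
    (hA.contDiffAt.restrict_scalars ℝ)).congr_of_eventuallyEq hsplit, ?_⟩
  rw [((hd1.add (hasDbarAt_of_holo hA.differentiableAt)).congr_of_eventuallyEq hsplit).2]
  have : χ v₀ = 1 := χ.eventuallyEq_one.self_of_nhds
  simp [h₁, this]

end CauchyTransform

/-! ### Exponents of densities: bounds, regularity and ∂̄ -/

section Density

/-- A measurable density with values in `[0, 1]` that vanishes outside the disc of radius `R`. -/
structure IsDensity (R : ℝ) (g : ℂ → ℝ) : Prop where
  meas : Measurable g
  nonneg : ∀ ζ, 0 ≤ g ζ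
  le_one : ∀ ζ, g ζ ≤ 1
  zero : ∀ ζ, R ≤ ‖ζ‖ → g ζ = 0

/-- The exponent `(1/π) ∫ g(ζ) / ((ζ - u) (ζ̄ - v̄)) dA(ζ)`. -/
def cpair (g : ℂ → ℝ) (u v : ℂ) : ℂ :=
  (1 / (Real.pi : ℂ)) * ∫ ζ, (g ζ : ℂ) * ((ζ - u) * (conj ζ - conj v))⁻¹

variable {R : ℝ} {g : ℂ → ℝ}

theorem norm_conj_sub_conj (ζ v : ℂ) : ‖conj ζ - conj v‖ = ‖ζ - v‖ := by
  rw [← map_sub, RCLike.norm_conj]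

theorem IsDensity.aestronglyMeasurable (hg : IsDensity R g) (u v : ℂ) :
    AEStronglyMeasurable (fun ζ => (g ζ : ℂ) * ((ζ - u) * (conj ζ - conj v))⁻¹) := by
  have := hg.meas
  have h : Measurable fun ζ : ℂ => conj ζ := Complex.continuous_conj.measurable
  exact (by fun_prop : Measurable _).aestronglyMeasurable

theorem IsDensity.norm_cauchy_le (hg : IsDensity R g) (u ζ : ℂ) :
    g ζ * ‖ζ - u‖⁻¹ ≤ cauchyMajorant R u ζ := by
  by_cases h : ‖ζ‖ < R
  · exact (mul_le_of_le_one_left (by positivity) (hg.le_one ζ)).trans (inv_norm_le_cauchyMajorant h)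
  · rw [hg.zero ζ (not_lt.1 h), zero_mul]
    exact cauchyMajorant_nonneg R u ζ

theorem IsDensity.norm_integrand (hg : IsDensity R g) (u v ζ : ℂ) :
    ‖(g ζ : ℂ) * ((ζ - u) * (conj ζ - conj v))⁻¹‖ = g ζ * (‖ζ - u‖⁻¹ * ‖ζ - v‖⁻¹) := by
  rw [norm_mul, norm_inv, norm_mul, Complex.norm_real, Real.norm_of_nonneg (hg.nonneg ζ),
    norm_conj_sub_conj, mul_inv]

/-- Partial fractions in absolute value: |u − v| ≤ |ζ − u| + |ζ − v| separates the two poles into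
two integrable ones. -/
theorem IsDensity.norm_integrand_le_of_ne (hg : IsDensity R g) {u v : ℂ} (huv : u ≠ v) (ζ : ℂ) :
    ‖(g ζ : ℂ) * ((ζ - u) * (conj ζ - conj v))⁻¹‖ ≤
      ‖u - v‖⁻¹ * (cauchyMajorant R u ζ + cauchyMajorant R v ζ) := by
  rw [hg.norm_integrand]
  have hd : 0 < ‖u - v‖ := norm_pos_iff.2 (sub_ne_zero.2 huv)
  have key : ‖ζ - u‖⁻¹ * ‖ζ - v‖⁻¹ ≤ ‖u - v‖⁻¹ * (‖ζ - u‖⁻¹ + ‖ζ - v‖⁻¹) := by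
    -- At a pole the convention `0⁻¹ = 0` makes the left side vanish.
    rcases (norm_nonneg (ζ - u)).eq_or_lt with h1 | h1
    · rw [← h1]; simp; positivity
    rcases (norm_nonneg (ζ - v)).eq_or_lt with h2 | h2
    · rw [← h2]; simp; positivity
    have htri : ‖u - v‖ ≤ ‖ζ - u‖ + ‖ζ - v‖ := by
      have := norm_sub_le (ζ - v) (ζ - u)
      rw [show ζ - v - (ζ - u) = u - v by ring] at this
      linarith
    rw [inv_mul_eq_div ‖u - v‖, le_div_iff₀ hd]
    have : ‖ζ - u‖⁻¹ + ‖ζ - v‖⁻¹ = ‖ζ - u‖⁻¹ * ‖ζ - v‖⁻¹ * (‖ζ - u‖ + ‖ζ - v‖) := by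
      field_simp; ring
    rw [this]
    exact mul_le_mul_of_nonneg_left htri (by positivity)
  calc g ζ * (‖ζ - u‖⁻¹ * ‖ζ - v‖⁻¹)
      ≤ g ζ * (‖u - v‖⁻¹ * (‖ζ - u‖⁻¹ + ‖ζ - v‖⁻¹)) := mul_le_mul_of_nonneg_left key (hg.nonneg ζ)
    _ = ‖u - v‖⁻¹ * (g ζ * ‖ζ - u‖⁻¹ + g ζ * ‖ζ - v‖⁻¹) := by ring
    _ ≤ _ := mul_le_mul_of_nonneg_left
        (add_le_add (hg.norm_cauchy_le u ζ) (hg.norm_cauchy_le v ζ)) (by positivity)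

/-- When the density stays away from `v`, only the pole at `u` counts, and u = v is allowed. This
covers the diagonal of the exterior kernel. -/
theorem IsDensity.norm_integrand_le_right (hg : IsDensity R g) {u v : ℂ} {δ : ℝ} (hδ : 0 < δ)
    (hv : ∀ ζ ∈ Metric.ball v δ, g ζ = 0) (ζ : ℂ) :
    ‖(g ζ : ℂ) * ((ζ - u) * (conj ζ - conj v))⁻¹‖ ≤ δ⁻¹ * cauchyMajorant R u ζ := by
  rw [hg.norm_integrand]
  by_cases h : ζ ∈ Metric.ball v δ
  · rw [hv ζ h, zero_mul]
    exact mul_nonneg (by positivity) (cauchyMajorant_nonneg _ _ _)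
  · have h1 : δ ≤ ‖ζ - v‖ := by simpa [dist_eq_norm] using h
    calc g ζ * (‖ζ - u‖⁻¹ * ‖ζ - v‖⁻¹) = (g ζ * ‖ζ - u‖⁻¹) * ‖ζ - v‖⁻¹ := by ring
      _ ≤ cauchyMajorant R u ζ * δ⁻¹ := mul_le_mul (hg.norm_cauchy_le u ζ)
        (inv_anti₀ hδ h1) (by positivity) (cauchyMajorant_nonneg _ _ _)
      _ = _ := mul_comm _ _

theorem IsDensity.integrable_of_ne (hg : IsDensity R g) {u v : ℂ} (huv : u ≠ v) :
    Integrable fun ζ => (g ζ : ℂ) * ((ζ - u) * (conj ζ - conj v))⁻¹ :=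
  (((integrable_cauchyMajorant R u).add (integrable_cauchyMajorant R v)).const_mul _).mono'
    (hg.aestronglyMeasurable u v) (.of_forall (hg.norm_integrand_le_of_ne huv))

theorem IsDensity.integrable_right (hg : IsDensity R g) (u : ℂ) {v : ℂ} {δ : ℝ} (hδ : 0 < δ)
    (hv : ∀ ζ ∈ Metric.ball v δ, g ζ = 0) :
    Integrable fun ζ => (g ζ : ℂ) * ((ζ - u) * (conj ζ - conj v))⁻¹ :=
  ((integrable_cauchyMajorant R u).const_mul _).mono'
    (hg.aestronglyMeasurable u v) (.of_forall (hg.norm_integrand_le_right hδ hv))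

theorem norm_cpair_le_integral {u v : ℂ} {b : ℂ → ℝ} (hb : Integrable b)
    (h : ∀ ζ, ‖(g ζ : ℂ) * ((ζ - u) * (conj ζ - conj v))⁻¹‖ ≤ b ζ) :
    ‖cpair g u v‖ ≤ ∫ ζ, b ζ := by
  have h1 := norm_integral_le_of_norm_le hb (.of_forall h)
  rw [cpair, norm_mul]
  have h2 : ‖(1 / (Real.pi : ℂ))‖ ≤ 1 := by
    rw [norm_div, norm_one, Complex.norm_real, Real.norm_of_nonneg Real.pi_pos.le, div_le_one
      Real.pi_pos]
    linarith [Real.pi_gt_three]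
  exact (mul_le_of_le_one_left (norm_nonneg _) h2).trans h1

theorem IsDensity.norm_cpair_le_of_ne (hg : IsDensity R g) {u v : ℂ} (huv : u ≠ v) :
    ‖cpair g u v‖ ≤ ‖u - v‖⁻¹ * (2 * cauchyBound R) := by
  refine (norm_cpair_le_integral (((integrable_cauchyMajorant R u).add
    (integrable_cauchyMajorant R v)).const_mul _) (hg.norm_integrand_le_of_ne huv)).trans_eq ?_
  have := integral_add (integrable_cauchyMajorant R u) (integrable_cauchyMajorant R v)
  simp only [Pi.add_apply]
  rw [integral_const_mul, this, integral_cauchyMajorant, integral_cauchyMajorant]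
  ring

theorem IsDensity.norm_cpair_le_right (hg : IsDensity R g) (u : ℂ) {v : ℂ} {δ : ℝ} (hδ : 0 < δ)
    (hv : ∀ ζ ∈ Metric.ball v δ, g ζ = 0) : ‖cpair g u v‖ ≤ δ⁻¹ * cauchyBound R := by
  refine (norm_cpair_le_integral ((integrable_cauchyMajorant R u).const_mul _)
    (hg.norm_integrand_le_right hδ hv)).trans_eq ?_
  rw [integral_const_mul, integral_cauchyMajorant]

theorem conj_cpair (g : ℂ → ℝ) (u v : ℂ) : conj (cpair g u v) = cpair g v u := by
  rw [cpair, cpair, map_mul, ← integral_conj]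
  congr 1
  · simp
  · refine integral_congr_ae (.of_forall fun ζ => ?_)
    simp [mul_comm]

/-- With `v` frozen the exponent is a Cauchy transform in `u`; analyticity, smoothness and the
∂̄-equation are inherited from there. -/
theorem cpair_eq_neg_cauchyT (g : ℂ → ℝ) (u v : ℂ) :
    cpair g u v = -cauchyT (fun ζ => (g ζ : ℂ) * (conj ζ - conj v)⁻¹) u := by
  rw [cpair, cauchyT, ← mul_neg, ← integral_neg]
  congr 1
  refine integral_congr_ae (.of_forall fun ζ => ?_)
  simp only []
  rw [mul_inv, ← neg_sub u ζ, inv_neg]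
  ring

theorem IsDensity.integrable_cauchy (hg : IsDensity R g) (v : ℂ) :
    Integrable fun ζ => (g ζ : ℂ) * (conj ζ - conj v)⁻¹ := by
  have := hg.meas
  have h : Measurable fun ζ : ℂ => conj ζ := Complex.continuous_conj.measurable
  refine (integrable_cauchyMajorant R v).mono' (by fun_prop : Measurable _).aestronglyMeasurable
    (.of_forall fun ζ => ?_)
  rw [norm_mul, norm_inv, norm_conj_sub_conj, Complex.norm_real,
    Real.norm_of_nonneg (hg.nonneg ζ)]
  exact hg.norm_cauchy_le v ζ

theorem IsDensity.analyticAt_cpair (hg : IsDensity R g) {u : ℂ} (v : ℂ) {δ : ℝ} (hδ : 0 < δ)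
    (hu : ∀ ζ ∈ Metric.ball u δ, g ζ = 0) : AnalyticAt ℂ (fun u => cpair g u v) u := by
  simp only [cpair_eq_neg_cauchyT]
  refine (analyticAt_cauchyT (hg.integrable_cauchy v) ?_).neg
  filter_upwards [Metric.ball_mem_nhds u hδ] with ζ hζ
  simp [hu ζ hζ]

/-- Smoothness and `∂̄` of the exponent at points where the density is smooth. -/
theorem IsDensity.cpair_local (hg : IsDensity R g) {u v : ℂ} {r : ℝ} (hr : 0 < r)
    (hs : ContDiffOn ℝ ∞ (fun ζ => (g ζ : ℂ) * (conj ζ - conj v)⁻¹) (Metric.ball u r))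
    (hv : u ≠ v ∨ ∃ δ > 0, ∀ ζ ∈ Metric.ball v δ, g ζ = 0) :
    ContDiffAt ℝ ∞ (fun u => cpair g u v) u ∧
      HasDbarAt (fun u => cpair g u v) (-((g u : ℂ) * (conj u - conj v)⁻¹)) u := by
  have hk : ∀ᶠ x in 𝓝 u, Integrable fun ζ =>
      (g ζ : ℂ) * (conj ζ - conj v)⁻¹ * (x - ζ)⁻¹ := by
    have e : ∀ x ζ : ℂ, (g ζ : ℂ) * (conj ζ - conj v)⁻¹ * (x - ζ)⁻¹ =
        -((g ζ : ℂ) * ((ζ - x) * (conj ζ - conj v))⁻¹) := fun x ζ => by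
      rw [mul_inv, ← neg_sub ζ x, inv_neg]; ring
    simp only [e]
    rcases hv with hv | ⟨δ, hδ, hv⟩
    · filter_upwards [isOpen_ne.mem_nhds hv] with x hx
      exact (hg.integrable_of_ne hx).neg
    · exact .of_forall fun x => (hg.integrable_right x hδ hv).neg
  obtain ⟨h1, h2⟩ := cauchyT_local (hg.integrable_cauchy v) hr hs hk
  simp only [cpair_eq_neg_cauchyT]
  exact ⟨h1.neg, HasDbarAt.neg ⟨h1.differentiableAt (by simp), h2⟩⟩

end Density

/-! ### Positivity and monotonicity of exp P − 1 on the sphere -/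

section Kernels

open scoped ComplexOrder

/-- The exponent on the sphere, `0` if one of the points is `∞`. -/
def cpairS (g : ℂ → ℝ) (z w : OnePoint ℂ) : ℂ :=
  z.elim 0 fun a => w.elim 0 fun b => cpair g a b

/-- The kernel `exp P - 1` for the exponent `P` of a density. -/
def sphereKer (g : ℂ → ℝ) (z w : OnePoint ℂ) : ℂ := Complex.exp (cpairS g z w) - 1

@[simp] theorem cpairS_coe (g : ℂ → ℝ) (a b : ℂ) : cpairS g a b = cpair g a b := rfl
@[simp] theorem cpairS_infty_left (g : ℂ → ℝ) (w : OnePoint ℂ) :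
    cpairS g OnePoint.infty w = 0 := rfl
@[simp] theorem cpairS_infty_right (g : ℂ → ℝ) (z : OnePoint ℂ) :
    cpairS g z OnePoint.infty = 0 := by
  induction z using OnePoint.rec <;> rfl

theorem conj_cpairS (g : ℂ → ℝ) (z w : OnePoint ℂ) : conj (cpairS g z w) = cpairS g w z := by
  induction z using OnePoint.rec <;> induction w using OnePoint.rec <;> simp [conj_cpair]

/-- The density vanishes near the point of the sphere (no condition at `∞`). -/
def IsFar (g : ℂ → ℝ) (x : OnePoint ℂ) : Prop :=
  ∀ a : ℂ, x = a → ∃ δ > 0, ∀ ζ ∈ Metric.ball a δ, g ζ = 0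

theorem IsFar.mono {g g' : ℂ → ℝ} {x : OnePoint ℂ} (h : IsFar g x) (hz : ∀ ζ, g ζ = 0 → g' ζ = 0) :
    IsFar g' x := fun a ha => by
  obtain ⟨δ, hδ, h⟩ := h a ha
  exact ⟨δ, hδ, fun ζ hζ => hz ζ (h ζ hζ)⟩

/-- The functions whose Gram kernel is the exponent. -/
def poleFun (x : OnePoint ℂ) (ζ : ℂ) : ℂ := x.elim 0 fun a => (ζ - a)⁻¹

/-- This displays the exponent as a Gram kernel in L²(g dA), with the zero function attached to the
point at infinity. -/
theorem cpairS_eq (g : ℂ → ℝ) (x y : OnePoint ℂ) :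
    cpairS g x y = (1 / (Real.pi : ℂ)) * ∫ ζ, (g ζ : ℂ) * (poleFun x ζ * conj (poleFun y ζ)) := by
  induction x using OnePoint.rec with
  | infty => simp [poleFun]
  | coe a =>
    induction y using OnePoint.rec with
    | infty => simp [poleFun]
    | coe b => simp [poleFun, cpair, mul_comm]

theorem IsDensity.integrable_poleFun {R : ℝ} {g : ℂ → ℝ} (hg : IsDensity R g) (x : OnePoint ℂ)
    {y : OnePoint ℂ} (hy : IsFar g y) :
    Integrable fun ζ => (g ζ : ℂ) * (poleFun x ζ * conj (poleFun y ζ)) := by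
  induction x using OnePoint.rec with
  | infty => simp [poleFun]
  | coe a =>
    induction y using OnePoint.rec with
    | infty => simp [poleFun]
    | coe b =>
      obtain ⟨δ, hδ, h⟩ := hy b rfl
      simpa [poleFun, mul_comm] using hg.integrable_right a hδ h

variable {X : Type*} {R : ℝ} {g : ℂ → ℝ}

/-- The quadratic form with coefficients c is (1/π) ∫ g |Σ c̄ₓ/(ζ − p(x))|² dA, with the summands at
infinity absent. `IsFar` makes the entries, including the diagonal ones, convergent integrals. -/
theorem posSemidef_cpairS (hg : IsDensity R g) (p : X → OnePoint ℂ) (hp : ∀ x, IsFar g (p x)) :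
    (Matrix.of fun x y => cpairS g (p x) (p y)).PosSemidef := by
  refine ⟨Matrix.IsHermitian.ext fun x y => ?_, fun c => ?_⟩
  · simpa using conj_cpairS g (p y) (p x)
  have hint : ∀ x y, Integrable fun ζ => star (c x) *
      ((g ζ : ℂ) * (poleFun (p x) ζ * conj (poleFun (p y) ζ))) * c y := fun x y =>
    ((hg.integrable_poleFun (p x) (hp y)).const_mul _).mul_const _
  have h : (c.sum fun i xi => c.sum fun j xj => star xi *
      (Matrix.of fun x y => cpairS g (p x) (p y)) i j * xj) =
      (1 / (Real.pi : ℂ)) * ∫ ζ, (((g ζ * ‖∑ x ∈ c.support, star (c x) * poleFun (p x) ζ‖ ^ 2 : ℝ)) : ℂ) := by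
    have e : ∀ ζ, (((g ζ * ‖∑ x ∈ c.support, star (c x) * poleFun (p x) ζ‖ ^ 2 : ℝ)) : ℂ) =
        ∑ x ∈ c.support, ∑ y ∈ c.support, star (c x) *
          ((g ζ : ℂ) * (poleFun (p x) ζ * conj (poleFun (p y) ζ))) * c y := by
      intro ζ
      push_cast
      rw [← Complex.mul_conj', map_sum, Finset.sum_mul_sum, Finset.mul_sum]
      refine Finset.sum_congr rfl fun x _ => ?_
      rw [Finset.mul_sum]
      refine Finset.sum_congr rfl fun y _ => ?_
      simp; ring
    simp only [e]
    rw [integral_finsetSum _ fun x _ => integrable_finsetSum _ fun y _ => hint x y, Finset.mul_sum]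
    simp only [Finsupp.sum]
    refine Finset.sum_congr rfl fun x _ => ?_
    rw [integral_finsetSum _ fun y _ => hint x y, Finset.mul_sum]
    refine Finset.sum_congr rfl fun y _ => ?_
    rw [integral_mul_const, integral_const_mul, Matrix.of_apply, cpairS_eq]
    ring
  rw [h, integral_complex_ofReal]
  have h1 : 0 ≤ 1 / Real.pi * ∫ ζ, g ζ * ‖∑ x ∈ c.support, star (c x) * poleFun (p x) ζ‖ ^ 2 :=
    mul_nonneg (by positivity) (integral_nonneg fun ζ => mul_nonneg (hg.nonneg ζ) (by positivity))
  exact_mod_cast h1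

theorem posSemidef_of_tendsto {M : ℕ → Matrix X X ℂ} {N : Matrix X X ℂ}
    (hM : ∀ n, (M n).PosSemidef) (h : ∀ x y, Tendsto (fun n => M n x y) atTop (𝓝 (N x y))) :
    N.PosSemidef := by
  refine ⟨Matrix.IsHermitian.ext fun x y => ?_, fun c => ?_⟩
  · have h1 : Tendsto (fun n => star (M n y x)) atTop (𝓝 (star (N y x))) := (h y x).star
    refine tendsto_nhds_unique h1 ?_
    simpa [(hM _).1.apply] using h x y
  · refine ge_of_tendsto (x := atTop) (f := fun n : ℕ =>
      c.sum fun i xi => c.sum fun j xj => star xi * M n i j * xj) ?_ (.of_forall fun n => (hM n).2 c)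
    simp only [Finsupp.sum]
    exact tendsto_finsetSum _ fun i _ => tendsto_finsetSum _ fun j _ =>
      ((h i j).const_mul _).mul_const _

theorem posSemidef_one_entries : (Matrix.of fun _ _ : X => (1 : ℂ)).PosSemidef := by
  refine ⟨Matrix.IsHermitian.ext fun x y => by simp, fun c => ?_⟩
  have : (c.sum fun i xi => c.sum fun j xj => star xi * (Matrix.of fun _ _ : X => (1 : ℂ)) i j * xj)
      = star (∑ i ∈ c.support, c i) * ∑ i ∈ c.support, c i := by
    simp [Finsupp.sum, Finset.sum_mul_sum]
  rw [this]
  exact star_mul_self_nonneg _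

/-- The Hadamard exponential of a positive semidefinite matrix minus the constant term. -/
theorem posSemidef_exp_sub_one {P : Matrix X X ℂ} (hP : P.PosSemidef) :
    (Matrix.of fun x y => Complex.exp (P x y) - 1).PosSemidef := by
  -- By Schur's product theorem all Hadamard powers are positive semidefinite, hence so are the
  -- partial sums of the exponential series without its constant term.
  have hpow : ∀ n : ℕ, (Matrix.of fun x y => (P x y) ^ n).PosSemidef := by
    intro n
    induction n with
    | zero => simpa using posSemidef_one_entries
    | succ n ih =>
      have h := ih.hadamard hP
      have e : (Matrix.of fun x y => (P x y) ^ n).hadamard P =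
          Matrix.of fun x y => (P x y) ^ (n + 1) := by
        ext x y; simp [pow_succ]
      rwa [e] at h
  have hsum : ∀ N : ℕ, (Matrix.of fun x y =>
      ∑ n ∈ Finset.range N, (P x y) ^ (n + 1) / ((n + 1).factorial : ℂ)).PosSemidef := by
    intro N
    have h := Matrix.posSemidef_sum (Finset.range N)
      (x := fun n => (((n + 1).factorial : ℝ)⁻¹ : ℝ) • (Matrix.of fun x y => (P x y) ^ (n + 1)))
      fun n _ => (hpow (n + 1)).smul (by positivity)
    refine (congrArg Matrix.PosSemidef (Matrix.ext fun x y => ?_)).mp h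
    rw [Matrix.sum_apply, Matrix.of_apply]
    refine Finset.sum_congr rfl fun n _ => ?_
    simp [div_eq_inv_mul]
  refine posSemidef_of_tendsto hsum fun x y => ?_
  have h := NormedSpace.expSeries_div_hasSum_exp (P x y)
  rw [← Complex.exp_eq_exp_ℂ] at h
  have h2 := ((hasSum_nat_add_iff' 1).2 h).tendsto_sum_nat
  simpa using h2

theorem posSemidef_sphereKer (hg : IsDensity R g) (p : X → OnePoint ℂ)
    (hp : ∀ x, IsFar g (p x)) : (Matrix.of fun x y => sphereKer g (p x) (p y)).PosSemidef :=
  posSemidef_exp_sub_one (posSemidef_cpairS hg p hp)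

theorem IsDensity.sub {g' : ℂ → ℝ} (hg : IsDensity R g) (hg' : IsDensity R g')
    (h : ∀ ζ, g ζ ≤ g' ζ) : IsDensity R fun ζ => g' ζ - g ζ where
  meas := hg'.meas.sub hg.meas
  nonneg ζ := sub_nonneg.2 (h ζ)
  le_one ζ := by linarith [hg'.le_one ζ, hg.nonneg ζ]
  zero ζ hζ := by rw [hg.zero ζ hζ, hg'.zero ζ hζ, sub_zero]

theorem cpairS_sub {g' : ℂ → ℝ} (hg : IsDensity R g) (hg' : IsDensity R g') (x : OnePoint ℂ)
    {y : OnePoint ℂ} (hy : IsFar g y) (hy' : IsFar g' y) :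
    cpairS (fun ζ => g' ζ - g ζ) x y = cpairS g' x y - cpairS g x y := by
  rw [cpairS_eq, cpairS_eq, cpairS_eq, ← mul_sub,
    ← integral_sub (hg'.integrable_poleFun x hy') (hg.integrable_poleFun x hy)]
  congr 1
  refine integral_congr_ae (.of_forall fun ζ => ?_)
  push_cast
  ring

/-- The kernel increases with the density. -/
theorem posSemidef_sphereKer_sub {g' : ℂ → ℝ} (hg : IsDensity R g) (hg' : IsDensity R g')
    (h : ∀ ζ, g ζ ≤ g' ζ) (p : X → OnePoint ℂ) (hp : ∀ x, IsFar g' (p x)) :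
    (Matrix.of fun x y => sphereKer g' (p x) (p y) - sphereKer g (p x) (p y)).PosSemidef := by
  have hz : ∀ ζ, g' ζ = 0 → g ζ = 0 := fun ζ hζ =>
    le_antisymm ((h ζ).trans_eq hζ) (hg.nonneg ζ)
  have hpg : ∀ x, IsFar g (p x) := fun x => (hp x).mono hz
  -- Entrywise, e^{P'} − e^P = ((e^P − 1) + 1)(e^{P'−P} − 1), and P' − P is the exponent of the
  -- density g' − g ≥ 0. Both factors are positive semidefinite, hence so is their Hadamard product.
  have h1 := posSemidef_exp_sub_one (posSemidef_cpairS (hg.sub hg' h) p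
    fun x => (hp x).mono fun ζ hζ => by rw [hζ, hz ζ hζ, sub_zero])
  have h2 := (posSemidef_sphereKer hg p hpg).add posSemidef_one_entries
  refine (congrArg Matrix.PosSemidef (Matrix.ext fun x y => ?_)).mp (h2.hadamard h1)
  simp only [sphereKer, Matrix.of_apply, Matrix.hadamard_apply, Matrix.add_apply,
    cpairS_sub hg hg' _ (hpg y) (hp y), Complex.exp_sub]
  have := Complex.exp_ne_zero (cpairS g (p x) (p y))
  field_simp
  ring

end Kernels

/-! ### The exponential transform of a disc with one point at the centre -/

section Polar

theorem integrableOn_comp_polarCoord_symm {f : ℂ → ℂ} (hm : Measurable f) (hf : Integrable f) :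
    IntegrableOn (fun p : ℝ × ℝ => p.1 • f (Complex.polarCoord.symm p)) polarCoord.target := by
  have hmp : Measurable fun p : ℝ × ℝ => Complex.polarCoord.symm p := by
    have : (fun p : ℝ × ℝ => Complex.polarCoord.symm p) = fun p : ℝ × ℝ =>
        (p.1 : ℂ) * (Real.cos p.2 + Real.sin p.2 * Complex.I) := by
      funext p; rw [Complex.polarCoord_symm_apply]
    rw [this]
    fun_prop
  refine ⟨(measurable_fst.smul (hm.comp hmp)).aestronglyMeasurable, ?_⟩
  have h := Complex.lintegral_comp_polarCoord_symm fun z => ‖f z‖ₑ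
  have h2 := hf.2
  rw [HasFiniteIntegral, ← h] at h2
  rw [HasFiniteIntegral]
  refine lt_of_eq_of_lt ?_ h2
  refine setLIntegral_congr_fun polarCoord.open_target.measurableSet fun p hp => ?_
  have hp1 : 0 < p.1 := hp.1
  simp only [enorm_smul, smul_eq_mul]
  rw [Real.enorm_of_nonneg hp1.le]

theorem integral_polar {f : ℂ → ℂ} (hm : Measurable f) (hf : Integrable f) :
    ∫ z, f z = ∫ r in Set.Ioi (0 : ℝ), ∫ θ in Set.Ioo (-Real.pi) Real.pi,
      r • f (Complex.polarCoord.symm (r, θ)) := by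
  rw [← Complex.integral_comp_polarCoord_symm]
  exact setIntegral_prod _ (integrableOn_comp_polarCoord_symm hm hf)

/-- This is ∮ dz/(z − a) over |z| = r with dz = i r e^{iθ} dθ; periodicity moves the parameter
interval to (−π, π). -/
theorem integral_circle_cauchy {a : ℂ} {r : ℝ} (hr : 0 < r) (hne : ‖a‖ ≠ r) :
    ∫ θ in Set.Ioo (-Real.pi) Real.pi, Complex.exp (θ * Complex.I) *
      (r * Complex.exp (θ * Complex.I) - a)⁻¹ = if ‖a‖ < r then ((2 * Real.pi / r : ℝ) : ℂ) else 0 := by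
  have hr' : (r : ℂ) ≠ 0 := by exact_mod_cast hr.ne'
  have h1 : (∮ z in C(0, r), (z - a)⁻¹) = if ‖a‖ < r then 2 * Real.pi * Complex.I else 0 := by
    split_ifs with h
    · exact circleIntegral.integral_sub_inv_of_mem_ball (by simpa using h)
    · have h' : r < ‖a‖ := lt_of_le_of_ne (not_lt.1 h) hne.symm
      have hz : ∀ z ∈ Metric.closedBall (0 : ℂ) r, z - a ≠ 0 := by
        intro z hz h0
        rw [sub_eq_zero.1 h0] at hz
        simp at hz; linarith
      refine Complex.circleIntegral_eq_zero_of_differentiable_on_off_countable hr.le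
        Set.countable_empty (ContinuousOn.inv₀ (by fun_prop) hz) fun z hz' => ?_
      exact DifferentiableAt.inv (by fun_prop) (hz z (Metric.ball_subset_closedBall hz'.1))
  have h2 : (∮ z in C(0, r), (z - a)⁻¹) = (r * Complex.I) * ∫ θ in (0 : ℝ)..2 * Real.pi,
      Complex.exp (θ * Complex.I) * (r * Complex.exp (θ * Complex.I) - a)⁻¹ := by
    rw [circleIntegral, ← intervalIntegral.integral_const_mul]
    refine intervalIntegral.integral_congr fun θ _ => ?_
    simp [circleMap]
    ring
  have hper : Function.Periodic (fun θ : ℝ => Complex.exp (θ * Complex.I) *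
      (r * Complex.exp (θ * Complex.I) - a)⁻¹) (2 * Real.pi) := by
    intro θ
    have : Complex.exp (((θ + 2 * Real.pi : ℝ) : ℂ) * Complex.I) = Complex.exp (θ * Complex.I) := by
      push_cast
      rw [add_mul, Complex.exp_add, Complex.exp_two_pi_mul_I, mul_one]
    simp only [this]
  have h3 := hper.intervalIntegral_add_eq (-Real.pi) 0
  rw [zero_add, show -Real.pi + 2 * Real.pi = Real.pi by ring] at h3
  rw [← integral_Ioc_eq_integral_Ioo,
    ← intervalIntegral.integral_of_le (by linarith [Real.pi_pos]), h3]
  rw [h1] at h2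
  have h4 : ∀ J : ℂ, (r * Complex.I) * J = (if ‖a‖ < r then 2 * Real.pi * Complex.I else 0) →
      J = if ‖a‖ < r then ((2 * Real.pi / r : ℝ) : ℂ) else 0 := by
    intro J hJ
    split_ifs at hJ ⊢
    · push_cast
      rw [eq_div_iff hr']
      refine mul_right_cancel₀ Complex.I_ne_zero ?_
      linear_combination hJ
    · have : (r : ℂ) * Complex.I ≠ 0 := mul_ne_zero hr' Complex.I_ne_zero
      simpa [this] using hJ
  exact h4 _ h2.symm

/-- The density of a disc. -/
def discDensity (z : ℂ) (ε : ℝ) : ℂ → ℝ := (Metric.ball z ε).indicator 1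

theorem discDensity_apply (z : ℂ) (ε : ℝ) (ζ : ℂ) :
    discDensity z ε ζ = if ‖ζ - z‖ < ε then 1 else 0 := by
  classical
  simp [discDensity, Set.indicator_apply, dist_eq_norm]

theorem isDensity_discDensity (z : ℂ) {ε R : ℝ} (h : ‖z‖ + ε ≤ R) :
    IsDensity R (discDensity z ε) where
  meas := measurable_one.indicator Metric.isOpen_ball.measurableSet
  nonneg ζ := Set.indicator_nonneg (fun _ _ => zero_le_one) _
  le_one ζ := Set.indicator_le_self' (fun _ _ => zero_le_one) _
  zero ζ hζ := by
    refine Set.indicator_of_notMem (fun hm => ?_) _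
    rw [Metric.mem_ball, dist_eq_norm] at hm
    have := norm_sub_norm_le ζ z
    linarith

/-- On |ζ| = r one has 1/ζ̄ = e^{iθ}/r, so the angular integral is a Cauchy integral: zero for r <
|a| and 2π/r for r > |a|. Radial integration from |a| to ε gives 2π log(ε/|a|). -/
theorem cpair_disc_center {a : ℂ} {ε : ℝ} (ha : a ≠ 0) (hε : ‖a‖ < ε) :
    cpair (discDensity 0 ε) a 0 = ((2 * Real.log (ε / ‖a‖) : ℝ) : ℂ) := by
  have hpos : 0 < ‖a‖ := norm_pos_iff.2 ha
  have hD : IsDensity ε (discDensity 0 ε) := isDensity_discDensity 0 (by simp)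
  have hm := hD.meas
  have hconj : Measurable fun ζ : ℂ => conj ζ := Complex.continuous_conj.measurable
  rw [cpair, integral_polar (by fun_prop) (hD.integrable_of_ne ha)]
  have hinner : ∀ r ∈ Set.Ioi (0 : ℝ), r ≠ ‖a‖ →
      (∫ θ in Set.Ioo (-Real.pi) Real.pi, r • ((discDensity 0 ε (Complex.polarCoord.symm (r, θ)) : ℂ) *
        ((Complex.polarCoord.symm (r, θ) - a) * (conj (Complex.polarCoord.symm (r, θ)) - conj 0))⁻¹))
      = (Set.Ioo ‖a‖ ε).indicator (fun r => ((2 * Real.pi * r⁻¹ : ℝ) : ℂ)) r := by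
    intro r hr hra
    have hr : 0 < r := hr
    have hr' : (r : ℂ) ≠ 0 := by exact_mod_cast hr.ne'
    have e : ∀ θ : ℝ, Complex.polarCoord.symm (r, θ) = r * Complex.exp (θ * Complex.I) := by
      intro θ
      rw [Complex.polarCoord_symm_apply, Complex.exp_mul_I]
      simp
    have hd : ∀ θ : ℝ, discDensity 0 ε (Complex.polarCoord.symm (r, θ)) = if r < ε then 1 else 0 := by
      intro θ
      rw [e, discDensity_apply]
      simp [Complex.norm_exp_ofReal_mul_I, abs_of_pos hr]
    have h1 : ∀ θ : ℝ, r • ((discDensity 0 ε (Complex.polarCoord.symm (r, θ)) : ℂ) *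
        ((Complex.polarCoord.symm (r, θ) - a) * (conj (Complex.polarCoord.symm (r, θ)) - conj 0))⁻¹) =
        (if r < ε then 1 else 0 : ℂ) * (Complex.exp (θ * Complex.I) *
          (r * Complex.exp (θ * Complex.I) - a)⁻¹) := by
      intro θ
      rw [hd, e]
      have hE := Complex.exp_ne_zero (θ * Complex.I)
      have hc : conj (Complex.exp (θ * Complex.I)) = (Complex.exp (θ * Complex.I))⁻¹ := by
        rw [← Complex.exp_conj, ← Complex.exp_neg]
        simp
      rw [map_zero, sub_zero, map_mul, hc, Complex.conj_ofReal, Complex.real_smul]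
      split_ifs
      · simp only [Complex.ofReal_one, one_mul, mul_inv, inv_inv]
        field_simp
      · simp
    simp only [h1]
    rw [integral_const_mul, integral_circle_cauchy hr hra.symm, Set.indicator_apply]
    by_cases h1 : r < ε <;> by_cases h2 : ‖a‖ < r <;> simp [h1, h2, div_eq_mul_inv]
  have hae : ∀ᵐ r ∂(volume.restrict (Set.Ioi (0 : ℝ))), r ≠ ‖a‖ :=
    ae_restrict_of_ae (by simp [ae_iff])
  have hset : (∫ r in Set.Ioi (0 : ℝ), ∫ θ in Set.Ioo (-Real.pi) Real.pi,
      r • ((discDensity 0 ε (Complex.polarCoord.symm (r, θ)) : ℂ) *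
        ((Complex.polarCoord.symm (r, θ) - a) * (conj (Complex.polarCoord.symm (r, θ)) - conj 0))⁻¹))
      = ∫ r in Set.Ioi (0 : ℝ), (Set.Ioo ‖a‖ ε).indicator (fun r => ((2 * Real.pi * r⁻¹ : ℝ) : ℂ)) r := by
    refine integral_congr_ae ?_
    filter_upwards [hae, ae_restrict_mem measurableSet_Ioi] with r h1 h2
    exact hinner r h2 h1
  rw [hset, setIntegral_indicator measurableSet_Ioo,
    show Set.Ioi (0 : ℝ) ∩ Set.Ioo ‖a‖ ε = Set.Ioo ‖a‖ ε from
      Set.inter_eq_right.2 fun r hr => hpos.trans hr.1,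
    integral_complex_ofReal, ← integral_Ioc_eq_integral_Ioo,
    ← intervalIntegral.integral_of_le hε.le, intervalIntegral.integral_const_mul,
    integral_inv_of_pos hpos (hpos.trans hε)]
  have hpi : (Real.pi : ℂ) ≠ 0 := by exact_mod_cast Real.pi_ne_zero
  push_cast
  field_simp

theorem cpair_translate (g : ℂ → ℝ) (u v c : ℂ) :
    cpair (fun ζ => g (ζ - c)) (u + c) (v + c) = cpair g u v := by
  rw [cpair, cpair, ← integral_sub_right_eq_self (fun ζ => (g ζ : ℂ) * ((ζ - u) * (conj ζ - conj v))⁻¹) c]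
  congr 1
  refine integral_congr_ae (.of_forall fun ζ => ?_)
  simp only [map_add, map_sub]
  congr 3 <;> ring

/-- The disc alone produces exactly the factor |v − z|² that cancels the pole of `innerKer` at the
centre. -/
theorem exp_neg_cpair_disc {z v : ℂ} {ε : ℝ} (hv : v ≠ z) (hε : ‖v - z‖ < ε) :
    Complex.exp (-cpair (discDensity z ε) v z) = ((‖v - z‖ ^ 2 / ε ^ 2 : ℝ) : ℂ) := by
  have h := cpair_translate (discDensity 0 ε) (v - z) 0 z
  have e : (fun ζ => discDensity 0 ε (ζ - z)) = discDensity z ε := by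
    funext ζ
    simp [discDensity_apply]
  rw [e, sub_add_cancel, zero_add, cpair_disc_center (sub_ne_zero.2 hv) hε] at h
  have h1 : 0 < ‖v - z‖ := norm_pos_iff.2 (sub_ne_zero.2 hv)
  rw [h, ← Complex.ofReal_neg, ← Complex.ofReal_exp, ← neg_mul, mul_comm, Real.exp_mul,
    Real.exp_log (by have := h1.trans hε; positivity)]
  congr 1
  rw [Real.rpow_neg (by have := h1.trans hε; positivity)]
  norm_cast
  rw [div_pow, inv_div]

end Polar

/-! ### The kernel E/|u − v|²: removable singularity and ∂̄ -/

section InnerKernel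

variable {R : ℝ} {g : ℂ → ℝ}

/-- The kernel `E / |u - v|²` built from the exponential transform of a density. -/
def innerKer (g : ℂ → ℝ) (u v : ℂ) : ℂ :=
  Complex.exp (-cpair g u v) * ((u - v) * (conj u - conj v))⁻¹

theorem conj_innerKer (g : ℂ → ℝ) (u v : ℂ) : conj (innerKer g u v) = innerKer g v u := by
  rw [innerKer, innerKer, map_mul, ← Complex.exp_conj, map_neg, conj_cpair, map_inv₀, map_mul,
    map_sub, map_sub, Complex.conj_conj, Complex.conj_conj]
  congr 2
  ring

theorem IsDensity.disc_of_eq_one (hg : IsDensity R g) {z : ℂ} {ε : ℝ}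
    (h1 : ∀ ζ ∈ Metric.ball z ε, g ζ = 1) : IsDensity R (discDensity z ε) where
  meas := measurable_one.indicator Metric.isOpen_ball.measurableSet
  nonneg ζ := Set.indicator_nonneg (fun _ _ => zero_le_one) _
  le_one ζ := Set.indicator_le_self' (fun _ _ => zero_le_one) _
  zero ζ hζ := Set.indicator_of_notMem (fun hm => by
    have := hg.zero ζ hζ
    rw [h1 ζ hm] at this
    exact one_ne_zero this) _

theorem IsDensity.disc_le (hg : IsDensity R g) {z : ℂ} {ε : ℝ}
    (h1 : ∀ ζ ∈ Metric.ball z ε, g ζ = 1) (ζ : ℂ) : discDensity z ε ζ ≤ g ζ := by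
  by_cases h : ζ ∈ Metric.ball z ε
  · rw [h1 ζ h, discDensity, Set.indicator_of_mem h]; rfl
  · rw [discDensity, Set.indicator_of_notMem h]; exact hg.nonneg ζ

theorem sub_disc_eq_zero {z : ℂ} {ε : ℝ} (h1 : ∀ ζ ∈ Metric.ball z ε, g ζ = 1) :
    ∀ ζ ∈ Metric.ball z ε, g ζ - discDensity z ε ζ = 0 := fun ζ hζ => by
  rw [h1 ζ hζ, discDensity, Set.indicator_of_mem hζ]; simp

/-- The kernel with the removable singularity at `z` filled in, when the density is `1` on the
disc of radius `ε` about `z`. -/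
def innerKerExt (g : ℂ → ℝ) (z : ℂ) (ε : ℝ) (v : ℂ) : ℂ :=
  if ‖v - z‖ < ε then
    ((ε : ℂ) ^ 2)⁻¹ * Complex.exp (-cpair (fun ζ => g ζ - discDensity z ε ζ) v z)
  else innerKer g v z

/-- Removing the disc from the density splits off the factor |v − z|²/ε² from E; the remaining
exponent belongs to a density vanishing near z and is harmless there. -/
theorem innerKerExt_eq (hg : IsDensity R g) {z v : ℂ} {ε : ℝ}
    (h1 : ∀ ζ ∈ Metric.ball z ε, g ζ = 1) (hv : v ≠ z) :
    innerKerExt g z ε v = innerKer g v z := by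
  rw [innerKerExt]
  split_ifs with h
  · have hd := hg.disc_of_eq_one h1
    have hpos : 0 < ‖v - z‖ := norm_pos_iff.2 (sub_ne_zero.2 hv)
    have hε : (ε : ℂ) ≠ 0 := by exact_mod_cast (hpos.trans h).ne'
    have hs : cpair (fun ζ => g ζ - discDensity z ε ζ) v z =
        cpair g v z - cpair (discDensity z ε) v z := by
      rw [cpair, cpair, cpair, ← mul_sub,
        ← integral_sub (hg.integrable_of_ne hv) (hd.integrable_of_ne hv)]
      congr 1
      refine integral_congr_ae (.of_forall fun ζ => ?_)
      push_cast
      ring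
    have he := exp_neg_cpair_disc hv h
    have hn : ((‖v - z‖ ^ 2 : ℝ) : ℂ) = (v - z) * (conj v - conj z) := by
      rw [← map_sub, Complex.mul_conj, Complex.normSq_eq_norm_sq]
    have hne : (v - z) * (conj v - conj z) ≠ 0 := by
      rw [← hn]; exact_mod_cast (by positivity : ‖v - z‖ ^ 2 ≠ 0)
    rw [Complex.ofReal_div, hn] at he
    rw [innerKer, hs, neg_sub, sub_eq_add_neg, Complex.exp_add,
      show -cpair g v z = -(cpair g v z) from rfl]
    have he2 : Complex.exp (cpair (discDensity z ε) v z) =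
        (ε : ℂ) ^ 2 * ((v - z) * (conj v - conj z))⁻¹ := by
      rw [← inv_inv (Complex.exp _), ← Complex.exp_neg, he]
      push_cast
      rw [inv_div, div_eq_mul_inv]
    rw [he2]
    field_simp
  · rfl

theorem norm_exp_le {x : ℂ} {M : ℝ} (h : ‖x‖ ≤ M) : ‖Complex.exp x‖ ≤ Real.exp M :=
  (Complex.norm_exp_le_exp_norm x).trans (Real.exp_le_exp.2 h)

theorem norm_innerKer_le_of_le (hg : IsDensity R g) {z v : ℂ} {ε : ℝ} (hε : 0 < ε)
    (hv : ε ≤ ‖v - z‖) :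
    ‖innerKer g v z‖ ≤ Real.exp (ε⁻¹ * (2 * cauchyBound R)) * (‖v - z‖ ^ 2)⁻¹ := by
  have hne : v ≠ z := by
    rintro rfl; simp at hv; linarith
  rw [innerKer, norm_mul, norm_inv, norm_mul, norm_conj_sub_conj, ← sq]
  refine mul_le_mul_of_nonneg_right (norm_exp_le ?_) (by positivity)
  rw [norm_neg]
  exact (hg.norm_cpair_le_of_ne hne).trans (mul_le_mul_of_nonneg_right (inv_anti₀ hε hv)
    (mul_nonneg zero_le_two (cauchyBound_nonneg R)))

theorem norm_innerKerExt_le (hg : IsDensity R g) {z : ℂ} {ε : ℝ} (hε : 0 < ε)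
    (h1 : ∀ ζ ∈ Metric.ball z ε, g ζ = 1) (v : ℂ) :
    ‖innerKerExt g z ε v‖ ≤ Real.exp (ε⁻¹ * (2 * cauchyBound R)) * (ε ^ 2)⁻¹ := by
  have hN := cauchyBound_nonneg R
  rw [innerKerExt]
  split_ifs with h
  · have hr := (hg.disc_of_eq_one h1).sub hg (hg.disc_le h1)
    rw [norm_mul, norm_inv, norm_pow, Complex.norm_real, Real.norm_of_nonneg hε.le, mul_comm]
    refine mul_le_mul_of_nonneg_right (norm_exp_le ?_) (by positivity)
    rw [norm_neg]
    refine (hr.norm_cpair_le_right v hε (sub_disc_eq_zero h1)).trans ?_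
    exact mul_le_mul_of_nonneg_left (by linarith) (by positivity)
  · refine (norm_innerKer_le_of_le hg hε (not_lt.1 h)).trans ?_
    exact mul_le_mul_of_nonneg_left
      (inv_anti₀ (by positivity) (pow_le_pow_left₀ hε.le (not_lt.1 h) 2)) (Real.exp_pos _).le

theorem norm_innerKer_le (hg : IsDensity R g) {z : ℂ} {ε : ℝ} (hε : 0 < ε)
    (h1 : ∀ ζ ∈ Metric.ball z ε, g ζ = 1) (v : ℂ) :
    ‖innerKer g v z‖ ≤ Real.exp (ε⁻¹ * (2 * cauchyBound R)) * (ε ^ 2)⁻¹ := by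
  -- On the diagonal `innerKer` is 0 because `0⁻¹ = 0`; this is not the value that fills in the
  -- singularity, but it satisfies the same bound.
  rcases eq_or_ne v z with rfl | hv
  · simp [innerKer]; positivity
  · rw [← innerKerExt_eq hg h1 hv]
    exact norm_innerKerExt_le hg hε h1 v

/-- Inside the disc the extension is holomorphic in v, in agreement with 1 − g = 0. Elsewhere ∂̄ of
e^{−P} contributes the factor g/(v̄ − z̄) and ∂̄ of 1/|v − z|² the factor −1/(v̄ − z̄). Thus the
derivative is carried by 1 − g. -/
theorem innerKerExt_smooth (hg : IsDensity R g) (hs : ContDiff ℝ ∞ g) {z : ℂ} {ε : ℝ}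
    (hε : 0 < ε) (h1 : ∀ ζ ∈ Metric.ball z ε, g ζ = 1) (v : ℂ) :
    ContDiffAt ℝ ∞ (innerKerExt g z ε) v ∧ HasDbarAt (innerKerExt g z ε)
      (-((1 - g v) * innerKerExt g z ε v * (conj v - conj z)⁻¹)) v := by
  by_cases h : ‖v - z‖ < ε
  · have hr := (hg.disc_of_eq_one h1).sub hg (hg.disc_le h1)
    have hvb : v ∈ Metric.ball z ε := by simpa [dist_eq_norm] using h
    obtain ⟨δ, hδ, hsub⟩ := Metric.isOpen_iff.1 Metric.isOpen_ball v hvb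
    have hA : AnalyticAt ℂ (fun v => ((ε : ℂ) ^ 2)⁻¹ *
        Complex.exp (-cpair (fun ζ => g ζ - discDensity z ε ζ) v z)) v :=
      analyticAt_const.mul ((hr.analyticAt_cpair z hδ
        fun ζ hζ => sub_disc_eq_zero h1 ζ (hsub hζ)).neg.cexp)
    have he : innerKerExt g z ε =ᶠ[𝓝 v] fun v => ((ε : ℂ) ^ 2)⁻¹ *
        Complex.exp (-cpair (fun ζ => g ζ - discDensity z ε ζ) v z) := by
      filter_upwards [Metric.isOpen_ball.mem_nhds hvb] with x hx
      rw [innerKerExt, if_pos (by simpa [dist_eq_norm] using hx)]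
    refine ⟨(hA.contDiffAt.restrict_scalars ℝ).congr_of_eventuallyEq he, ?_⟩
    refine ((hasDbarAt_of_holo hA.differentiableAt).congr_of_eventuallyEq he).congr_dbar ?_
    rw [h1 v hvb]; simp
  · have hvz : v ≠ z := by
      rintro rfl; simp at h; linarith
    have hne : conj v - conj z ≠ 0 := by
      rw [← map_sub, map_ne_zero]; exact sub_ne_zero.2 hvz
    have hne1 : v - z ≠ 0 := sub_ne_zero.2 hvz
    have he : innerKerExt g z ε =ᶠ[𝓝 v] fun v => innerKer g v z := by
      filter_upwards [isOpen_ne.mem_nhds hvz] with x hx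
      exact innerKerExt_eq hg h1 hx
    have hconj : ContDiff ℝ ∞ (fun z : ℂ => conj z) := Complex.conjCLE.contDiff
    have hgs : ContDiff ℝ ∞ (fun ζ => (g ζ : ℂ)) := Complex.ofRealCLM.contDiff.comp hs
    obtain ⟨c1, c2⟩ := hg.cpair_local (u := v) (v := z) hε (hgs.contDiffOn.mul
      ((hconj.sub contDiff_const).contDiffOn.inv fun x hx => by
        rw [← map_sub, map_ne_zero, sub_ne_zero]
        rintro rfl
        rw [Metric.mem_ball, dist_eq_norm, norm_sub_rev] at hx
        exact h hx)) (Or.inl hvz)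
    have hden : ContDiff ℝ ∞ fun v : ℂ => (v - z) * (conj v - conj z) :=
      (contDiff_id.sub contDiff_const).mul (hconj.sub contDiff_const)
    refine ⟨ContDiffAt.congr_of_eventuallyEq
      (c1.neg.cexp.mul (hden.contDiffAt.inv (mul_ne_zero hne1 hne))) he, ?_⟩
    have d1 := HasDbarAt.comp_holo (Complex.hasDerivAt_exp _) c2.neg
    have d2 := ((hasDbarAt_of_holo (differentiableAt_id (x := v))).add
      (hasDbarAt_const (-z) v)).mul ((hasDbarAt_conj v).add (hasDbarAt_const (-conj z) v))
    have hne2 : (id v + -z) * (conj v + -conj z) ≠ 0 := by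
      simpa [← sub_eq_add_neg] using mul_ne_zero hne1 hne
    have d3 := d1.mul (HasDbarAt.comp_holo (hasDerivAt_inv hne2) d2)
    refine HasDbarAt.congr_dbar (d3.congr_of_eventuallyEq (he.trans (.of_forall fun x => ?_))) ?_
    · simp [innerKer, ← sub_eq_add_neg]
    · rw [innerKerExt_eq hg h1 hvz, innerKer]
      simp only [id, ← sub_eq_add_neg, neg_neg]
      field_simp
      ring

end InnerKernel

/-! ### Stokes' formula on the plane with a residue at infinity -/

section Stokes

/-- Stokes' formula on the whole plane for functions with a simple pole type behaviour at `∞`. -/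
theorem integral_dbar_eq {Y d : ℂ → ℂ} (hY : ContDiff ℝ 1 Y) (hd : ∀ v, HasDbarAt Y (d v) v)
    (hi : Integrable d) {c : ℂ} (hc : Tendsto (fun v => v * Y v) (cocompact ℂ) (𝓝 c)) :
    ∫ v, d v = Real.pi * c := by
  let χ : ContDiffBump (0 : ℂ) := ⟨1, 2, one_pos, one_lt_two⟩
  let X : ℂ → ℂ := fun v => ((χ v : ℝ) : ℂ)
  have hX : ContDiff ℝ 1 X := Complex.ofRealCLM.contDiff.comp χ.contDiff
  have hXc : HasCompactSupport X :=
    χ.hasCompactSupport.comp_left (g := fun x : ℝ => (x : ℂ)) (by simp)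
  obtain ⟨M, hM⟩ := (hasCompactSupport_wirtingerBar hXc).exists_bound_of_continuous
    (continuous_wirtingerBar hX)
  have hM0 : 0 ≤ M := (norm_nonneg _).trans (hM 0)
  let e : ℕ → ℝ := fun n => 1 / ((n : ℝ) + 1)
  have he : ∀ n, 0 < e n := fun n => by positivity
  have he0 : Tendsto e atTop (𝓝 0) := tendsto_one_div_add_atTop_nhds_zero_nat
  let Xn : ℕ → ℂ → ℂ := fun n v => X (e n • v)
  have hXn : ∀ n, ContDiff ℝ 1 (Xn n) := fun n => hX.comp (contDiff_const_smul _)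
  have hXnc : ∀ n, HasCompactSupport (Xn n) := fun n => hXc.comp_smul (he n).ne'
  have hXd : ∀ n v, wirtingerBar (Xn n) v = e n * wirtingerBar X (e n • v) := by
    intro n v
    have : HasFDerivAt (Xn n) _ v :=
      ((hX.differentiable one_ne_zero).differentiableAt (x := e n • v)).hasFDerivAt.comp v
        ((hasFDerivAt_id v).const_smul (e n))
    rw [wirtingerBar, this.fderiv, wirtingerBar]
    simp
    ring
  have hX1 : ∀ v : ℂ, ‖v‖ ≤ 1 → X v = 1 := fun v hv => by
    simp only [X]
    rw [χ.one_of_mem_closedBall (by simpa using hv)]; simp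
  have hXle : ∀ v, ‖X v‖ ≤ 1 := fun v => by
    simp only [X, Complex.norm_real, Real.norm_of_nonneg χ.nonneg]
    exact χ.le_one
  have hX0 : ∀ v : ℂ, 2 < ‖v‖ → wirtingerBar X v = 0 := fun v hv => by
    refine wirtingerBar_eq_zero_of_notMem_tsupport fun h => ?_
    have hs : Function.support X ⊆ Function.support χ := fun x hx h0 => hx (by simp [X, h0])
    have h2 : v ∈ tsupport χ := closure_mono hs h
    rw [χ.tsupport_eq] at h2
    simp [χ] at h2
    linarith
  have hX0' : ∀ v : ℂ, ‖v‖ < 1 → wirtingerBar X v = 0 := fun v hv => by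
    have : X =ᶠ[𝓝 v] fun _ => 1 := by
      filter_upwards [Metric.isOpen_ball.mem_nhds (by simpa using hv : v ∈ Metric.ball 0 1)] with x hx
      exact hX1 x (by simpa using (Metric.ball_subset_closedBall hx))
    exact ((hasDbarAt_const 1 v).congr_of_eventuallyEq this).2
  -- the cut off identity
  have hcut : ∀ n, ∫ v, Xn n v * d v =
      Real.pi * c - ∫ v, wirtingerBar (Xn n) v * (Y v - c * v⁻¹) := by
    intro n
    have h0 := integral_wirtingerBar_eq_zero ((hXn n).mul hY) (hXnc n).mul_right
    have hcp := integral_wirtingerBar_mul_inv (hXn n) (hXnc n)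
    have hdd : ∀ v, wirtingerBar (fun v => Xn n v * Y v) v =
        wirtingerBar (Xn n) v * Y v + Xn n v * d v := fun v =>
      ((hasDbarAt_of_contDiff (hXn n) v).mul (hd v)).2
    have hwc := continuous_wirtingerBar (hXn n)
    have hws := hasCompactSupport_wirtingerBar (hXnc n)
    have i1 : Integrable fun v => wirtingerBar (Xn n) v * Y v :=
      (hwc.mul hY.continuous).integrable_of_hasCompactSupport hws.mul_right
    have i2 : Integrable fun v => Xn n v * d v :=
      hi.bdd_mul (hXn n).continuous.aestronglyMeasurable (c := 1) (.of_forall fun v => hXle _)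
    have i3 : Integrable fun v => wirtingerBar (Xn n) v * v⁻¹ := by
      have := locallyIntegrable_inv.integrable_smul_left_of_hasCompactSupport hwc hws
      simpa using this
    have h00 : ∫ v, wirtingerBar (fun v => Xn n v * Y v) v = 0 := h0
    simp only [hdd] at h00
    rw [integral_add i1 i2] at h00
    have e3 : ∫ v, wirtingerBar (Xn n) v * (Y v - c * v⁻¹) =
        (∫ v, wirtingerBar (Xn n) v * Y v) - c * ∫ v, wirtingerBar (Xn n) v * v⁻¹ := by
      rw [← integral_const_mul, ← integral_sub i1 (i3.const_mul c)]
      refine integral_congr_ae (.of_forall fun v => ?_)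
      simp only []
      ring
    have hx0 : Xn n 0 = 1 := hX1 _ (by simp)
    rw [hx0] at hcp
    rw [e3, hcp]
    linear_combination h00
  have hlim1 : Tendsto (fun n => ∫ v, Xn n v * d v) atTop (𝓝 (∫ v, d v)) := by
    refine tendsto_integral_of_dominated_convergence (fun v => ‖d v‖)
      (fun n => (hXn n).continuous.aestronglyMeasurable.mul hi.aestronglyMeasurable) hi.norm
      (fun n => .of_forall fun v => ?_) (.of_forall fun v => ?_)
    · rw [norm_mul]
      exact mul_le_of_le_one_left (norm_nonneg _) (hXle _)
    · refine tendsto_const_nhds.congr' ?_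
      have h1 : Tendsto (fun n => e n • v) atTop (𝓝 0) := by simpa using he0.smul_const v
      filter_upwards [h1 (Metric.ball_mem_nhds (0 : ℂ) one_pos)] with n hn
      have : Xn n v = 1 := hX1 _ (by
        have : e n • v ∈ Metric.ball (0 : ℂ) 1 := hn
        simpa using (Metric.ball_subset_closedBall this))
      simp [this]
  -- Here ∂̄`Xn n` is O(`e n`) and is supported where |v| lies between 1/`e n` and 2/`e n`, a region
  -- of area O(`e n`⁻²), while Y − c/v is o(1/|v|) there. Cauchy–Pompeiu has already extracted πc
  -- from the term c/v.
  have hlim2 : Tendsto (fun n => ∫ v, wirtingerBar (Xn n) v * (Y v - c * v⁻¹)) atTop (𝓝 0) := by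
    rw [Metric.tendsto_atTop]
    intro η hη
    -- The disc of radius 2/`e n` has area 4π/`e n`², so the integral is at most η · 4πM/(2(4πM +
    -- 1)) < η; the added 1 covers M = 0.
    have hη' : 0 < η / (2 * (M * (4 * Real.pi) + 1)) := by
      have := Real.pi_pos
      positivity
    have hev := Metric.tendsto_nhds.1 hc _ hη'
    obtain ⟨ρ, hρ⟩ : ∃ ρ : ℝ, ∀ v : ℂ, ρ < ‖v‖ →
        dist (v * Y v) c < η / (2 * (M * (4 * Real.pi) + 1)) := by
      rw [← Metric.cobounded_eq_cocompact,
        (Metric.hasBasis_cobounded_compl_closedBall (0 : ℂ)).eventually_iff] at hev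
      obtain ⟨ρ, -, hρ⟩ := hev
      exact ⟨ρ, fun v hv => hρ (by simpa using hv)⟩
    have hN : ∀ᶠ n in atTop, ρ < (e n)⁻¹ := by
      have : Tendsto (fun n : ℕ => (e n)⁻¹) atTop atTop := by
        simp only [e, one_div, inv_inv]
        exact tendsto_atTop_add_const_right _ _ tendsto_natCast_atTop_atTop
      exact this.eventually_gt_atTop ρ
    obtain ⟨N, hN⟩ := eventually_atTop.1 hN
    refine ⟨N, fun n hn => ?_⟩
    have hρn := hN n hn
    rw [dist_zero_right]
    have hb : ∀ v, ‖wirtingerBar (Xn n) v * (Y v - c * v⁻¹)‖ ≤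
        (Metric.closedBall (0 : ℂ) (2 * (e n)⁻¹)).indicator
          (fun _ => M * e n ^ 2 * (η / (2 * (M * (4 * Real.pi) + 1)))) v := by
      intro v
      have hen := he n
      have hnv : ‖e n • v‖ = e n * ‖v‖ := by rw [norm_smul, Real.norm_of_nonneg hen.le]
      by_cases hv2 : 2 < ‖e n • v‖
      · rw [hXd, hX0 _ hv2]
        simp only [mul_zero, zero_mul, norm_zero]
        exact Set.indicator_nonneg (fun _ _ => by positivity) _
      have hmem : v ∈ Metric.closedBall (0 : ℂ) (2 * (e n)⁻¹) := by
        rw [mem_closedBall_zero_iff, ← div_eq_mul_inv, le_div_iff₀ hen, mul_comm, ← hnv]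
        exact not_lt.1 hv2
      rw [Set.indicator_of_mem hmem]
      by_cases hv1 : ‖e n • v‖ < 1
      · rw [hXd, hX0' _ hv1]
        simp only [mul_zero, zero_mul, norm_zero]
        positivity
      rw [not_lt, hnv] at hv1
      have hv3 : (e n)⁻¹ ≤ ‖v‖ := by
        rw [inv_le_iff_one_le_mul₀ hen, mul_comm]; exact hv1
      have hvpos : 0 < ‖v‖ := (inv_pos.2 hen).trans_le hv3
      have hv0 : v ≠ 0 := norm_pos_iff.1 hvpos
      have hY := hρ v (hρn.trans_le hv3)
      rw [dist_eq_norm] at hY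
      have hYe : Y v - c * v⁻¹ = v⁻¹ * (v * Y v - c) := by field_simp
      rw [hYe, hXd, norm_mul, norm_mul, norm_mul, Complex.norm_real, Real.norm_of_nonneg hen.le,
        norm_inv]
      calc e n * ‖wirtingerBar X (e n • v)‖ * (‖v‖⁻¹ * ‖v * Y v - c‖)
          ≤ e n * M * (e n * (η / (2 * (M * (4 * Real.pi) + 1)))) := by
            refine mul_le_mul (mul_le_mul_of_nonneg_left (hM _) hen.le)
              (mul_le_mul ?_ hY.le (norm_nonneg _) hen.le) (by positivity) (by positivity)
            rw [inv_le_comm₀ hvpos hen]; exact hv3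
        _ = _ := by ring
    refine lt_of_le_of_lt (norm_integral_le_of_norm_le ?_ (.of_forall hb)) ?_
    · exact (integrable_indicator_iff Metric.isClosed_closedBall.measurableSet).2
        (integrableOn_const Metric.isBounded_closedBall.measure_lt_top.ne)
    · have hen := he n
      rw [integral_indicator Metric.isClosed_closedBall.measurableSet, setIntegral_const,
        measureReal_def, Complex.volume_closedBall]
      have hpi := Real.pi_pos
      rw [smul_eq_mul, ENNReal.toReal_mul, ENNReal.toReal_pow,
        ENNReal.toReal_ofReal (by positivity)]
      simp only [ENNReal.coe_toReal, NNReal.coe_real_pi]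
      have : (2 * (e n)⁻¹) ^ 2 * Real.pi * (M * e n ^ 2 * (η / (2 * (M * (4 * Real.pi) + 1)))) =
          η * (M * (4 * Real.pi) / (2 * (M * (4 * Real.pi) + 1))) := by
        field_simp
        ring
      rw [this]
      refine mul_lt_of_lt_one_right hη ?_
      rw [div_lt_one (by positivity)]
      have : 0 ≤ M * (4 * Real.pi) := by positivity
      linarith
  have h := (tendsto_const_nhds (x := (Real.pi : ℂ) * c)).sub hlim2
  rw [sub_zero] at h
  exact tendsto_nhds_unique hlim1 (h.congr fun n => (hcut n).symm)

end Stokes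

/-! ### Dominated convergence for exponents and kernels; decay at infinity -/

section Limits

variable {R : ℝ} {g : ℂ → ℝ}

theorem tendsto_cpair_of_le {gj : ℕ → ℂ → ℝ} (hgj : ∀ j, IsDensity R (gj j)) {u v : ℂ}
    (hlim : ∀ᵐ ζ, Tendsto (fun j => gj j ζ) atTop (𝓝 (g ζ))) {b : ℂ → ℝ} (hb : Integrable b)
    (h : ∀ᶠ j in atTop, ∀ ζ, ‖(gj j ζ : ℂ) * ((ζ - u) * (conj ζ - conj v))⁻¹‖ ≤ b ζ) :
    Tendsto (fun j => cpair (gj j) u v) atTop (𝓝 (cpair g u v)) := by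
  refine Tendsto.const_mul _ (tendsto_integral_filter_of_dominated_convergence b
    (.of_forall fun j => (hgj j).aestronglyMeasurable u v)
    (h.mono fun j hj => .of_forall hj) hb ?_)
  filter_upwards [hlim] with ζ hζ
  exact ((Complex.continuous_ofReal.tendsto _).comp hζ).mul_const _

theorem tendsto_cpair_of_ne {gj : ℕ → ℂ → ℝ} (hgj : ∀ j, IsDensity R (gj j))
    (hlim : ∀ᵐ ζ, Tendsto (fun j => gj j ζ) atTop (𝓝 (g ζ))) {u v : ℂ} (huv : u ≠ v) :
    Tendsto (fun j => cpair (gj j) u v) atTop (𝓝 (cpair g u v)) :=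
  tendsto_cpair_of_le hgj hlim (((integrable_cauchyMajorant R u).add
    (integrable_cauchyMajorant R v)).const_mul _)
    (.of_forall fun j => (hgj j).norm_integrand_le_of_ne huv)

theorem tendsto_cpair_of_far {gj : ℕ → ℂ → ℝ} (hgj : ∀ j, IsDensity R (gj j))
    (hlim : ∀ᵐ ζ, Tendsto (fun j => gj j ζ) atTop (𝓝 (g ζ))) (u : ℂ) {v : ℂ} {δ : ℝ} (hδ : 0 < δ)
    (hv : ∀ᶠ j in atTop, ∀ ζ ∈ Metric.ball v δ, gj j ζ = 0) :
    Tendsto (fun j => cpair (gj j) u v) atTop (𝓝 (cpair g u v)) :=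
  tendsto_cpair_of_le hgj hlim ((integrable_cauchyMajorant R u).const_mul _)
    (hv.mono fun j hj => (hgj j).norm_integrand_le_right hδ hj)

theorem tendsto_innerKer {gj : ℕ → ℂ → ℝ} (hgj : ∀ j, IsDensity R (gj j))
    (hlim : ∀ᵐ ζ, Tendsto (fun j => gj j ζ) atTop (𝓝 (g ζ))) (u v : ℂ) :
    Tendsto (fun j => innerKer (gj j) u v) atTop (𝓝 (innerKer g u v)) := by
  rcases eq_or_ne u v with rfl | huv
  · simp [innerKer]
  · exact (((tendsto_cpair_of_ne hgj hlim huv).neg.cexp).mul_const _)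

theorem tendsto_sub_inv_cocompact (z : ℂ) :
    Tendsto (fun v : ℂ => (v - z)⁻¹) (cocompact ℂ) (𝓝 0) := by
  have h1 : Tendsto (fun v : ℂ => v - z) (cocompact ℂ) (cocompact ℂ) :=
    (Homeomorph.subRight z).isClosedEmbedding.tendsto_cocompact
  have h2 : Tendsto (fun v : ℂ => v⁻¹) (cocompact ℂ) (𝓝 0) := by
    rw [← Metric.cobounded_eq_cocompact]; exact tendsto_inv₀_cobounded
  exact h2.comp h1

theorem tendsto_div_sub_cocompact (w z : ℂ) :
    Tendsto (fun v : ℂ => (v - w) * (v - z)⁻¹) (cocompact ℂ) (𝓝 1) := by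
  have h1 := ((tendsto_sub_inv_cocompact z).const_mul (z - w)).const_add 1
  simp only [mul_zero, add_zero] at h1
  refine h1.congr' ?_
  have : ∀ᶠ v : ℂ in cocompact ℂ, v ≠ z :=
    (isCompact_singleton (x := z)).compl_mem_cocompact
  filter_upwards [this] with v hv
  have : v - z ≠ 0 := sub_ne_zero.2 hv
  field_simp
  ring

theorem IsDensity.tendsto_cpair_cocompact (hg : IsDensity R g) (w : ℂ) :
    Tendsto (fun v => cpair g v w) (cocompact ℂ) (𝓝 0) := by
  have h1 := (tendsto_sub_inv_cocompact w).norm.mul_const (2 * cauchyBound R)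
  rw [norm_zero, zero_mul] at h1
  refine squeeze_zero_norm' ?_ h1
  have : ∀ᶠ v : ℂ in cocompact ℂ, v ≠ w := (isCompact_singleton (x := w)).compl_mem_cocompact
  filter_upwards [this] with v hv
  rw [norm_inv]
  exact hg.norm_cpair_le_of_ne hv

/-- A majorant of the order `|v|⁻³`, vanishing on the disc of radius `ε` about `z`. -/
def farMajorant (z : ℂ) (ε : ℝ) (v : ℂ) : ℝ := if ε ≤ ‖v - z‖ then (‖v - z‖ ^ 3)⁻¹ else 0

theorem farMajorant_nonneg (z : ℂ) (ε : ℝ) (v : ℂ) : 0 ≤ farMajorant z ε v := by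
  unfold farMajorant; split_ifs <;> positivity

theorem farMajorant_le {ε : ℝ} (hε : 0 < ε) (z v : ℂ) :
    farMajorant z ε v ≤ (1 + ε⁻¹) ^ 3 * (1 + ‖v - z‖) ^ (-(3 : ℝ)) := by
  have h3 : (1 + ‖v - z‖) ^ (-(3 : ℝ)) = ((1 + ‖v - z‖) ^ 3)⁻¹ := by
    rw [Real.rpow_neg (by positivity)]; norm_cast
  rw [h3, farMajorant]
  split_ifs with h
  · have hp : 0 < ‖v - z‖ := hε.trans_le h
    rw [← div_eq_mul_inv, le_div_iff₀ (by positivity), inv_mul_eq_div, ← div_pow]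
    refine pow_le_pow_left₀ (by positivity) ?_ 3
    rw [div_le_iff₀ hp, add_mul, one_mul]
    have : 1 ≤ ε⁻¹ * ‖v - z‖ := by
      rw [inv_mul_eq_div, one_le_div hε]; exact h
    linarith
  · positivity

theorem integrable_farMajorant {ε : ℝ} (hε : 0 < ε) (z : ℂ) : Integrable (farMajorant z ε) := by
  have h := (integrable_one_add_norm (E := ℂ) (μ := volume) (r := 3)
    (by rw [Complex.finrank_real_complex]; norm_num)).comp_sub_right z
  refine (h.const_mul ((1 + ε⁻¹) ^ 3)).mono' ?_ (.of_forall fun v => ?_)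
  · refine Measurable.aestronglyMeasurable ?_
    exact Measurable.ite (measurableSet_le measurable_const (by fun_prop)) (by fun_prop)
      measurable_const
  · rw [Real.norm_of_nonneg (farMajorant_nonneg _ _ _)]
    exact farMajorant_le hε z v

/-- The density part of the Stokes formula. -/
def stokesKer (g : ℂ → ℝ) (z v : ℂ) : ℂ :=
  (1 - g v) * innerKer g v z * (conj v - conj z)⁻¹

/-- The factor 1 − g vanishes on the disc about z. Off it, `innerKer` contributes |v − z|⁻² and the
remaining factor |v − z|⁻¹, which is integrable at infinity and uniform in the density. -/
theorem norm_stokesKer_le (hg : IsDensity R g) {z : ℂ} {ε : ℝ} (hε : 0 < ε)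
    (h1 : ∀ ζ ∈ Metric.ball z ε, g ζ = 1) (v : ℂ) :
    ‖stokesKer g z v‖ ≤ Real.exp (ε⁻¹ * (2 * cauchyBound R)) * farMajorant z ε v := by
  unfold stokesKer farMajorant
  split_ifs with h
  · have hg1 : ‖(1 - g v : ℂ)‖ ≤ 1 := by
      rw [← Complex.ofReal_one, ← Complex.ofReal_sub, Complex.norm_real, Real.norm_of_nonneg
        (by linarith [hg.le_one v])]
      linarith [hg.nonneg v]
    rw [norm_mul, norm_mul, norm_inv, norm_conj_sub_conj]
    have h2 := norm_innerKer_le_of_le hg hε h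
    calc ‖(1 - g v : ℂ)‖ * ‖innerKer g v z‖ * ‖v - z‖⁻¹
        ≤ 1 * (Real.exp (ε⁻¹ * (2 * cauchyBound R)) * (‖v - z‖ ^ 2)⁻¹) * ‖v - z‖⁻¹ := by
          gcongr
      _ = _ := by rw [pow_succ ‖v - z‖ 2, mul_inv]; ring
  · have hm : v ∈ Metric.ball z ε := by simpa [dist_eq_norm] using h
    simp [h1 v hm]

theorem tendsto_stokesKer {gj : ℕ → ℂ → ℝ} (hgj : ∀ j, IsDensity R (gj j))
    (hlim : ∀ ζ, Tendsto (fun j => gj j ζ) atTop (𝓝 (g ζ))) (z v : ℂ) :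
    Tendsto (fun j => stokesKer (gj j) z v) atTop (𝓝 (stokesKer g z v)) :=
  (((((Complex.continuous_ofReal.tendsto _).comp (hlim v)).const_sub 1).mul
    (tendsto_innerKer hgj (.of_forall hlim) v z)).mul_const _)

theorem measurable_cpair (hg : Measurable g) : Measurable fun p : ℂ × ℂ => cpair g p.1 p.2 := by
  have hconj : Measurable fun ζ : ℂ => conj ζ := Complex.continuous_conj.measurable
  have h : StronglyMeasurable fun q : (ℂ × ℂ) × ℂ =>
      (g q.2 : ℂ) * ((q.2 - q.1.1) * (conj q.2 - conj q.1.2))⁻¹ :=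
    Measurable.stronglyMeasurable (by fun_prop)
  exact (h.integral_prod_right (ν := volume)).measurable.const_mul _

theorem measurable_innerKer (hg : Measurable g) :
    Measurable fun p : ℂ × ℂ => innerKer g p.1 p.2 := by
  have hconj : Measurable fun ζ : ℂ => conj ζ := Complex.continuous_conj.measurable
  have := measurable_cpair hg
  unfold innerKer
  fun_prop

theorem measurable_stokesKer (hg : Measurable g) :
    Measurable fun p : ℂ × ℂ => stokesKer g p.1 p.2 := by
  have hconj : Measurable fun ζ : ℂ => conj ζ := Complex.continuous_conj.measurable
  have h0 := (measurable_innerKer hg).comp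
    ((measurable_snd (α := ℂ) (β := ℂ)).prodMk measurable_fst)
  have h1 : Measurable fun p : ℂ × ℂ => innerKer g p.2 p.1 := h0
  have h2 : Measurable fun p : ℂ × ℂ => (1 : ℂ) - g p.2 :=
    measurable_const.sub (Complex.measurable_ofReal.comp (hg.comp measurable_snd))
  exact (h2.mul h1).mul
    ((hconj.comp measurable_snd).sub (hconj.comp measurable_fst)).inv

end Limits

/-! ### Stokes identities for smooth densities -/

section SmoothIdentities

variable {R : ℝ} {g : ℂ → ℝ}

theorem innerKerExt_ae_eq (hg : IsDensity R g) {z : ℂ} {ε : ℝ}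
    (h1 : ∀ ζ ∈ Metric.ball z ε, g ζ = 1) :
    ∀ᵐ v, innerKerExt g z ε v = innerKer g v z := by
  have : ∀ᵐ v : ℂ, v ≠ z := by simp [ae_iff]
  filter_upwards [this] with v hv
  exact innerKerExt_eq hg h1 hv

/-- Stokes' formula for the product of q with the regularized kernel; by `innerKerExt_smooth` its ∂̄
is the integrand, up to the null set {z}. -/
theorem stokes_smooth (hg : IsDensity R g) (hs : ContDiff ℝ ∞ g) {z : ℂ} {ε : ℝ}
    (hε : 0 < ε) (h1 : ∀ ζ ∈ Metric.ball z ε, g ζ = 1) {q q' : ℂ → ℂ} (hq : ContDiff ℝ 1 q)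
    (hq' : ∀ v, HasDbarAt q (q' v) v)
    (hi : Integrable fun v => -(stokesKer g z v * q v) + innerKer g v z * q' v) {c : ℂ}
    (hc : Tendsto (fun v => v * (innerKer g v z * q v)) (cocompact ℂ) (𝓝 c)) :
    ∫ v, (-(stokesKer g z v * q v) + innerKer g v z * q' v) = Real.pi * c := by
  have hsm := innerKerExt_smooth hg hs hε h1
  have hY : ContDiff ℝ 1 fun v => innerKerExt g z ε v * q v :=
    (contDiff_iff_contDiffAt.2 fun v => (hsm v).1.of_le (by norm_cast)).mul hq
  have hd := fun v => (hsm v).2.mul (hq' v)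
  have hae : (fun v => -((1 - g v) * innerKerExt g z ε v * (conj v - conj z)⁻¹) * q v +
      innerKerExt g z ε v * q' v) =ᵐ[volume]
      fun v => -(stokesKer g z v * q v) + innerKer g v z * q' v := by
    filter_upwards [innerKerExt_ae_eq hg h1] with v hv
    rw [hv, stokesKer]; ring
  rw [← integral_congr_ae hae]
  refine integral_dbar_eq hY hd (hi.congr hae.symm) (hc.congr' ?_)
  have : ∀ᶠ v : ℂ in cocompact ℂ, v ≠ z := (isCompact_singleton (x := z)).compl_mem_cocompact
  filter_upwards [this] with v hv
  rw [innerKerExt_eq hg h1 hv]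

theorem integrable_stokesKer_mul (hg : IsDensity R g) {z : ℂ} {ε : ℝ} (hε : 0 < ε)
    (h1 : ∀ ζ ∈ Metric.ball z ε, g ζ = 1) {q : ℂ → ℂ} (hq : AEStronglyMeasurable q) {Q : ℝ}
    (hQ : ∀ v, ‖q v‖ ≤ Q) : Integrable fun v => stokesKer g z v * q v := by
  refine Integrable.mul_bdd (c := Q) ?_ hq (.of_forall hQ)
  exact ((integrable_farMajorant hε z).const_mul _).mono'
    ((measurable_stokesKer hg.meas).comp measurable_prodMk_left).aestronglyMeasurable
    (.of_forall (norm_stokesKer_le hg hε h1))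

theorem integrable_innerKer_mul (hg : IsDensity R g) {z : ℂ} {ε : ℝ} (hε : 0 < ε)
    (h1 : ∀ ζ ∈ Metric.ball z ε, g ζ = 1) {q : ℂ → ℂ} (hq : Integrable q) :
    Integrable fun v => innerKer g v z * q v :=
  hq.bdd_mul ((measurable_innerKer hg.meas).comp measurable_prodMk_right).aestronglyMeasurable
    (.of_forall (norm_innerKer_le hg hε h1))

/-- For bounded q the product with the kernel is O(|v|⁻²), so infinity contributes no residue. -/
theorem stokes_bounded_smooth (hg : IsDensity R g) (hs : ContDiff ℝ ∞ g) {z : ℂ} {ε : ℝ}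
    (hε : 0 < ε) (h1 : ∀ ζ ∈ Metric.ball z ε, g ζ = 1) {q : ℂ → ℂ} (hq : ContDiff ℝ 1 q) {Q : ℝ}
    (hQ : ∀ v, ‖q v‖ ≤ Q) (hq' : Integrable (wirtingerBar q)) :
    ∫ v, innerKer g v z * wirtingerBar q v = ∫ v, stokesKer g z v * q v := by
  have i1 := integrable_stokesKer_mul hg hε h1 hq.continuous.aestronglyMeasurable hQ
  have i2 := integrable_innerKer_mul hg hε h1 hq'
  have hc : Tendsto (fun v => v * (innerKer g v z * q v)) (cocompact ℂ) (𝓝 0) := by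
    have e1 := (hg.tendsto_cpair_cocompact z).neg.cexp
    have e2 := tendsto_div_sub_cocompact 0 z
    have e3 := Complex.continuous_conj.tendsto 0 |>.comp (tendsto_sub_inv_cocompact z)
    have e4 := (e1.mul (e2.mul e3))
    rw [map_zero, mul_zero, mul_zero] at e4
    refine (e4.zero_mul_isBoundedUnder_le (g := q)
      (isBoundedUnder_of ⟨Q, hQ⟩)).congr fun v => ?_
    simp only [innerKer, Function.comp, map_inv₀, map_sub, sub_zero, mul_inv]
    ring
  have h := stokes_smooth hg hs hε h1 hq (hasDbarAt_of_contDiff hq) (i1.neg.add i2) hc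
  have i3 : Integrable fun v => -(stokesKer g z v * q v) := i1.neg
  rw [mul_zero, integral_add i3 i2, integral_neg] at h
  linear_combination h

/-- The test function q = e^{P(v,w)}(v̄ − w̄) satisfies ∂̄q = (1 − g)e^{P(v,w)}, because ∂̄P =
−g/(v̄ − w̄). The two terms of the Stokes integrand then combine through (v̄ − z̄) − (v̄ − w̄) = w̄
− z̄. At infinity the product of q with the kernel behaves like 1/v, whence the residue 1 and the
value π. -/
theorem stokes_pole_smooth (hg : IsDensity R g) (hs : ContDiff ℝ ∞ g) {z : ℂ} {ε : ℝ}
    (hε : 0 < ε) (h1 : ∀ ζ ∈ Metric.ball z ε, g ζ = 1) {w : ℂ} {δ : ℝ} (hδ : 0 < δ)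
    (hw : ∀ ζ ∈ Metric.ball w δ, g ζ = 0) :
    ∫ v, stokesKer g z v * Complex.exp (cpair g v w) * (conj w - conj z) = Real.pi := by
  have hconj : ContDiff ℝ ∞ (fun z : ℂ => conj z) := Complex.conjCLE.contDiff
  have hgs : ContDiff ℝ ∞ (fun ζ => (g ζ : ℂ)) := Complex.ofRealCLM.contDiff.comp hs
  have hk : ContDiff ℝ ∞ fun ζ => (g ζ : ℂ) * (conj ζ - conj w)⁻¹ := by
    rw [contDiff_iff_contDiffAt]
    intro ζ
    rcases eq_or_ne ζ w with rfl | hne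
    · refine (contDiffAt_const (c := (0 : ℂ))).congr_of_eventuallyEq ?_
      filter_upwards [Metric.ball_mem_nhds ζ hδ] with x hx
      simp [hw x hx]
    · refine hgs.contDiffAt.mul ((hconj.sub contDiff_const).contDiffAt.inv ?_)
      rw [← map_sub, map_ne_zero]
      exact sub_ne_zero.2 hne
  have hcp := fun v => hg.cpair_local (u := v) (v := w) one_pos hk.contDiffOn (Or.inr ⟨δ, hδ, hw⟩)
  let q : ℂ → ℂ := fun v => Complex.exp (cpair g v w) * (conj v - conj w)
  have hq : ContDiff ℝ 1 q := by
    rw [contDiff_iff_contDiffAt]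
    intro v
    exact ((hcp v).1.cexp.mul (hconj.sub contDiff_const).contDiffAt).of_le (by norm_cast)
  have hq' : ∀ v, HasDbarAt q ((1 - g v) * Complex.exp (cpair g v w)) v := by
    intro v
    have d1 := HasDbarAt.comp_holo (Complex.hasDerivAt_exp _) (hcp v).2
    have d2 := (hasDbarAt_conj v).add (hasDbarAt_const (-conj w) v)
    refine ((d1.mul d2).congr_of_eventuallyEq (.of_forall fun x => ?_)).congr_dbar ?_
    · simp [q, sub_eq_add_neg]
    · rcases eq_or_ne v w with rfl | hne
      · simp [hw v (Metric.mem_ball_self hδ)]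
      · have : conj v - conj w ≠ 0 := by
          rw [← map_sub, map_ne_zero]; exact sub_ne_zero.2 hne
        simp only [← sub_eq_add_neg, add_zero]
        field_simp
        ring
  have hae : ∀ᵐ v : ℂ, v ≠ z := by simp [ae_iff]
  have hd : (fun v => -(stokesKer g z v * q v) +
      innerKer g v z * ((1 - g v) * Complex.exp (cpair g v w))) =ᵐ[volume]
      fun v => stokesKer g z v * Complex.exp (cpair g v w) * (conj w - conj z) := by
    filter_upwards [hae] with v hv
    have : conj v - conj z ≠ 0 := by
      rw [← map_sub, map_ne_zero]; exact sub_ne_zero.2 hv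
    simp only [stokesKer, q]
    field_simp
    ring
  have hcpm0 := (measurable_cpair hg.meas).comp (measurable_prodMk_right (y := w))
  have hcpm : Measurable fun v => cpair g v w := hcpm0
  have hi := (integrable_stokesKer_mul hg hε h1 (q := fun v => Complex.exp (cpair g v w))
    hcpm.cexp.aestronglyMeasurable
    fun v => norm_exp_le (hg.norm_cpair_le_right v hδ hw)).mul_const (conj w - conj z)
  have hc : Tendsto (fun v => v * (innerKer g v z * q v)) (cocompact ℂ) (𝓝 1) := by
    have e1 := (hg.tendsto_cpair_cocompact z).neg.cexp
    have e1' := (hg.tendsto_cpair_cocompact w).cexp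
    have e2 := tendsto_div_sub_cocompact 0 z
    have e3 := Complex.continuous_conj.tendsto 1 |>.comp (tendsto_div_sub_cocompact w z)
    have e4 := (e1.mul e1').mul (e2.mul e3)
    rw [map_one, neg_zero, Complex.exp_zero, mul_one, mul_one] at e4
    refine e4.congr fun v => ?_
    simp only [innerKer, q, Function.comp, map_inv₀, map_sub, map_mul, sub_zero, mul_inv]
    ring
  have h := stokes_smooth hg hs hε h1 hq hq' (hi.congr hd.symm) hc
  rw [integral_congr_ae hd, mul_one] at h
  exact h

end SmoothIdentities

/-! ### Smooth approximation of sets, and the Stokes identities for closed sets -/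

section SetDensity

open scoped Manifold

/-- The characteristic function of a set as a density. -/
def setDensity (A : Set ℂ) : ℂ → ℝ := A.indicator 1

theorem isDensity_setDensity {A : Set ℂ} (hA : MeasurableSet A) {R : ℝ}
    (hR : A ⊆ Metric.ball 0 R) : IsDensity R (setDensity A) where
  meas := measurable_one.indicator hA
  nonneg ζ := Set.indicator_nonneg (fun _ _ => zero_le_one) _
  le_one ζ := Set.indicator_le_self' (fun _ _ => zero_le_one) _
  zero ζ hζ := Set.indicator_of_notMem (fun hm => by
    have := hR hm
    rw [mem_ball_zero_iff] at this
    linarith) _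

theorem setDensity_of_mem {A : Set ℂ} {ζ : ℂ} (h : ζ ∈ A) : setDensity A ζ = 1 := by
  rw [setDensity, Set.indicator_of_mem h]; rfl

theorem setDensity_of_notMem {A : Set ℂ} {ζ : ℂ} (h : ζ ∉ A) : setDensity A ζ = 0 :=
  Set.indicator_of_notMem h _

theorem isDensity_of_support {R : ℝ} {g : ℂ → ℝ} (hc : Measurable g) (h0 : ∀ ζ, 0 ≤ g ζ)
    (h1 : ∀ ζ, g ζ ≤ 1) {s : Set ℂ} (hs : s ⊆ Metric.ball 0 R) (hz : ∀ ζ, ζ ∉ s → g ζ = 0) :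
    IsDensity R g :=
  ⟨hc, h0, h1, fun ζ hζ => hz ζ fun h => by
    have := hs h
    rw [mem_ball_zero_iff] at this
    linarith⟩

/-- Smooth densities decreasing to the characteristic function of a closed set. -/
theorem exists_smooth_densities_closed {W s : Set ℂ} (hW : IsClosed W) (hs : IsOpen s)
    (hWs : W ⊆ s) {R : ℝ} (hR : s ⊆ Metric.ball 0 R) :
    ∃ gj : ℕ → ℂ → ℝ, (∀ j, IsDensity R (gj j)) ∧ (∀ j, ContDiff ℝ ∞ (gj j)) ∧
      (∀ j, ∀ ζ ∈ W, gj j ζ = 1) ∧ (∀ j, ∀ ζ, ζ ∉ s → gj j ζ = 0) ∧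
      ∀ ζ, Tendsto (fun j => gj j ζ) atTop (𝓝 (setDensity W ζ)) := by
  obtain ⟨f, hf, hr, hsupp, h1⟩ := exists_contMDiff_support_eq_eq_one_iff 𝓘(ℝ, ℂ) hs hW hWs
    (n := ⊤)
  rw [contMDiff_iff_contDiff] at hf
  have hr' : ∀ ζ, f ζ ∈ Set.Icc (0 : ℝ) 1 := fun ζ => hr ⟨ζ, rfl⟩
  have hz : ∀ ζ, ζ ∉ s → f ζ = 0 := fun ζ hζ => by
    rw [← hsupp] at hζ; simpa using hζ
  -- Since f = 1 exactly on W and 0 ≤ f ≤ 1, the powers decrease to the characteristic function of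
  -- W.
  refine ⟨fun j ζ => f ζ ^ (j + 1), fun j => ?_, fun j => hf.pow _, fun j ζ hζ => ?_,
    fun j ζ hζ => ?_, fun ζ => ?_⟩
  · exact isDensity_of_support (hf.continuous.measurable.pow_const _)
      (fun ζ => pow_nonneg (hr' ζ).1 _) (fun ζ => pow_le_one₀ (hr' ζ).1 (hr' ζ).2) hR
      fun ζ hζ => by simp [hz ζ hζ]
  · simp [(h1 ζ).1 hζ]
  · simp [hz ζ hζ]
  · by_cases hζ : ζ ∈ W
    · simp [setDensity_of_mem hζ, (h1 ζ).1 hζ]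
    · rw [setDensity_of_notMem hζ]
      have hne : f ζ ≠ 1 := fun h => hζ ((h1 ζ).2 h)
      exact (tendsto_pow_atTop_nhds_zero_of_lt_one (hr' ζ).1
        (lt_of_le_of_ne (hr' ζ).2 hne)).comp (tendsto_add_atTop_nat 1)

/-- Smooth densities with compact support in an open set and converging to its characteristic
function. -/
theorem exists_smooth_densities_open {U : Set ℂ} (hU : IsOpen U) {R : ℝ}
    (hR : U ⊆ Metric.ball 0 R) :
    ∃ gj : ℕ → ℂ → ℝ, (∀ j, IsDensity R (gj j)) ∧ (∀ j, ContDiff ℝ ∞ (gj j)) ∧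
      (∀ j, HasCompactSupport (gj j) ∧ tsupport (gj j) ⊆ U) ∧
      ∀ ζ, Tendsto (fun j => gj j ζ) atTop (𝓝 (setDensity U ζ)) := by
  obtain ⟨f, hf, hr, hsupp, -⟩ := exists_contMDiff_support_eq_eq_one_iff 𝓘(ℝ, ℂ) hU
    isClosed_empty (Set.empty_subset U) (n := ⊤)
  rw [contMDiff_iff_contDiff] at hf
  have hr' : ∀ ζ, f ζ ∈ Set.Icc (0 : ℝ) 1 := fun ζ => hr ⟨ζ, rfl⟩
  have hmem : ∀ ζ, f ζ ≠ 0 → ζ ∈ U := fun ζ hζ => by rw [← hsupp]; exact hζ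
  -- Vanishing where jf < 1 keeps the closed support inside {jf ≥ 1} ⊆ U; at a fixed point of U the
  -- value is 1 as soon as jf ≥ 2.
  let G : ℕ → ℂ → ℝ := fun j ζ => Real.smoothTransition ((j : ℝ) * f ζ - 1)
  have hG : ∀ j, ContDiff ℝ ∞ (G j) := fun j =>
    Real.smoothTransition.contDiff.comp ((contDiff_const.mul hf).sub contDiff_const)
  have hsub : ∀ j, tsupport (G j) ⊆ U := by
    intro j
    have hc : IsClosed {ζ | 1 ≤ (j : ℝ) * f ζ} :=
      isClosed_le continuous_const (continuous_const.mul hf.continuous)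
    have h1 : tsupport (G j) ⊆ {ζ | 1 ≤ (j : ℝ) * f ζ} := by
      refine closure_minimal (fun ζ hζ => ?_) hc
      by_contra h
      refine hζ (Real.smoothTransition.zero_of_nonpos ?_)
      simp only [Set.mem_ofPred_eq, not_le] at h
      linarith
    refine h1.trans fun ζ hζ => hmem ζ fun h => ?_
    simp only [Set.mem_ofPred_eq, h, mul_zero] at hζ
    linarith
  refine ⟨G, fun j => ?_, hG, fun j => ⟨?_, hsub j⟩, fun ζ => ?_⟩
  · exact isDensity_of_support (hG j).continuous.measurable
      (fun ζ => Real.smoothTransition.nonneg _) (fun ζ => Real.smoothTransition.le_one _) hR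
      fun ζ hζ => image_eq_zero_of_notMem_tsupport fun h => hζ (hsub j h)
  · exact Metric.isCompact_of_isClosed_isBounded (isClosed_tsupport _)
      (Metric.isBounded_ball.subset ((hsub j).trans hR))
  · by_cases hζ : ζ ∈ U
    · rw [setDensity_of_mem hζ]
      refine tendsto_const_nhds.congr' ?_
      have hpos : 0 < f ζ := lt_of_le_of_ne (hr' ζ).1 fun h => by
        rw [← hsupp] at hζ; exact hζ h.symm
      have ht : Tendsto (fun j : ℕ => (j : ℝ) * f ζ) atTop atTop :=
        tendsto_natCast_atTop_atTop.atTop_mul_const hpos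
      filter_upwards [ht.eventually_ge_atTop 2] with j hj
      exact (Real.smoothTransition.one_of_one_le (by linarith)).symm
    · rw [setDensity_of_notMem hζ]
      have : ∀ j, G j ζ = 0 := fun j =>
        image_eq_zero_of_notMem_tsupport fun h => hζ (hsub j h)
      simp [this]

variable {W : Set ℂ} {R : ℝ}

/-- The smooth approximants equal 1 on W, in particular on the disc about z, so the majorants for
both integrals do not depend on the approximant. -/
theorem stokes_bounded (hW : IsClosed W) (hR : W ⊆ Metric.ball 0 R) {z : ℂ} {ε : ℝ}
    (hε : 0 < ε) (hz : Metric.ball z ε ⊆ W) {q : ℂ → ℂ} (hq : ContDiff ℝ 1 q) {Q : ℝ}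
    (hQ : ∀ v, ‖q v‖ ≤ Q) (hq' : Integrable (wirtingerBar q)) :
    ∫ v, innerKer (setDensity W) v z * wirtingerBar q v =
      ∫ v, stokesKer (setDensity W) z v * q v := by
  obtain ⟨gj, hgj, hsm, h1, -, hlim⟩ :=
    exists_smooth_densities_closed hW Metric.isOpen_ball hR subset_rfl
  have h1' : ∀ j, ∀ ζ ∈ Metric.ball z ε, gj j ζ = 1 := fun j ζ hζ => h1 j ζ (hz hζ)
  have hL : Tendsto (fun j => ∫ v, innerKer (gj j) v z * wirtingerBar q v) atTop
      (𝓝 (∫ v, innerKer (setDensity W) v z * wirtingerBar q v)) := by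
    refine tendsto_integral_of_dominated_convergence
      (fun v => Real.exp (ε⁻¹ * (2 * cauchyBound R)) * (ε ^ 2)⁻¹ * ‖wirtingerBar q v‖)
      (fun j => (integrable_innerKer_mul (hgj j) hε (h1' j) hq').aestronglyMeasurable)
      (hq'.norm.const_mul _) (fun j => .of_forall fun v => ?_) (.of_forall fun v => ?_)
    · rw [norm_mul]
      exact mul_le_mul_of_nonneg_right (norm_innerKer_le (hgj j) hε (h1' j) v) (norm_nonneg _)
    · exact (tendsto_innerKer hgj (.of_forall hlim) v z).mul_const _
  have hRt : Tendsto (fun j => ∫ v, stokesKer (gj j) z v * q v) atTop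
      (𝓝 (∫ v, stokesKer (setDensity W) z v * q v)) := by
    refine tendsto_integral_of_dominated_convergence
      (fun v => Real.exp (ε⁻¹ * (2 * cauchyBound R)) * farMajorant z ε v * Q)
      (fun j => (integrable_stokesKer_mul (hgj j) hε (h1' j)
        hq.continuous.aestronglyMeasurable hQ).aestronglyMeasurable)
      (((integrable_farMajorant hε z).const_mul _).mul_const _)
      (fun j => .of_forall fun v => ?_) (.of_forall fun v => ?_)
    · rw [norm_mul]
      exact mul_le_mul (norm_stokesKer_le (hgj j) hε (h1' j) v) (hQ v) (norm_nonneg _)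
        (mul_nonneg (Real.exp_pos _).le (farMajorant_nonneg _ _ _))
    · exact (tendsto_stokesKer hgj hlim z v).mul_const _
  exact tendsto_nhds_unique hL (hRt.congr fun j =>
    (stokes_bounded_smooth (hgj j) (hsm j) hε (h1' j) hq hQ hq').symm)

theorem stokes_pole (hW : IsClosed W) (hR : W ⊆ Metric.ball 0 R) {z : ℂ} {ε : ℝ}
    (hε : 0 < ε) (hz : Metric.ball z ε ⊆ W) {w : ℂ} (hw : w ∉ W) :
    ∫ v, stokesKer (setDensity W) z v * Complex.exp (cpair (setDensity W) v w) *
      (conj w - conj z) = Real.pi := by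
  obtain ⟨δ, hδ, hsub⟩ := Metric.isOpen_iff.1 hW.isOpen_compl w hw
  have hδ2 : 0 < δ / 2 := by positivity
  -- The approximants must also vanish on a fixed disc about `w`, which bounds e^{P(v,w)} uniformly
  -- in v and in the approximant.
  obtain ⟨gj, hgj, hsm, h1, h0, hlim⟩ := exists_smooth_densities_closed (R := R) hW
    (s := Metric.ball 0 R \ Metric.closedBall w (δ / 2))
    (Metric.isOpen_ball.sdiff Metric.isClosed_closedBall)
    (fun ζ hζ => ⟨hR hζ, fun h => hsub (Metric.closedBall_subset_ball (by linarith) h) hζ⟩)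
    Set.sdiff_subset
  have h1' : ∀ j, ∀ ζ ∈ Metric.ball z ε, gj j ζ = 1 := fun j ζ hζ => h1 j ζ (hz hζ)
  have h0' : ∀ j, ∀ ζ ∈ Metric.ball w (δ / 2), gj j ζ = 0 := fun j ζ hζ =>
    h0 j ζ fun h => h.2 (Metric.ball_subset_closedBall hζ)
  suffices h : Tendsto (fun j => ∫ v, stokesKer (gj j) z v * Complex.exp (cpair (gj j) v w) *
      (conj w - conj z)) atTop (𝓝 (∫ v, stokesKer (setDensity W) z v *
        Complex.exp (cpair (setDensity W) v w) * (conj w - conj z))) from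
    tendsto_nhds_unique h (tendsto_const_nhds.congr fun j =>
      (stokes_pole_smooth (hgj j) (hsm j) hε (h1' j) hδ2 (h0' j)).symm)
  refine tendsto_integral_of_dominated_convergence
    (fun v => Real.exp (ε⁻¹ * (2 * cauchyBound R)) * farMajorant z ε v *
      Real.exp ((δ / 2)⁻¹ * cauchyBound R) * ‖conj w - conj z‖)
    (fun j => ?_) ((((integrable_farMajorant hε z).const_mul _).mul_const _).mul_const _)
    (fun j => .of_forall fun v => ?_) (.of_forall fun v => ?_)
  · have m1 := (measurable_stokesKer (hgj j).meas).comp (measurable_prodMk_left (x := z))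
    have m2 := (measurable_cpair (hgj j).meas).comp (measurable_prodMk_right (y := w))
    have m3 := (m1.mul m2.cexp).mul_const (conj w - conj z)
    exact m3.aestronglyMeasurable
  · rw [norm_mul, norm_mul]
    refine mul_le_mul_of_nonneg_right ?_ (norm_nonneg _)
    exact mul_le_mul (norm_stokesKer_le (hgj j) hε (h1' j) v)
      (norm_exp_le ((hgj j).norm_cpair_le_right v hδ2 (h0' j))) (norm_nonneg _)
      (mul_nonneg (Real.exp_pos _).le (farMajorant_nonneg _ _ _))
  · exact ((tendsto_stokesKer hgj hlim z v).mul
      (tendsto_cpair_of_far hgj (.of_forall hlim) v hδ2 (.of_forall h0')).cexp).mul_const _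

end SetDensity

/-! ### Analytic functions on the exterior and their ∂̄-data -/

section ExtAnalyticFacts

variable {Ω : Set ℂ}

theorem contDiff_wirtingerBar {f : ℂ → ℂ} (hf : ContDiff ℝ ∞ f) :
    ContDiff ℝ ∞ (wirtingerBar f) := by
  have h : ContDiff ℝ ∞ (fderiv ℝ f) := hf.fderiv_right (by norm_cast)
  exact ((h.clm_apply contDiff_const).add
    (contDiff_const.mul (h.clm_apply contDiff_const))).div_const 2

/-- Analyticity is an open condition, so f is analytic on a neighbourhood of the complement of Ω and
the closed support of ∂̄f cannot reach the boundary. -/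
theorem tsupport_wirtingerBar_subset (f : ExtAnalytic Ω) :
    tsupport (wirtingerBar f.1) ⊆ Ω := by
  have hopen : IsOpen {z | AnalyticAt ℂ f.1 z} := isOpen_analyticAt ℂ f.1
  have h1 : tsupport (wirtingerBar f.1) ⊆ {z | AnalyticAt ℂ f.1 z}ᶜ :=
    closure_minimal (fun z hz ha => hz (hasDbarAt_of_holo ha.differentiableAt).2)
      hopen.isClosed_compl
  intro z hz
  by_contra h
  exact h1 hz (f.2.2.1 z h)

theorem hasCompactSupport_wirtingerBar_ext (hb : Bornology.IsBounded Ω) (f : ExtAnalytic Ω) :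
    HasCompactSupport (wirtingerBar f.1) :=
  Metric.isCompact_of_isClosed_isBounded (isClosed_tsupport _)
    (hb.subset (tsupport_wirtingerBar_subset f))

theorem exists_bound_ext (f : ExtAnalytic Ω) : ∃ Q, ∀ v, ‖f.1 v‖ ≤ Q := by
  have h := f.2.2.2
  have h1 : ∀ᶠ v in cocompact ℂ, ‖f.1 v‖ < 1 := by
    simpa using h.norm.eventually (gt_mem_nhds (by simp : ‖(0 : ℂ)‖ < 1))
  obtain ⟨K, hK, hKs⟩ := mem_cocompact.1 h1
  obtain ⟨C, hC⟩ := hK.exists_bound_of_continuousOn f.2.1.continuous.continuousOn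
  refine ⟨max C 1, fun v => ?_⟩
  by_cases hv : v ∈ K
  · exact (hC v hv).trans (le_max_left _ _)
  · exact (le_of_lt (hKs hv)).trans (le_max_right _ _)

theorem tendsto_cauchyT_cocompact {h : ℂ → ℂ} (hi : Integrable h) (hc : HasCompactSupport h) :
    Tendsto (cauchyT h) (cocompact ℂ) (𝓝 0) := by
  obtain ⟨ρ, hρ⟩ := hc.isCompact.isBounded.subset_closedBall (0 : ℂ)
  have hz : ∀ ζ, h ζ ≠ 0 → ‖ζ‖ ≤ ρ := fun ζ hζ => by
    simpa using hρ (subset_tsupport _ hζ)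
  have hnorm : Tendsto (fun v : ℂ => ‖v‖ - ρ) (cocompact ℂ) atTop :=
    tendsto_atTop_add_const_right _ _ tendsto_norm_cocompact_atTop
  have h0 : Tendsto (fun v : ℂ => (∫ ζ, ‖h ζ‖) * (‖v‖ - ρ)⁻¹) (cocompact ℂ) (𝓝 0) := by
    simpa using (tendsto_inv_atTop_zero.comp hnorm).const_mul (∫ ζ, ‖h ζ‖)
  have h1 : Tendsto (fun v => ∫ ζ, h ζ * (v - ζ)⁻¹) (cocompact ℂ) (𝓝 0) := by
    refine squeeze_zero_norm' ?_ h0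
    filter_upwards [hnorm.eventually_gt_atTop 0] with v hv
    rw [← integral_mul_const]
    refine norm_integral_le_of_norm_le (hi.norm.mul_const _) (.of_forall fun ζ => ?_)
    rw [norm_mul, norm_inv]
    by_cases hζ : h ζ = 0
    · simp [hζ]
    · refine mul_le_mul_of_nonneg_left (inv_anti₀ hv ?_) (norm_nonneg _)
      have := norm_sub_norm_le v ζ
      linarith [hz ζ hζ]
  have h2 := h1.const_mul (1 / (Real.pi : ℂ))
  rw [mul_zero] at h2
  exact h2

/-- Analytic functions on the exterior are the Cauchy transforms of their `∂̄`-data. -/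
theorem ext_eq_cauchyT (hb : Bornology.IsBounded Ω) (f : ExtAnalytic Ω) (w : ℂ) :
    f.1 w = cauchyT (wirtingerBar f.1) w := by
  have hφ := contDiff_wirtingerBar f.2.1
  have hc := hasCompactSupport_wirtingerBar_ext hb f
  have hT := contDiff_cauchyT hφ hc
  -- The difference is entire and tends to zero at infinity; Liouville's theorem finishes.
  have hd : Differentiable ℂ fun w => f.1 w + -cauchyT (wirtingerBar f.1) w := fun w => by
    refine HasDbarAt.differentiableAt_complex ?_
    refine ((hasDbarAt_of_contDiff (f.2.1.of_le (by norm_cast)) w).add (HasDbarAt.neg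
      (hasDbarAt_of_contDiff (hT.of_le (by norm_cast)) w))).congr_dbar ?_
    rw [wirtingerBar_cauchyT hφ hc]; ring
  have ht : Tendsto (fun w => f.1 w + -cauchyT (wirtingerBar f.1) w) (cocompact ℂ) (𝓝 0) := by
    simpa using f.2.2.2.add (tendsto_cauchyT_cocompact
      (hφ.continuous.integrable_of_hasCompactSupport hc) hc).neg
  have := hd.apply_eq_of_tendsto_cocompact w ht
  linear_combination this

end ExtAnalyticFacts

/-! ### Representation of an analytic function by a density outside W -/

section Psi

/-- The weight `(1 + |v|)⁻³`. -/
def decay (v : ℂ) : ℝ := (1 + ‖v‖) ^ (-(3 : ℝ))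

theorem decay_nonneg (v : ℂ) : 0 ≤ decay v := by unfold decay; positivity

theorem integrable_decay : Integrable decay :=
  integrable_one_add_norm (by rw [Complex.finrank_real_complex]; norm_num)

/-- The comparison makes the weight independent of z in a bounded disc, as needed to integrate over
z against ∂̄f. -/
theorem farMajorant_le_decay {ε R : ℝ} (hε : 0 < ε) {z : ℂ} (hz : ‖z‖ ≤ R) (v : ℂ) :
    farMajorant z ε v ≤ (1 + ε⁻¹) ^ 3 * (1 + R) ^ 3 * decay v := by
  have hR : 0 ≤ R := (norm_nonneg z).trans hz
  have h3 : ∀ t : ℝ, 0 ≤ t → (1 + t) ^ (-(3 : ℝ)) = ((1 + t) ^ 3)⁻¹ := fun t ht => by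
    rw [Real.rpow_neg (by positivity)]; norm_cast
  refine (farMajorant_le hε z v).trans ?_
  rw [mul_assoc]
  refine mul_le_mul_of_nonneg_left ?_ (by positivity)
  rw [decay, h3 _ (norm_nonneg _), h3 _ (norm_nonneg _), ← div_eq_mul_inv,
    le_div_iff₀ (by positivity), inv_mul_le_iff₀ (by positivity), ← mul_pow]
  refine pow_le_pow_left₀ (by positivity) ?_ 3
  have h1 : ‖v‖ ≤ ‖v - z‖ + ‖z‖ := by simpa using norm_add_le (v - z) z
  nlinarith [norm_nonneg (v - z), mul_nonneg (norm_nonneg (v - z)) hR]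

variable {Ω W : Set ℂ} {R : ℝ}

/-- The conjugate of the density on `ℂ ∖ W` that represents `f`. -/
def psiConj (W : Set ℂ) (φ : ℂ → ℂ) (v : ℂ) : ℂ :=
  (1 / (Real.pi : ℂ) ^ 2) * ∫ z, conj (φ z) * stokesKer (setDensity W) z v

/-- The constant in the bounds for `psiConj`. -/
def psiBound (ε R : ℝ) : ℝ :=
  Real.exp (ε⁻¹ * (2 * cauchyBound R)) * ((1 + ε⁻¹) ^ 3 * (1 + R) ^ 3)

theorem norm_conj_mul_stokesKer_le (hW : IsClosed W) (hR : W ⊆ Metric.ball 0 R) {φ : ℂ → ℂ}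
    {ε : ℝ} (hε : 0 < ε) (hφ : ∀ z, φ z ≠ 0 → Metric.ball z ε ⊆ W) (z v : ℂ) :
    ‖conj (φ z) * stokesKer (setDensity W) z v‖ ≤ ‖φ z‖ * (psiBound ε R * decay v) := by
  rw [norm_mul, RCLike.norm_conj]
  by_cases h : φ z = 0
  · simp [h]
  refine mul_le_mul_of_nonneg_left ?_ (norm_nonneg _)
  have hz := hφ z h
  have hzR : ‖z‖ ≤ R := by
    have := hR (hz (Metric.mem_ball_self hε))
    rw [mem_ball_zero_iff] at this
    exact this.le
  refine (norm_stokesKer_le (isDensity_setDensity hW.measurableSet hR) hε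
    (fun ζ hζ => setDensity_of_mem (hz hζ)) v).trans ?_
  rw [psiBound, mul_assoc]
  exact mul_le_mul_of_nonneg_left (farMajorant_le_decay hε hzR v) (Real.exp_pos _).le

theorem measurable_conj_mul_stokesKer (hW : IsClosed W) {φ : ℂ → ℂ} (hφ : Continuous φ) :
    Measurable fun p : ℂ × ℂ => conj (φ p.1) * stokesKer (setDensity W) p.1 p.2 := by
  have h1 : Measurable fun p : ℂ × ℂ => conj (φ p.1) :=
    (Complex.continuous_conj.comp (hφ.comp continuous_fst)).measurable
  have h2 : Measurable (setDensity W) := measurable_one.indicator hW.measurableSet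
  exact h1.mul (measurable_stokesKer h2)

theorem measurable_psiConj (hW : IsClosed W) {φ : ℂ → ℂ} (hφ : Continuous φ) :
    Measurable (psiConj W φ) := by
  have h := (measurable_conj_mul_stokesKer hW hφ).stronglyMeasurable.integral_prod_left'
    (μ := volume)
  exact h.measurable.const_mul _

theorem norm_psiConj_le (hW : IsClosed W) (hR : W ⊆ Metric.ball 0 R) {φ : ℂ → ℂ}
    (hi : Integrable φ) {ε : ℝ} (hε : 0 < ε) (hφ : ∀ z, φ z ≠ 0 → Metric.ball z ε ⊆ W) (v : ℂ) :
    ‖psiConj W φ v‖ ≤ (∫ z, ‖φ z‖) * psiBound ε R * decay v := by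
  have hpi : ‖(1 / (Real.pi : ℂ) ^ 2)‖ ≤ 1 := by
    rw [norm_div, norm_one, norm_pow, Complex.norm_real, Real.norm_of_nonneg Real.pi_pos.le,
      div_le_one (by positivity)]
    nlinarith [Real.pi_gt_three]
  rw [psiConj, norm_mul]
  refine (mul_le_of_le_one_left (norm_nonneg _) hpi).trans ?_
  rw [mul_assoc, ← integral_mul_const]
  exact norm_integral_le_of_norm_le (hi.norm.mul_const _)
    (.of_forall fun z => norm_conj_mul_stokesKer_le hW hR hε hφ z v)

theorem psiConj_eq_zero {φ : ℂ → ℂ} {v : ℂ} (hv : v ∈ W) : psiConj W φ v = 0 := by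
  simp [psiConj, stokesKer, setDensity_of_mem hv]

theorem integral_psiConj_mul (hW : IsClosed W) (hR : W ⊆ Metric.ball 0 R) {φ : ℂ → ℂ}
    (hc : Continuous φ) (hi : Integrable φ) {ε : ℝ} (hε : 0 < ε)
    (hφ : ∀ z, φ z ≠ 0 → Metric.ball z ε ⊆ W) {q : ℂ → ℂ} (hq : Measurable q) {Q : ℝ}
    (hQ : ∀ v, ‖q v‖ ≤ Q) :
    ∫ v, psiConj W φ v * q v =
      (1 / (Real.pi : ℂ) ^ 2) * ∫ z, conj (φ z) * ∫ v, stokesKer (setDensity W) z v * q v := by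
  have hint : Integrable (fun p : ℂ × ℂ =>
      conj (φ p.1) * stokesKer (setDensity W) p.1 p.2 * q p.2) (volume.prod volume) := by
    have hb : Integrable (fun p : ℂ × ℂ => ‖φ p.1‖ * (psiBound ε R * decay p.2 * Q))
        (volume.prod volume) :=
      hi.norm.mul_prod ((integrable_decay.const_mul _).mul_const _)
    refine hb.mono' ((measurable_conj_mul_stokesKer hW hc).mul
      (hq.comp measurable_snd)).aestronglyMeasurable (.of_forall fun p => ?_)
    rw [norm_mul, ← mul_assoc]
    have h1 := norm_conj_mul_stokesKer_le hW hR hε hφ p.1 p.2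
    exact mul_le_mul h1 (hQ _) (norm_nonneg _) ((norm_nonneg _).trans h1)
  have hswap := integral_integral_swap (f := fun z v =>
    conj (φ z) * stokesKer (setDensity W) z v * q v) hint
  simp only [psiConj, mul_assoc, integral_const_mul] at hswap ⊢
  rw [hswap]
  congr 1
  refine integral_congr_ae (.of_forall fun v => ?_)
  simp only []
  rw [← integral_mul_const]
  simp only [mul_assoc]

/-- The representing density has integral zero. -/
theorem integral_psiConj (hW : IsClosed W) (hR : W ⊆ Metric.ball 0 R) {φ : ℂ → ℂ}
    (hc : Continuous φ) (hi : Integrable φ) {ε : ℝ} (hε : 0 < ε)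
    (hφ : ∀ z, φ z ≠ 0 → Metric.ball z ε ⊆ W) : ∫ v, psiConj W φ v = 0 := by
  have h := integral_psiConj_mul hW hR hc hi hε hφ (q := fun _ => 1) measurable_const (Q := 1)
    (by simp)
  simp only [mul_one] at h
  rw [h]
  -- Stokes with the constant test function 1, whose ∂̄ is zero.
  have hz : ∀ z, conj (φ z) * ∫ v, stokesKer (setDensity W) z v = 0 := by
    intro z
    by_cases h0 : φ z = 0
    · simp [h0]
    have h1 : wirtingerBar (fun _ : ℂ => (1 : ℂ)) = 0 := by
      funext v; exact (hasDbarAt_const 1 v).2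
    have h2 := stokes_bounded hW hR hε (hφ z h0) (q := fun _ => 1) contDiff_const (Q := 1)
      (by simp) (by rw [h1]; exact integrable_zero _ _ _)
    rw [h1] at h2
    simp only [Pi.zero_apply, mul_zero, integral_zero, mul_one] at h2
    rw [← h2, mul_zero]
  simp [hz]

/-- Division of `stokes_pole` by w̄ − z̄ writes the conjugate Cauchy kernel as a superposition of
the functions e^{P(v,w)}. Integration against the conjugate of ∂̄f recovers f, which is the Cauchy
transform of ∂̄f. -/
theorem conj_eq_integral_psiConj (hb : Bornology.IsBounded Ω) (f : ExtAnalytic Ω)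
    (hW : IsClosed W) (hR : W ⊆ Metric.ball 0 R) {ε : ℝ} (hε : 0 < ε)
    (hφ : ∀ z, wirtingerBar f.1 z ≠ 0 → Metric.ball z ε ⊆ W) {w : ℂ} (hw : w ∉ W) :
    conj (f.1 w) = ∫ v, psiConj W (wirtingerBar f.1) v *
      Complex.exp (cpair (setDensity W) v w) := by
  have hc := (contDiff_wirtingerBar f.2.1).continuous
  have hi : Integrable (wirtingerBar f.1) := hc.integrable_of_hasCompactSupport
    (hasCompactSupport_wirtingerBar_ext hb f)
  obtain ⟨δ, hδ, hsub⟩ := Metric.isOpen_iff.1 hW.isOpen_compl w hw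
  have hD := isDensity_setDensity hW.measurableSet hR
  have hm := (measurable_cpair hD.meas).comp (measurable_prodMk_right (y := w))
  rw [integral_psiConj_mul hW hR hc hi hε hφ (q := fun v => Complex.exp (cpair (setDensity W) v w))
    hm.cexp (fun v => norm_exp_le (hD.norm_cpair_le_right v hδ
      fun ζ hζ => setDensity_of_notMem (hsub hζ))), ext_eq_cauchyT hb f w, cauchyT, map_mul,
    ← integral_conj]
  have hpi : (Real.pi : ℂ) ≠ 0 := by exact_mod_cast Real.pi_ne_zero
  have hz : ∀ z, conj (wirtingerBar f.1 z * (w - z)⁻¹) = (1 / (Real.pi : ℂ)) *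
      (conj (wirtingerBar f.1 z) * ∫ v, stokesKer (setDensity W) z v *
        Complex.exp (cpair (setDensity W) v w)) := by
    intro z
    by_cases h0 : wirtingerBar f.1 z = 0
    · simp [h0]
    have h1 := stokes_pole hW hR hε (hφ z h0) hw
    rw [integral_mul_const] at h1
    have hne : conj w - conj z ≠ 0 := by
      rw [← map_sub, map_ne_zero, sub_ne_zero]
      rintro rfl
      exact hw (hφ w h0 (Metric.mem_ball_self hε))
    rw [eq_div_of_mul_eq hne h1, map_mul, map_inv₀, map_sub]
    field_simp
  simp only [hz, integral_const_mul]
  simp only [map_div₀, map_one, Complex.conj_ofReal]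
  ring

/-- The pairing of the representing density with another function. -/
theorem integral_psiConj_mul_ext (hb : Bornology.IsBounded Ω) (f g : ExtAnalytic Ω)
    (hW : IsClosed W) (hR : W ⊆ Metric.ball 0 R) {ε : ℝ} (hε : 0 < ε)
    (hφ : ∀ z, wirtingerBar f.1 z ≠ 0 → Metric.ball z ε ⊆ W) :
    ∫ v, psiConj W (wirtingerBar f.1) v * g.1 v = (1 / (Real.pi : ℂ) ^ 2) *
      ∫ z, conj (wirtingerBar f.1 z) * ∫ v, innerKer (setDensity W) v z * wirtingerBar g.1 v := by
  have hc := (contDiff_wirtingerBar f.2.1).continuous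
  have hi : Integrable (wirtingerBar f.1) := hc.integrable_of_hasCompactSupport
    (hasCompactSupport_wirtingerBar_ext hb f)
  have hgi : Integrable (wirtingerBar g.1) :=
    (contDiff_wirtingerBar g.2.1).continuous.integrable_of_hasCompactSupport
      (hasCompactSupport_wirtingerBar_ext hb g)
  obtain ⟨Q, hQ⟩ := exists_bound_ext g
  rw [integral_psiConj_mul hW hR hc hi hε hφ g.2.1.continuous.measurable hQ]
  congr 1
  refine integral_congr_ae (.of_forall fun z => ?_)
  by_cases h0 : wirtingerBar f.1 z = 0
  · simp [h0]
  simp only []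
  rw [stokes_bounded hW hR hε (hφ z h0) (g.2.1.of_le (by norm_cast)) hQ hgi]

end Psi

/-! ### Boundary growth of the diagonal, and good sets around Ω -/

section Annulus

theorem polarCoord_symm_eq (r θ : ℝ) :
    Complex.polarCoord.symm (r, θ) = r * Complex.exp (θ * Complex.I) := by
  rw [Complex.polarCoord_symm_apply, Complex.exp_mul_I]
  simp

/-- The Poisson kernel has mean value one. -/
theorem integral_circle_poisson {v : ℂ} {r : ℝ} (hr : ‖v‖ < r) :
    ∫ θ in Set.Ioo (-Real.pi) Real.pi, ((r * Complex.exp (θ * Complex.I) - v) *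
      (conj (r * Complex.exp (θ * Complex.I)) - conj v))⁻¹ =
      ((2 * Real.pi / (r ^ 2 - ‖v‖ ^ 2) : ℝ) : ℂ) := by
  have hr0 : 0 < r := (norm_nonneg v).trans_lt hr
  have hr' : (r : ℂ) ≠ 0 := by exact_mod_cast hr0.ne'
  have hpos : 0 < r ^ 2 - ‖v‖ ^ 2 := by nlinarith [norm_nonneg v]
  have hposC : (r : ℂ) ^ 2 - (‖v‖ : ℂ) ^ 2 ≠ 0 := by exact_mod_cast hpos.ne'
  have hne : ∀ θ : ℝ, r * Complex.exp (θ * Complex.I) - v ≠ 0 := fun θ h => by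
    have h1 := congrArg norm (sub_eq_zero.1 h)
    rw [norm_mul, Complex.norm_exp_ofReal_mul_I, mul_one, Complex.norm_real,
      Real.norm_of_nonneg hr0.le] at h1
    exact hr.ne' h1
  let J : ℝ → ℂ := fun θ => Complex.exp (θ * Complex.I) * (r * Complex.exp (θ * Complex.I) - v)⁻¹
  have hJc : Continuous J := Continuous.mul (by fun_prop) (Continuous.inv₀ (by fun_prop) hne)
  have hJi : IntegrableOn J (Set.Ioo (-Real.pi) Real.pi) :=
    (hJc.continuousOn.integrableOn_compact isCompact_Icc).mono_set Set.Ioo_subset_Icc_self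
  have hJci : IntegrableOn (fun θ => conj (J θ)) (Set.Ioo (-Real.pi) Real.pi) :=
    ((Complex.continuous_conj.comp hJc).continuousOn.integrableOn_compact
      isCompact_Icc).mono_set Set.Ioo_subset_Icc_self
  have hJ : ∫ θ in Set.Ioo (-Real.pi) Real.pi, J θ = ((2 * Real.pi / r : ℝ) : ℂ) := by
    have := integral_circle_cauchy hr0 hr.ne
    rwa [if_pos hr] at this
  have e : ∀ θ : ℝ, ((r * Complex.exp (θ * Complex.I) - v) *
      (conj (r * Complex.exp (θ * Complex.I)) - conj v))⁻¹ =
      ((r : ℂ) ^ 2 - (‖v‖ : ℂ) ^ 2)⁻¹ * (r * (J θ + conj (J θ)) - 1) := by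
    intro θ
    have h1 := hne θ
    have h2 : conj (r * Complex.exp (θ * Complex.I)) - conj v ≠ 0 := by
      rw [← map_sub, map_ne_zero]; exact h1
    have h3 : (r : ℂ) ^ 2 = (r * Complex.exp (θ * Complex.I)) *
        conj (r * Complex.exp (θ * Complex.I)) := by
      rw [Complex.mul_conj', norm_mul, Complex.norm_exp_ofReal_mul_I, Complex.norm_real,
        Real.norm_of_nonneg hr0.le]
      push_cast; ring
    have h4 : (‖v‖ : ℂ) ^ 2 = v * conj v := (Complex.mul_conj' v).symm
    have h5 : r * J θ = (r * Complex.exp (θ * Complex.I)) *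
        (r * Complex.exp (θ * Complex.I) - v)⁻¹ := by simp only [J]; ring
    have h6 : r * conj (J θ) = conj (r * Complex.exp (θ * Complex.I)) *
        (conj (r * Complex.exp (θ * Complex.I)) - conj v)⁻¹ := by
      rw [← map_sub, ← map_inv₀, ← map_mul, ← h5, map_mul (starRingEnd ℂ) (r : ℂ) (J θ),
        Complex.conj_ofReal]
    have h7 := hposC
    rw [mul_add, h5, h6]
    rw [h3, h4] at h7 ⊢
    generalize (r * Complex.exp (θ * Complex.I)) = A at h1 h2 h7 ⊢
    generalize conj A = B at h2 h7 ⊢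
    generalize conj v = u at h2 h7 ⊢
    field_simp
    ring
  simp only [e]
  have h1 : IntegrableOn (fun _ : ℝ => (1 : ℂ)) (Set.Ioo (-Real.pi) Real.pi) := by simp
  have h2 : IntegrableOn (fun θ => r * (J θ + conj (J θ))) (Set.Ioo (-Real.pi) Real.pi) :=
    (hJi.add hJci).const_mul _
  rw [integral_const_mul, integral_sub h2 h1, integral_const_mul, integral_add hJi hJci,
    integral_conj, hJ, Complex.conj_ofReal]
  simp only [integral_const, MeasurableSet.univ, measureReal_restrict_apply, Set.univ_inter,
    Real.volume_real_Ioo, Complex.real_smul, mul_one]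
  rw [max_eq_left (by linarith [Real.pi_pos])]
  push_cast
  field_simp
  ring

/-- The density of an annulus. -/
def annulusDensity (r ρ : ℝ) : ℂ → ℝ := setDensity {ζ | r ≤ ‖ζ‖ ∧ ‖ζ‖ < ρ}

theorem isDensity_annulus (r ρ : ℝ) : IsDensity ρ (annulusDensity r ρ) :=
  isDensity_setDensity ((measurableSet_le measurable_const measurable_norm).inter
    (measurableSet_lt measurable_norm measurable_const)) fun ζ hζ => by simpa using hζ.2

theorem annulusDensity_apply (r ρ : ℝ) (ζ : ℂ) :
    annulusDensity r ρ ζ = if r ≤ ‖ζ‖ ∧ ‖ζ‖ < ρ then 1 else 0 := by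
  classical
  rw [annulusDensity, setDensity, Set.indicator_apply]
  rfl

theorem annulusDensity_ball {r ρ : ℝ} {v : ℂ} :
    ∀ ζ ∈ Metric.ball v (r - ‖v‖), annulusDensity r ρ ζ = 0 := fun ζ hζ => by
  rw [annulusDensity_apply, if_neg]
  rintro ⟨h, -⟩
  rw [Metric.mem_ball, dist_eq_norm] at hζ
  have := norm_sub_norm_le ζ v
  linarith

/-- On the circle of radius s the mean value of the Poisson kernel gives 2π/(s² − |v|²); the radial
integral of 2πs/(s² − |v|²) is a logarithm. -/
theorem cpair_annulus {v : ℂ} {r ρ : ℝ} (hv : ‖v‖ < r) (hr : r ≤ ρ) :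
    cpair (annulusDensity r ρ) v v =
      ((Real.log (ρ ^ 2 - ‖v‖ ^ 2) - Real.log (r ^ 2 - ‖v‖ ^ 2) : ℝ) : ℂ) := by
  have hD := isDensity_annulus r ρ
  have hm := hD.meas
  have hconj : Measurable fun ζ : ℂ => conj ζ := Complex.continuous_conj.measurable
  rw [cpair, integral_polar (by fun_prop)
    (hD.integrable_right v (sub_pos.2 hv) annulusDensity_ball)]
  have hinner : ∀ s ∈ Set.Ioi (0 : ℝ),
      (∫ θ in Set.Ioo (-Real.pi) Real.pi,
        s • ((annulusDensity r ρ (Complex.polarCoord.symm (s, θ)) : ℂ) *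
        ((Complex.polarCoord.symm (s, θ) - v) *
          (conj (Complex.polarCoord.symm (s, θ)) - conj v))⁻¹)) =
      (Set.Ico r ρ).indicator
        (fun s => ((Real.pi * (2 * s / (s ^ 2 - ‖v‖ ^ 2)) : ℝ) : ℂ)) s := by
    intro s hs
    have hs : 0 < s := hs
    have hd : ∀ θ : ℝ, annulusDensity r ρ (Complex.polarCoord.symm (s, θ)) =
        if r ≤ s ∧ s < ρ then 1 else 0 := by
      intro θ
      rw [polarCoord_symm_eq, annulusDensity_apply]
      simp [Complex.norm_exp_ofReal_mul_I, abs_of_pos hs]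
    classical
    simp only [hd]
    simp only [polarCoord_symm_eq, Set.indicator_apply, Set.mem_Ico]
    split_ifs with h
    · have := integral_circle_poisson (hv.trans_le h.1)
      simp only [Complex.ofReal_one, one_mul]
      rw [integral_smul, this, Complex.real_smul]
      push_cast
      ring
    · simp
  have hset : (∫ s in Set.Ioi (0 : ℝ), ∫ θ in Set.Ioo (-Real.pi) Real.pi,
        s • ((annulusDensity r ρ (Complex.polarCoord.symm (s, θ)) : ℂ) *
        ((Complex.polarCoord.symm (s, θ) - v) *
          (conj (Complex.polarCoord.symm (s, θ)) - conj v))⁻¹)) =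
      ((Real.pi * (Real.log (ρ ^ 2 - ‖v‖ ^ 2) - Real.log (r ^ 2 - ‖v‖ ^ 2)) : ℝ) : ℂ) := by
    rw [setIntegral_congr_fun measurableSet_Ioi hinner]
    have hr0 : 0 < r := (norm_nonneg v).trans_lt hv
    rw [setIntegral_indicator measurableSet_Ico, show Set.Ioi 0 ∩ Set.Ico r ρ = Set.Ico r ρ from
      Set.inter_eq_right.2 fun s hs => hr0.trans_le hs.1, integral_complex_ofReal, integral_const_mul,
      integral_Ico_eq_integral_Ioc, ← intervalIntegral.integral_of_le hr]
    have hpos : ∀ s ∈ Set.uIcc r ρ, s ^ 2 - ‖v‖ ^ 2 ≠ 0 := fun s hs => by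
      rw [Set.uIcc_of_le hr] at hs
      have := hv.trans_le hs.1
      nlinarith [norm_nonneg v]
    rw [intervalIntegral.integral_eq_sub_of_hasDerivAt (a := r) (b := ρ)
      (f := fun s => Real.log (s ^ 2 - ‖v‖ ^ 2))]
    · intro s hs
      have h := (((hasDerivAt_pow 2 s).sub_const (‖v‖ ^ 2)).log (hpos s hs))
      simpa using h
    · refine ContinuousOn.intervalIntegrable ?_
      exact ContinuousOn.div (by fun_prop) (by fun_prop) hpos
  rw [hset]
  have hpi : (Real.pi : ℂ) ≠ 0 := by exact_mod_cast Real.pi_ne_zero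
  push_cast
  field_simp

theorem cpair_diag_re (g : ℂ → ℝ) (v : ℂ) :
    (cpair g v v).re = 1 / Real.pi * ∫ ζ, g ζ * (‖ζ - v‖ ^ 2)⁻¹ := by
  have h : ∀ ζ, (g ζ : ℂ) * ((ζ - v) * (conj ζ - conj v))⁻¹ =
      ((g ζ * (‖ζ - v‖ ^ 2)⁻¹ : ℝ) : ℂ) := fun ζ => by
    rw [← map_sub, Complex.mul_conj']
    push_cast
    rfl
  simp only [cpair, h]
  rw [integral_complex_ofReal, ← Complex.ofReal_one, ← Complex.ofReal_div, ← Complex.ofReal_mul,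
    Complex.ofReal_re]

theorem IsDensity.integrable_diag {R : ℝ} {g : ℂ → ℝ} (hg : IsDensity R g) {v : ℂ} {δ : ℝ}
    (hδ : 0 < δ) (hv : ∀ ζ ∈ Metric.ball v δ, g ζ = 0) :
    Integrable fun ζ => g ζ * (‖ζ - v‖ ^ 2)⁻¹ := by
  refine (hg.integrable_right v hδ hv).norm.congr (.of_forall fun ζ => ?_)
  simp only [hg.norm_integrand]
  rw [sq, mul_inv]

theorem re_cpair_mono {R R' : ℝ} {g g' : ℂ → ℝ} (hg : IsDensity R g) (hg' : IsDensity R' g')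
    (h : ∀ ζ, g ζ ≤ g' ζ) {v : ℂ} {δ : ℝ} (hδ : 0 < δ) (hv : ∀ ζ ∈ Metric.ball v δ, g' ζ = 0) :
    (cpair g v v).re ≤ (cpair g' v v).re := by
  rw [cpair_diag_re, cpair_diag_re]
  have h0 : ∀ ζ ∈ Metric.ball v δ, g ζ = 0 := fun ζ hζ =>
    le_antisymm ((h ζ).trans_eq (hv ζ hζ)) (hg.nonneg ζ)
  refine mul_le_mul_of_nonneg_left (integral_mono (hg.integrable_diag hδ h0)
    (hg'.integrable_diag hδ hv) fun ζ => ?_) (by positivity)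
  exact mul_le_mul_of_nonneg_right (h ζ) (by positivity)

/-- A set that misses a disc has an exterior exponential transform whose diagonal decays at least
like the distance to the circle. -/
theorem exp_half_cpair_le {W : Set ℂ} {R : ℝ} (hW : MeasurableSet W) (hR : W ⊆ Metric.ball 0 R)
    (hR0 : 0 ≤ R) {c v : ℂ} {r : ℝ} (hr : Disjoint W (Metric.ball c r)) (hv : ‖v - c‖ < r) :
    Real.exp ((cpair (setDensity W) v v).re / 2) ≤
      (R + ‖c‖ + r) * r ^ (-(1 / 2) : ℝ) * (r - ‖v - c‖) ^ (-(1 / 2) : ℝ) := by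
  have hr0 : 0 < r := (norm_nonneg _).trans_lt hv
  -- Points of W satisfy |ζ − c| < R + |c|, so W lies in the annulus r ≤ |ζ − c| < ρ; the summand r
  -- ensures r ≤ ρ.
  set ρ := R + ‖c‖ + r with hρ
  have hrρ : r ≤ ρ := by rw [hρ]; linarith [norm_nonneg c]
  have hD := isDensity_setDensity hW hR
  have ht := cpair_translate (annulusDensity r ρ) (v - c) (v - c) c
  rw [sub_add_cancel, cpair_annulus hv hrρ] at ht
  have hann : IsDensity (ρ + ‖c‖) fun ζ => annulusDensity r ρ (ζ - c) := by
    have h := isDensity_annulus r ρ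
    refine ⟨h.meas.comp (measurable_sub_const c), fun ζ => h.nonneg _, fun ζ => h.le_one _,
      fun ζ hζ => h.zero _ ?_⟩
    have := norm_sub_norm_le ζ c
    linarith
  have hmono := re_cpair_mono hD hann (v := v) (fun ζ => by
    by_cases hζ : ζ ∈ W
    · rw [setDensity_of_mem hζ, annulusDensity_apply, if_pos]
      constructor
      · by_contra hlt
        exact Set.disjoint_left.1 hr hζ (by rw [Metric.mem_ball, dist_eq_norm]; exact not_le.1 hlt)
      · have h1 := hR hζ
        rw [mem_ball_zero_iff] at h1
        have := norm_sub_le ζ c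
        linarith
    · rw [setDensity_of_notMem hζ]
      exact (isDensity_annulus r ρ).nonneg _) (sub_pos.2 hv) (fun ζ hζ => by
      refine annulusDensity_ball (v := v - c) _ ?_
      simpa [dist_eq_norm] using hζ)
  rw [ht, Complex.ofReal_re] at hmono
  have hm0 := norm_nonneg (v - c)
  have hA : 0 < ρ ^ 2 - ‖v - c‖ ^ 2 := by nlinarith
  have hB : 0 < r ^ 2 - ‖v - c‖ ^ 2 := by nlinarith
  calc Real.exp ((cpair (setDensity W) v v).re / 2)
      ≤ Real.exp (Real.log (ρ ^ 2 - ‖v - c‖ ^ 2) * (1 / 2) +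
          Real.log (r ^ 2 - ‖v - c‖ ^ 2) * (-(1 / 2))) := Real.exp_le_exp.2 (by linarith)
    _ = (ρ ^ 2 - ‖v - c‖ ^ 2) ^ (1 / 2 : ℝ) * (r ^ 2 - ‖v - c‖ ^ 2) ^ (-(1 / 2) : ℝ) := by
      rw [Real.exp_add, ← Real.rpow_def_of_pos hA, ← Real.rpow_def_of_pos hB]
    _ ≤ ρ * (r * (r - ‖v - c‖)) ^ (-(1 / 2) : ℝ) := by
      refine mul_le_mul ?_ (Real.rpow_le_rpow_of_nonpos (mul_pos hr0 (sub_pos.2 hv))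
        (by nlinarith) (by norm_num)) (by positivity) (by linarith)
      rw [← Real.sqrt_eq_rpow]
      exact Real.sqrt_le_iff.2 ⟨by linarith, by nlinarith⟩
    _ = ρ * r ^ (-(1 / 2) : ℝ) * (r - ‖v - c‖) ^ (-(1 / 2) : ℝ) := by
      rw [Real.mul_rpow hr0.le (sub_pos.2 hv).le, mul_assoc]

theorem integrableOn_ball_rpow (c : ℂ) (r : ℝ) :
    IntegrableOn (fun v => (r - ‖v - c‖) ^ (-(1 / 2) : ℝ)) (Metric.ball c r) := by
  rw [← integrable_indicator_iff Metric.isOpen_ball.measurableSet]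
  let f : ℝ → ℝ := (Set.Iio r).indicator fun y => (r - y) ^ (-(1 / 2) : ℝ)
  have hf : Integrable fun v : ℂ => f ‖v‖ := by
    rw [integrable_fun_norm_addHaar, Complex.finrank_real_complex]
    simp only [Nat.add_one_sub_one, pow_one, smul_eq_mul]
    rcases le_or_gt r 0 with hr | hr
    · refine integrableOn_zero.congr_fun (fun y hy => ?_) measurableSet_Ioi
      have hy : 0 < y := hy
      simp only [f]
      rw [Set.indicator_of_notMem (by simp; linarith), mul_zero]
    have h1 : IntervalIntegrable (fun y : ℝ => (r - y) ^ (-(1 / 2) : ℝ)) volume 0 r := by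
      have := (intervalIntegral.intervalIntegrable_rpow' (a := 0) (b := r)
        (r := (-(1 / 2) : ℝ)) (by norm_num)).comp_sub_left r
      simpa using this.symm
    have h2 : IntegrableOn (fun y : ℝ => y * (r - y) ^ (-(1 / 2) : ℝ)) (Set.Ioo 0 r) :=
      ((intervalIntegrable_iff_integrableOn_Ioc_of_le hr.le).1
        (h1.continuousOn_mul continuousOn_id)).mono_set Set.Ioo_subset_Ioc_self
    rw [← integrable_indicator_iff measurableSet_Ioo] at h2
    refine (h2.integrableOn (s := Set.Ioi 0)).congr_fun (fun y hy => ?_) measurableSet_Ioi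
    have hy : 0 < y := hy
    classical
    simp [f, Set.indicator_apply, hy]
  refine (hf.comp_sub_right c).congr (.of_forall fun v => ?_)
  classical
  simp [f, Set.indicator_apply, dist_eq_norm]

/-- Every bounded set has arbitrarily close compact neighbourhoods whose exterior exponential
transform has an integrable diagonal. -/
theorem exists_hull {Ω : Set ℂ} {R : ℝ} (hR0 : 0 ≤ R)
    (hR : Metric.thickening 1 (closure Ω) ⊆ Metric.ball 0 R) {δ : ℝ} (hδ : 0 < δ) (hδ1 : δ ≤ 1) :
    ∃ W : Set ℂ, IsClosed W ∧ closure Ω ⊆ W ∧ W ⊆ Metric.thickening δ (closure Ω) ∧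
      IntegrableOn (fun v => decay v * Real.exp ((cpair (setDensity W) v v).re / 2)) Wᶜ := by
  have hK : IsCompact (Metric.closedBall (0 : ℂ) (R + 1) \ Metric.thickening δ (closure Ω)) :=
    (isCompact_closedBall _ _).diff Metric.isOpen_thickening
  obtain ⟨t, htK, htf, hcov⟩ := hK.finite_cover_balls hδ
  have hopen : IsOpen (⋃ x ∈ t, Metric.ball x δ) :=
    isOpen_biUnion fun _ _ => Metric.isOpen_ball
  -- The removed discs cover the part of the large disc at distance at least δ from the closure of
  -- Ω, and their centres lie there, so they miss that closure. The complement of W is now a finite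
  -- union of discs and the outside of a disc. In each small disc the square root of e^P blows up at
  -- most like the inverse square root of the distance to the circle, which is integrable.
  let W : Set ℂ := Metric.closedBall (0 : ℂ) (R + 1) \ ⋃ x ∈ t, Metric.ball x δ
  have hWc : IsClosed W := Metric.isClosed_closedBall.sdiff hopen
  have hWδ : W ⊆ Metric.thickening δ (closure Ω) := fun ζ hζ => by
    by_contra h
    exact hζ.2 (hcov ⟨hζ.1, h⟩)
  have hWR : W ⊆ Metric.ball 0 R :=
    hWδ.trans ((Metric.thickening_mono hδ1 _).trans hR)
  have hD := isDensity_setDensity hWc.measurableSet hWR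
  refine ⟨W, hWc, fun ζ hζ => ⟨?_, fun h => ?_⟩, hWδ, ?_⟩
  · have := hR (Metric.self_subset_thickening one_pos _ hζ)
    exact Metric.closedBall_subset_closedBall (by linarith) (Metric.ball_subset_closedBall this)
  · obtain ⟨x, hx, hζx⟩ := Set.mem_iUnion₂.1 h
    refine (htK hx).2 (Metric.mem_thickening_iff.2 ⟨ζ, hζ, ?_⟩)
    rw [dist_comm]; exact hζx
  have hmeas : Measurable fun v =>
      decay v * Real.exp ((cpair (setDensity W) v v).re / 2) := by
    have h1 := (measurable_cpair hD.meas).comp (measurable_id.prodMk measurable_id)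
    have h2 : Measurable fun v => cpair (setDensity W) v v := h1
    have h3 : Measurable decay := by unfold decay; fun_prop
    have h4 : Measurable fun v => (cpair (setDensity W) v v).re := Complex.measurable_re.comp h2
    exact h3.mul (h4.div_const 2).exp
  have hset : Wᶜ ⊆ (⋃ x ∈ t, Metric.ball x δ) ∪ (Metric.closedBall (0 : ℂ) (R + 1))ᶜ := by
    intro ζ hζ
    by_contra h
    rw [Set.mem_union, not_or, Set.notMem_compl_iff] at h
    exact hζ ⟨h.2, h.1⟩
  refine IntegrableOn.mono_set (IntegrableOn.union ?_ ?_) hset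
  · rw [integrableOn_finite_biUnion htf]
    intro x hx
    refine ((integrableOn_ball_rpow x δ).const_mul
      ((R + ‖x‖ + δ) * δ ^ (-(1 / 2) : ℝ))).mono' hmeas.aestronglyMeasurable ?_
    filter_upwards [ae_restrict_mem Metric.isOpen_ball.measurableSet] with v hv
    rw [Metric.mem_ball, dist_eq_norm] at hv
    have hdisj : Disjoint W (Metric.ball x δ) :=
      Set.disjoint_left.2 fun ζ hζ h => hζ.2 (Set.mem_iUnion₂.2 ⟨x, hx, h⟩)
    have hd1 : decay v ≤ 1 :=
      Real.rpow_le_one_of_one_le_of_nonpos (by linarith [norm_nonneg v]) (by norm_num)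
    rw [Real.norm_of_nonneg (mul_nonneg (decay_nonneg v) (Real.exp_pos _).le)]
    exact (mul_le_of_le_one_left (Real.exp_pos _).le hd1).trans
      (exp_half_cpair_le hWc.measurableSet hWR hR0 hdisj hv)
  -- W lies in the disc of radius R, so beyond R + 1 its distance is at least 1 and the exponent is
  -- at most `cauchyBound R`.
  · refine ((integrable_decay.mul_const (Real.exp (1⁻¹ * cauchyBound R))).integrableOn).mono'
      hmeas.aestronglyMeasurable ?_
    filter_upwards [ae_restrict_mem Metric.isClosed_closedBall.isOpen_compl.measurableSet]
      with v hv
    rw [Real.norm_of_nonneg (mul_nonneg (decay_nonneg v) (Real.exp_pos _).le)]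
    refine mul_le_mul_of_nonneg_left (Real.exp_le_exp.2 ?_) (decay_nonneg v)
    have hv' : R + 1 < ‖v‖ := by simpa using hv
    have h := hD.norm_cpair_le_right v one_pos (v := v) fun ζ hζ => by
      refine hD.zero ζ ?_
      rw [Metric.mem_ball, dist_comm, dist_eq_norm] at hζ
      have := norm_sub_norm_le v ζ
      linarith
    have h1 := Complex.re_le_norm (cpair (setDensity W) v v)
    have h2 := norm_nonneg (cpair (setDensity W) v v)
    linarith

end Annulus

/-! ### Analytic functions as Riesz vectors in the space of W -/

section Representation

theorem mem_closure_of_exterior {A : Set ℂ} (x : Exterior A) {a : ℂ} (h : x.1 = a) :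
    a ∉ closure A := fun ha => x.2 ⟨a, ha, h.symm⟩

theorem isFar_exterior {A : Set ℂ} (x : Exterior A) : IsFar (setDensity A) x.1 := by
  intro a ha
  obtain ⟨δ, hδ, hsub⟩ := Metric.isOpen_iff.1 isClosed_closure.isOpen_compl a
    (mem_closure_of_exterior x ha)
  exact ⟨δ, hδ, fun ζ hζ => setDensity_of_notMem fun h => hsub hζ (subset_closure h)⟩

/-- A finite point of the exterior of a closed set. -/
def extPt {W : Set ℂ} (hW : IsClosed W) {v : ℂ} (hv : v ∉ W) : Exterior W :=
  ⟨(v : OnePoint ℂ), by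
    rintro ⟨a, ha, h⟩
    rw [OnePoint.coe_injective h, hW.closure_eq] at ha
    exact hv ha⟩

variable {W : Set ℂ} {R : ℝ} {K : Type*} [NormedAddCommGroup K] [InnerProductSpace ℂ K]
  [CompleteSpace K] [RKHS ℂ K (Exterior W) ℂ]

open Classical in
/-- A function on the exterior of `W`, restricted to the plane and extended by zero. -/
def extVal (hW : IsClosed W) (h : K) (v : ℂ) : ℂ :=
  if hv : v ∉ W then h (extPt hW hv) else 0

omit [CompleteSpace K] in
theorem extVal_of_notMem (hW : IsClosed W) (h : K) {v : ℂ} (hv : v ∉ W) :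
    extVal hW h v = h (extPt hW hv) := dif_pos hv

theorem extVal_eq_inner (hW : IsClosed W) (h : K) {v : ℂ} (hv : v ∉ W) :
    extVal hW h v = inner ℂ (kerVec K (extPt hW hv)) h := by
  rw [inner_kerVec, extVal_of_notMem hW h hv]

omit [CompleteSpace K] in
theorem extVal_of_mem (hW : IsClosed W) (h : K) {v : ℂ} (hv : v ∈ W) :
    extVal hW h v = 0 := dif_neg (not_not.2 hv)

/-- Kernel functions are explicit and measurable, their span is dense, and norm limits in the space
are pointwise limits. -/
theorem measurable_extVal (hW : IsClosed W)
    (hK : ∀ x y : Exterior W, inner ℂ (kerVec K x) (kerVec K y) = sphereKer (setDensity W) x.1 y.1)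
    (h : K) : Measurable (extVal hW h) := by
  have hadd : ∀ a b : K, extVal hW (a + b) = extVal hW a + extVal hW b := fun a b => by
    funext v
    by_cases hv : v ∈ W
    · simp [extVal_of_mem hW _ hv]
    · simp [extVal_eq_inner hW _ hv]
  have hsmul : ∀ (c : ℂ) (a : K), extVal hW (c • a) = c • extVal hW a := fun c a => by
    funext v
    by_cases hv : v ∈ W
    · simp [extVal_of_mem hW _ hv]
    · simp [extVal_eq_inner hW _ hv]
  have hker : ∀ x : Exterior W, Measurable (extVal hW (kerVec K x)) := fun x => by
    have hm : Measurable fun v : ℂ => sphereKer (setDensity W) v x.1 := by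
      obtain ⟨x, hx⟩ := x
      induction x using OnePoint.rec with
      | infty => simp [sphereKer]
      | coe b =>
        have h0 := (measurable_cpair (measurable_one.indicator hW.measurableSet :
          Measurable (setDensity W))).comp (measurable_prodMk_right (y := b))
        have h1 : Measurable fun v : ℂ => cpair (setDensity W) v b := h0
        exact h1.cexp.sub_const 1
    have e : extVal hW (kerVec K x) = Wᶜ.indicator fun v : ℂ => sphereKer (setDensity W) v x.1 := by
      funext v
      by_cases hv : v ∈ W
      · rw [extVal_of_mem hW _ hv, Set.indicator_of_notMem (not_not.2 hv)]
      · rw [extVal_eq_inner hW _ hv, hK, Set.indicator_of_mem hv]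
        rfl
    rw [e]
    exact hm.indicator hW.isOpen_compl.measurableSet
  let S : Submodule ℂ K :=
    { carrier := {h | Measurable (extVal hW h)}
      add_mem' := fun {a b} ha hb => by
        rw [Set.mem_ofPred_eq] at ha hb ⊢
        rw [hadd]; exact ha.add hb
      zero_mem' := by
        have : extVal hW (0 : K) = 0 := by
          have := hsmul 0 (0 : K)
          simpa using this
        rw [Set.mem_ofPred_eq, this]; exact measurable_zero
      smul_mem' := fun c a ha => by
        rw [Set.mem_ofPred_eq] at ha ⊢
        rw [hsmul]; exact ha.const_smul c }
  have hd : Dense (S : Set K) := dense_span_kerVec fun x => S.le_topologicalClosure (hker x)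
  obtain ⟨u, hu, hlim⟩ := mem_closure_iff_seq_limit.1 (hd h)
  refine measurable_of_tendsto_metrizable (f := fun n => extVal hW (u n)) hu
    (tendsto_pi_nhds.2 fun v => ?_)
  by_cases hv : v ∈ W
  · simp [extVal_of_mem hW _ hv]
  · simp only [extVal_eq_inner hW _ hv]
    exact tendsto_const_nhds.inner hlim

/-- Cauchy–Schwarz against the kernel function at v, whose squared norm is e^{P(v,v)} − 1 ≤
e^{P(v,v)}. -/
theorem norm_extVal_le (hW : IsClosed W)
    (hK : ∀ x y : Exterior W, inner ℂ (kerVec K x) (kerVec K y) = sphereKer (setDensity W) x.1 y.1)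
    (h : K) {v : ℂ} (hv : v ∉ W) :
    ‖extVal hW h v‖ ≤ Real.exp ((cpair (setDensity W) v v).re / 2) * ‖h‖ := by
  rw [extVal_eq_inner hW h hv]
  refine (norm_inner_le_norm _ _).trans (mul_le_mul_of_nonneg_right ?_ (norm_nonneg _))
  refine (pow_le_pow_iff_left₀ (norm_nonneg _) (Real.exp_pos _).le two_ne_zero).1 ?_
  rw [← Real.exp_nat_mul]
  have h1 := inner_self_eq_norm_sq (𝕜 := ℂ) (kerVec K (extPt hW hv))
  rw [hK] at h1
  rw [← h1]
  have h2 : sphereKer (setDensity W) (extPt hW hv).1 (extPt hW hv).1 =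
    Complex.exp (cpair (setDensity W) v v) - 1 := rfl
  rw [h2]
  have h3 : ‖Complex.exp (cpair (setDensity W) v v)‖ =
      Real.exp (cpair (setDensity W) v v).re := Complex.norm_exp _
  have h4 := Complex.re_le_norm (Complex.exp (cpair (setDensity W) v v))
  have h5 : ((2 : ℕ) : ℝ) * ((cpair (setDensity W) v v).re / 2) =
      (cpair (setDensity W) v v).re := by push_cast; ring
  rw [h5]
  simp only [RCLike.re_to_complex, Complex.sub_re, Complex.one_re]
  linarith

/-- Integration against an integrable density represents a vector of the space. -/
theorem exists_riesz_vector (hW : IsClosed W)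
    (hK : ∀ x y : Exterior W, inner ℂ (kerVec K x) (kerVec K y) = sphereKer (setDensity W) x.1 y.1)
    (hI : IntegrableOn (fun v => decay v * Real.exp ((cpair (setDensity W) v v).re / 2)) Wᶜ)
    {p : ℂ → ℂ} (hp : Measurable p) {C : ℝ} (hC : ∀ v, ‖p v‖ ≤ C * decay v)
    (h0 : ∀ v ∈ W, p v = 0) :
    ∃ Ψ : K, ∀ h : K, inner ℂ Ψ h = ∫ v, p v * extVal hW h v := by
  have hC0 : 0 ≤ C := by
    have h1 := (norm_nonneg _).trans (hC 0)
    have h2 : decay 0 = 1 := by simp [decay]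
    rwa [h2, mul_one] at h1
  let b : ℂ → ℝ := Wᶜ.indicator fun v =>
    decay v * Real.exp ((cpair (setDensity W) v v).re / 2)
  have hb : Integrable b := (integrable_indicator_iff hW.isOpen_compl.measurableSet).2 hI
  have hbound : ∀ (h : K) v, ‖p v * extVal hW h v‖ ≤ b v * (C * ‖h‖) := by
    intro h v
    by_cases hv : v ∈ W
    · simp [h0 v hv, b, hv]
    · rw [norm_mul]
      simp only [b, Set.indicator_of_mem (show v ∈ Wᶜ from hv)]
      refine (mul_le_mul (hC v) (norm_extVal_le hW hK h hv) (norm_nonneg _)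
        (mul_nonneg hC0 (decay_nonneg v))).trans_eq ?_
      ring
  have hint : ∀ h : K, Integrable fun v => p v * extVal hW h v := fun h =>
    (hb.mul_const _).mono' (hp.mul (measurable_extVal hW hK h)).aestronglyMeasurable
      (.of_forall (hbound h))
  let l : K →ₗ[ℂ] ℂ :=
    { toFun := fun h => ∫ v, p v * extVal hW h v
      map_add' := fun a c => by
        rw [← integral_add (hint a) (hint c)]
        refine integral_congr_ae (.of_forall fun v => ?_)
        by_cases hv : v ∈ W
        · simp [h0 v hv]
        · simp only [extVal_eq_inner hW _ hv, inner_add_right]; ring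
      map_smul' := fun c a => by
        rw [RingHom.id_apply, smul_eq_mul, ← integral_const_mul]
        refine integral_congr_ae (.of_forall fun v => ?_)
        by_cases hv : v ∈ W
        · simp [h0 v hv]
        · simp only [extVal_eq_inner hW _ hv, inner_smul_right]; ring }
  let L : StrongDual ℂ K := l.mkContinuous ((∫ v, b v) * C) fun h => by
    refine (norm_integral_le_of_norm_le (hb.mul_const _) (.of_forall (hbound h))).trans_eq ?_
    rw [integral_mul_const, mul_assoc]
  exact ⟨(InnerProductSpace.toDual ℂ K).symm L, fun h =>
    InnerProductSpace.toDual_symm_apply⟩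

/-- The sesquilinear form of a density on the analytic functions. -/
def pairing {Ω : Set ℂ} (g : ℂ → ℝ) (f₁ f₂ : ExtAnalytic Ω) : ℂ :=
  (1 / (Real.pi : ℂ) ^ 2) * ∫ z, wirtingerBar f₁.1 z *
    ∫ w, innerKer g z w * conj (wirtingerBar f₂.1 w)

theorem conj_integral_psiConj_mul_ext {Ω : Set ℂ} (hb : Bornology.IsBounded Ω)
    (f g : ExtAnalytic Ω) (hW : IsClosed W) (hR : W ⊆ Metric.ball 0 R) {ε : ℝ} (hε : 0 < ε)
    (hφ : ∀ z, wirtingerBar f.1 z ≠ 0 → Metric.ball z ε ⊆ W) :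
    conj (∫ v, psiConj W (wirtingerBar f.1) v * g.1 v) = pairing (setDensity W) f g := by
  rw [integral_psiConj_mul_ext hb f g hW hR hε hφ, pairing, map_mul, ← integral_conj]
  congr 1
  · simp
  refine integral_congr_ae (.of_forall fun z => ?_)
  simp only [map_mul, Complex.conj_conj, ← integral_conj, conj_innerKer]

/-- The analytic functions belong to the space of a good neighbourhood, and there the inner
product is the sesquilinear form of the neighbourhood. -/
theorem exists_mem_rkhs {Ω : Set ℂ} (hb : Bornology.IsBounded Ω) (hW : IsClosed W)
    (hR : W ⊆ Metric.ball 0 R)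
    (hK : ∀ x y : Exterior W, inner ℂ (kerVec K x) (kerVec K y) = sphereKer (setDensity W) x.1 y.1)
    (hI : IntegrableOn (fun v => decay v * Real.exp ((cpair (setDensity W) v v).re / 2)) Wᶜ)
    (f : ExtAnalytic Ω) {ε : ℝ} (hε : 0 < ε)
    (hφ : ∀ z, wirtingerBar f.1 z ≠ 0 → Metric.ball z ε ⊆ W) :
    ∃ Ψ : K, (∀ x : Exterior W, Ψ x = x.1.elim 0 f.1) ∧
      ∀ (g : ExtAnalytic Ω) (Φ : K), (∀ x : Exterior W, Φ x = x.1.elim 0 g.1) →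
        inner ℂ Φ Ψ = pairing (setDensity W) f g := by
  have hc := (contDiff_wirtingerBar f.2.1).continuous
  have hi : Integrable (wirtingerBar f.1) :=
    hc.integrable_of_hasCompactSupport (hasCompactSupport_wirtingerBar_ext hb f)
  -- `Ψ` represents h ↦ ∫ `psiConj` · h. Testing it on kernel functions gives its values, testing it
  -- on another analytic function gives the inner product.
  obtain ⟨Ψ, hΨ⟩ := exists_riesz_vector hW hK hI (measurable_psiConj hW hc)
    (fun v => norm_psiConj_le hW hR hi hε hφ v) (fun v hv => psiConj_eq_zero hv)
  refine ⟨Ψ, fun x => ?_, fun g Φ hΦ => ?_⟩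
  · rw [← inner_kerVec, ← inner_conj_symm, hΨ]
    have e : ∀ v, psiConj W (wirtingerBar f.1) v * extVal hW (kerVec K x) v =
        psiConj W (wirtingerBar f.1) v * sphereKer (setDensity W) v x.1 := fun v => by
      by_cases hv : v ∈ W
      · simp [psiConj_eq_zero hv]
      · rw [extVal_eq_inner hW _ hv, hK]; rfl
    simp only [e]
    obtain ⟨x, hx⟩ := x
    induction x using OnePoint.rec with
    | infty => simp [sphereKer]
    | coe w =>
      have hw : w ∉ W := fun h => hx ⟨w, subset_closure h, rfl⟩
      obtain ⟨δ, hδ, hsub⟩ := Metric.isOpen_iff.1 hW.isOpen_compl w hw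
      have hD := isDensity_setDensity hW.measurableSet hR
      have hm0 := (measurable_cpair hD.meas).comp (measurable_prodMk_right (y := w))
      have hm : Measurable fun v => cpair (setDensity W) v w := hm0
      have hpi : Integrable (psiConj W (wirtingerBar f.1)) :=
        (integrable_decay.const_mul _).mono' (measurable_psiConj hW hc).aestronglyMeasurable
          (.of_forall fun v => norm_psiConj_le hW hR hi hε hφ v)
      have h1 : Integrable fun v => psiConj W (wirtingerBar f.1) v *
          Complex.exp (cpair (setDensity W) v w) :=
        hpi.mul_bdd hm.cexp.aestronglyMeasurable (.of_forall fun v =>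
          norm_exp_le (hD.norm_cpair_le_right v hδ fun ζ hζ => setDensity_of_notMem (hsub hζ)))
      -- The −1 in the kernel drops out because `psiConj` has integral zero.
      have h2 : ∀ v : ℂ, psiConj W (wirtingerBar f.1) v * sphereKer (setDensity W) v w =
          psiConj W (wirtingerBar f.1) v * Complex.exp (cpair (setDensity W) v w) -
            psiConj W (wirtingerBar f.1) v := fun v => by
        rw [sphereKer, cpairS_coe]; ring
      simp only [h2]
      rw [integral_sub h1 hpi, integral_psiConj hW hR hc hi hε hφ, sub_zero,
        ← conj_eq_integral_psiConj hb f hW hR hε hφ hw, Complex.conj_conj]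
      rfl
  · rw [← inner_conj_symm, hΨ, ← conj_integral_psiConj_mul_ext hb f g hW hR hε hφ]
    congr 1
    refine integral_congr_ae (.of_forall fun v => ?_)
    by_cases hv : v ∈ W
    · simp [psiConj_eq_zero hv]
    · simp only [extVal_of_notMem hW _ hv, hΦ]
      rfl

end Representation

/-! ### The given transforms in terms of densities, and their limits -/

section Transforms

variable {Ω : Set ℂ} {R : ℝ}

theorem setIntegral_inv_eq (hΩ : MeasurableSet Ω) (a b : ℂ) :
    (1 / (Real.pi : ℂ)) * ∫ ζ in Ω, 1 / ((ζ - a) * (conj ζ - conj b)) =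
      cpair (setDensity Ω) a b := by
  rw [cpair, ← integral_indicator hΩ]
  congr 1
  refine integral_congr_ae (.of_forall fun ζ => ?_)
  by_cases h : ζ ∈ Ω
  · simp [h, setDensity_of_mem h]
  · simp [h, setDensity_of_notMem h]

theorem expTransform_eq (hΩ : MeasurableSet Ω) {a b : ℂ}
    (hi : Integrable fun ζ => (setDensity Ω ζ : ℂ) * ((ζ - a) * (conj ζ - conj b))⁻¹) :
    expTransform Ω a b = Complex.exp (-cpair (setDensity Ω) a b) := by
  have h : IntegrableOn (fun ζ : ℂ => 1 / ((ζ - a) * (conj ζ - conj b))) Ω := by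
    rw [← integrable_indicator_iff hΩ]
    refine hi.congr (.of_forall fun ζ => ?_)
    by_cases h : ζ ∈ Ω
    · simp [h, setDensity_of_mem h]
    · simp [h, setDensity_of_notMem h]
  rw [expTransform, if_pos h, neg_mul, setIntegral_inv_eq hΩ]

theorem one_div_expTransformSphere (hΩ : MeasurableSet Ω) (hR : Ω ⊆ Metric.ball 0 R)
    (z w : Exterior Ω) :
    1 / expTransformSphere Ω z.1 w.1 - 1 = sphereKer (setDensity Ω) z.1 w.1 := by
  have hw := isFar_exterior w
  obtain ⟨z, hz⟩ := z
  obtain ⟨w, hw'⟩ := w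
  induction z using OnePoint.rec with
  | infty => simp [expTransformSphere, sphereKer]
  | coe a =>
    induction w using OnePoint.rec with
    | infty => simp [expTransformSphere, sphereKer]
    | coe b =>
      obtain ⟨δ, hδ, h⟩ := hw b rfl
      have e : expTransformSphere Ω (a : OnePoint ℂ) (b : OnePoint ℂ) = expTransform Ω a b := rfl
      rw [e, expTransform_eq hΩ ((isDensity_setDensity hΩ hR).integrable_right a hδ h), one_div,
        ← Complex.exp_neg, neg_neg]
      rfl

theorem contDiffOn_of_eq_one {g : ℂ → ℝ} {u v : ℂ} {r : ℝ}
    (h1 : ∀ ζ ∈ Metric.ball u r, g ζ = 1) (hv : ∀ ζ ∈ Metric.ball u r, ζ ≠ v) :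
    ContDiffOn ℝ ∞ (fun ζ => (g ζ : ℂ) * (conj ζ - conj v)⁻¹) (Metric.ball u r) := by
  have h : ContDiffOn ℝ ∞ (fun ζ : ℂ => (conj ζ - conj v)⁻¹) (Metric.ball u r) :=
    ContDiffOn.inv (Complex.conjCLE.contDiff.contDiffOn.sub contDiffOn_const) fun ζ hζ => by
      rw [← map_sub, map_ne_zero, sub_ne_zero]; exact hv ζ hζ
  refine h.congr fun ζ hζ => ?_
  rw [h1 ζ hζ]; simp

theorem hasDbarAt_exp_neg_cpair (hΩ : IsOpen Ω) (hR : Ω ⊆ Metric.ball 0 R) {u v : ℂ}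
    (hu : u ∈ Ω) (huv : u ≠ v) :
    HasDbarAt (fun u => Complex.exp (-cpair (setDensity Ω) u v))
      (Complex.exp (-cpair (setDensity Ω) u v) * (conj u - conj v)⁻¹) u := by
  have hopen : IsOpen (Ω ∩ {v}ᶜ) := hΩ.inter isOpen_compl_singleton
  obtain ⟨r, hr, hsub⟩ := Metric.isOpen_iff.1 hopen u ⟨hu, huv⟩
  have hD := isDensity_setDensity hΩ.measurableSet hR
  have h := (hD.cpair_local hr (contDiffOn_of_eq_one
    (fun ζ hζ => setDensity_of_mem (hsub hζ).1) fun ζ hζ => (hsub hζ).2) (.inl huv)).2.neg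
  rw [setDensity_of_mem hu, neg_neg] at h
  refine (HasDbarAt.comp_holo (Complex.hasDerivAt_exp _) h).congr_dbar ?_
  simp

/-- Inside Ω and off the diagonal, ∂E/∂w = E/(w − z) and ∂E/∂z̄ = E/(z̄ − w̄), so H = E/|z − w|². -/
theorem innerExpTransform_eq (hΩ : IsOpen Ω) (hR : Ω ⊆ Metric.ball 0 R) {z w : ℂ}
    (hz : z ∈ Ω) (hw : w ∈ Ω) (hzw : z ≠ w) :
    innerExpTransform Ω z w = innerKer (setDensity Ω) z w := by
  have hD := isDensity_setDensity hΩ.measurableSet hR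
  have hE : ∀ {a b : ℂ}, a ≠ b → expTransform Ω a b = Complex.exp (-cpair (setDensity Ω) a b) :=
    fun hab => expTransform_eq hΩ.measurableSet (hD.integrable_of_ne hab)
  have h1 : ∀ z' : ℂ, w ≠ z' → wirtinger (fun w' => expTransform Ω z' w') w =
      Complex.exp (-cpair (setDensity Ω) z' w) * (w - z')⁻¹ := by
    intro z' hz'
    have h := hasDbarAt_exp_neg_cpair hΩ hR hw hz'
    have h2 : HasDbarAt (fun w' => conj (expTransform Ω z' w'))
        (Complex.exp (-cpair (setDensity Ω) w z') * (conj w - conj z')⁻¹) w := by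
      refine h.congr_of_eventuallyEq ?_
      filter_upwards [isOpen_ne.mem_nhds hz'] with w' hw'
      rw [hE (Ne.symm hw'), ← Complex.exp_conj, map_neg, conj_cpair]
    rw [wirtinger_eq_conj h2, map_mul, ← Complex.exp_conj, map_neg, conj_cpair, map_inv₀, map_sub,
      Complex.conj_conj, Complex.conj_conj]
  have h3 : HasDbarAt (fun z' => wirtinger (fun w' => expTransform Ω z' w') w)
      (Complex.exp (-cpair (setDensity Ω) z w) * (conj z - conj w)⁻¹ * (w - z)⁻¹ +
        Complex.exp (-cpair (setDensity Ω) z w) * 0) z := by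
    have hinv : HasDbarAt (fun z' : ℂ => (w - z')⁻¹) 0 z :=
      hasDbarAt_of_holo (DifferentiableAt.inv (by fun_prop) (sub_ne_zero.2 hzw.symm))
    refine ((hasDbarAt_exp_neg_cpair hΩ hR hz hzw).mul hinv).congr_of_eventuallyEq ?_
    filter_upwards [isOpen_ne.mem_nhds hzw] with z' hz'
    exact h1 z' (Ne.symm hz')
  rw [innerExpTransform, h3.2, innerKer, mul_zero, add_zero, mul_inv,
    ← neg_sub z w, inv_neg]
  ring

theorem exists_ball_subset (hΩ : IsOpen Ω) (hb : Bornology.IsBounded Ω) (f : ExtAnalytic Ω) :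
    ∃ ε > 0, ∀ z, wirtingerBar f.1 z ≠ 0 → Metric.ball z ε ⊆ Ω := by
  obtain ⟨ε, hε, h⟩ := (hasCompactSupport_wirtingerBar_ext hb f).isCompact.exists_thickening_subset_open
    hΩ (tsupport_wirtingerBar_subset f)
  exact ⟨ε, hε, fun z hz =>
    (Metric.ball_subset_thickening (subset_tsupport _ hz) ε).trans h⟩

theorem integrable_wirtingerBar_ext (hb : Bornology.IsBounded Ω) (f : ExtAnalytic Ω) :
    Integrable (wirtingerBar f.1) :=
  (contDiff_wirtingerBar f.2.1).continuous.integrable_of_hasCompactSupport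
    (hasCompactSupport_wirtingerBar_ext hb f)

/-- The ∂̄-data vanish outside Ω, and the diagonal, where the kernels have not been compared, is
negligible in the inner integral. -/
theorem innerO_eq_pairing (hΩ : IsOpen Ω) (hR : Ω ⊆ Metric.ball 0 R) (f g : ExtAnalytic Ω) :
    innerO f g = pairing (setDensity Ω) f g := by
  have hz : ∀ (f : ExtAnalytic Ω) z, z ∉ Ω → wirtingerBar f.1 z = 0 := fun f z hz =>
    image_eq_zero_of_notMem_tsupport fun h => hz (tsupport_wirtingerBar_subset f h)
  rw [innerO, pairing]
  congr 1
  rw [← setIntegral_eq_integral_of_forall_compl_eq_zero (s := Ω)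
    (f := fun z => wirtingerBar f.1 z * ∫ w, innerKer (setDensity Ω) z w *
      conj (wirtingerBar g.1 w)) fun z hz' => by rw [hz f z hz', zero_mul]]
  refine setIntegral_congr_fun hΩ.measurableSet fun z hzΩ => ?_
  rw [← setIntegral_eq_integral_of_forall_compl_eq_zero (s := Ω)
    (f := fun w => innerKer (setDensity Ω) z w * conj (wirtingerBar g.1 w))
    fun w hw' => by rw [hz g w hw', map_zero, mul_zero], ← integral_const_mul]
  refine setIntegral_congr_ae hΩ.measurableSet ?_
  have : ∀ᵐ w : ℂ, w ≠ z := by simp [ae_iff]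
  filter_upwards [this] with w hw hwΩ
  rw [innerExpTransform_eq hΩ hR hzΩ hwΩ hw.symm]
  ring

/-- All densities equal 1 on Ω, so `innerKer` is bounded uniformly for z in the support of ∂̄f₁,
which has positive distance to the complement of Ω. -/
theorem tendsto_pairing (hΩ : IsOpen Ω) (hb : Bornology.IsBounded Ω) {gn : ℕ → ℂ → ℝ}
    {g : ℂ → ℝ} (hgn : ∀ n, IsDensity R (gn n))
    (h1 : ∀ n, ∀ ζ ∈ Ω, gn n ζ = 1)
    (hlim : ∀ᵐ ζ, Tendsto (fun n => gn n ζ) atTop (𝓝 (g ζ))) (f₁ f₂ : ExtAnalytic Ω) :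
    Tendsto (fun n => pairing (gn n) f₁ f₂) atTop (𝓝 (pairing g f₁ f₂)) := by
  obtain ⟨ε, hε, hball⟩ := exists_ball_subset hΩ hb f₁
  have hi₁ := integrable_wirtingerBar_ext hb f₁
  have hi₂ := integrable_wirtingerBar_ext hb f₂
  have hc₁ := (contDiff_wirtingerBar f₁.2.1).continuous.measurable
  have hc₂ : Measurable fun w => conj (wirtingerBar f₂.1 w) :=
    (Complex.continuous_conj.comp (contDiff_wirtingerBar f₂.2.1).continuous).measurable
  set B := Real.exp (ε⁻¹ * (2 * cauchyBound R)) * (ε ^ 2)⁻¹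
  have hB : ∀ n z w, wirtingerBar f₁.1 z ≠ 0 →
      ‖innerKer (gn n) z w * conj (wirtingerBar f₂.1 w)‖ ≤ B * ‖wirtingerBar f₂.1 w‖ := by
    intro n z w hz
    rw [norm_mul, RCLike.norm_conj, ← conj_innerKer, RCLike.norm_conj]
    exact mul_le_mul_of_nonneg_right (norm_innerKer_le (hgn n) hε
      (fun ζ hζ => h1 n ζ (hball z hz hζ)) w) (norm_nonneg _)
  have hmeas : ∀ n, Measurable fun p : ℂ × ℂ =>
      innerKer (gn n) p.1 p.2 * conj (wirtingerBar f₂.1 p.2) := fun n =>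
    (measurable_innerKer (hgn n).meas).mul (hc₂.comp measurable_snd)
  refine Tendsto.const_mul _ (tendsto_integral_of_dominated_convergence
    (fun z => ‖wirtingerBar f₁.1 z‖ * ∫ w, B * ‖wirtingerBar f₂.1 w‖) (fun n => ?_)
    (hi₁.norm.mul_const _) (fun n => .of_forall fun z => ?_) (.of_forall fun z => ?_))
  · exact (hc₁.mul
      ((hmeas n).stronglyMeasurable.integral_prod_right' (ν := volume)).measurable).aestronglyMeasurable
  · rw [norm_mul]
    by_cases hz : wirtingerBar f₁.1 z = 0
    · simp [hz]
    exact mul_le_mul_of_nonneg_left (norm_integral_le_of_norm_le (hi₂.norm.const_mul B)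
      (.of_forall fun w => hB n z w hz)) (norm_nonneg _)
  · by_cases hz : wirtingerBar f₁.1 z = 0
    · simp [hz]
    refine Tendsto.const_mul _ (tendsto_integral_of_dominated_convergence
      (fun w => B * ‖wirtingerBar f₂.1 w‖) (fun n => ?_) (hi₂.norm.const_mul B)
      (fun n => .of_forall fun w => hB n z w hz) (.of_forall fun w => ?_))
    · have h0 := (hmeas n).comp (measurable_prodMk_left (x := z))
      have h2 : Measurable fun w => innerKer (gn n) z w * conj (wirtingerBar f₂.1 w) := h0
      exact h2.aestronglyMeasurable
    · exact (tendsto_innerKer hgn hlim z w).mul_const _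

theorem tendsto_sphereKer {gn : ℕ → ℂ → ℝ} {g : ℂ → ℝ} (hgn : ∀ n, IsDensity R (gn n))
    (hlim : ∀ᵐ ζ, Tendsto (fun n => gn n ζ) atTop (𝓝 (g ζ))) (x : OnePoint ℂ) {y : OnePoint ℂ}
    (hy : ∀ b : ℂ, y = b → ∃ δ > 0, ∀ᶠ n in atTop, ∀ ζ ∈ Metric.ball b δ, gn n ζ = 0) :
    Tendsto (fun n => sphereKer (gn n) x y) atTop (𝓝 (sphereKer g x y)) := by
  refine Tendsto.sub_const (Tendsto.cexp ?_) 1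
  induction x using OnePoint.rec with
  | infty => simp
  | coe a =>
    induction y using OnePoint.rec with
    | infty => simp
    | coe b =>
      obtain ⟨δ, hδ, h⟩ := hy b rfl
      simpa using tendsto_cpair_of_far hgn hlim a hδ h

end Transforms

/-! ### Comparison of reproducing kernel spaces -/

section Comparison

variable {X Y I : Type*} {K : Type*} [NormedAddCommGroup K] [InnerProductSpace ℂ K]
  [CompleteSpace K] [RKHS ℂ K X ℂ] {K' : Type*} [NormedAddCommGroup K'] [InnerProductSpace ℂ K']
  [CompleteSpace K'] [RKHS ℂ K' Y ℂ]

theorem norm_sq_sum_kerVec_comp (q : I → X) (c : I →₀ ℂ) :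
    (((‖c.sum fun x a => a • kerVec K (q x)‖ ^ 2 : ℝ)) : ℂ) =
      c.sum fun x a => c.sum fun y b =>
        star a * inner ℂ (kerVec K (q x)) (kerVec K (q y)) * b := by
  have h := inner_self_eq_norm_sq_to_K (𝕜 := ℂ) (c.sum fun x a => a • kerVec K (q x))
  push_cast
  rw [show ((‖c.sum fun x a => a • kerVec K (q x)‖ : ℂ)) ^ 2 = _ from h.symm]
  simp only [Finsupp.sum, sum_inner, inner_sum, inner_smul_left, inner_smul_right,
    Finset.mul_sum]
  rw [Finset.sum_comm]
  refine Finset.sum_congr rfl fun x _ => Finset.sum_congr rfl fun y _ => ?_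
  simp; ring

theorem norm_sum_mul_conj_apply_le (q : I → X) (f : K) (c : I →₀ ℂ) :
    ‖c.sum fun x a => a * conj (f (q x))‖ ≤ ‖f‖ * ‖c.sum fun x a => a • kerVec K (q x)‖ := by
  have : (c.sum fun x a => a * conj (f (q x))) =
      inner ℂ f (c.sum fun x a => a • kerVec K (q x)) := by
    simp only [Finsupp.sum, inner_sum, inner_smul_right, inner_kerVec_right]
  rw [this]
  exact norm_inner_le_norm _ _

open scoped ComplexOrder in
/-- A larger kernel defines a larger space with smaller norm. -/
theorem exists_rkhs_of_le (q : Y → X) (h : (Matrix.of fun x y : Y =>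
    inner ℂ (kerVec K' x) (kerVec K' y) - inner ℂ (kerVec K (q x)) (kerVec K (q y))).PosSemidef)
    (f : K) : ∃ f' : K', (∀ y, f' y = f (q y)) ∧ ‖f'‖ ≤ ‖f‖ := by
  refine exists_rkhs_of_bound _ _ (norm_nonneg f) fun c => ?_
  refine (norm_sum_mul_conj_apply_le q f c).trans
    (mul_le_mul_of_nonneg_left ?_ (norm_nonneg f))
  refine (pow_le_pow_iff_left₀ (norm_nonneg _) (norm_nonneg _) two_ne_zero).1 ?_
  have h1 := h.2 c
  have h2 := norm_sq_sum_kerVec_comp (K := K) q c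
  have h3 := norm_sq_sum_kerVec_comp (K := K') id c
  have h4 : (c.sum fun x a => c.sum fun y b => star a * (Matrix.of fun x y : Y =>
      inner ℂ (kerVec K' x) (kerVec K' y) - inner ℂ (kerVec K (q x)) (kerVec K (q y))) x y * b) =
      (((‖c.sum fun x a => a • kerVec K' x‖ ^ 2 -
        ‖c.sum fun x a => a • kerVec K (q x)‖ ^ 2 : ℝ)) : ℂ) := by
    rw [Complex.ofReal_sub, h2]
    simp only [id_eq] at h3
    rw [h3]
    simp only [Finsupp.sum, Matrix.of_apply, mul_sub, sub_mul, Finset.sum_sub_distrib]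
  rw [h4] at h1
  have h5 : (0 : ℝ) ≤ ‖c.sum fun x a => a • kerVec K' x‖ ^ 2 -
    ‖c.sum fun x a => a • kerVec K (q x)‖ ^ 2 := by exact_mod_cast h1
  linarith

end Comparison

/-! ### Norm estimates from a single good set W -/

section HullForm

variable {Ω W : Set ℂ} {R : ℝ}

/-- The quadratic form of the exterior kernel. -/
def kerQuad (g : ℂ → ℝ) (c : Exterior Ω →₀ ℂ) : ℂ :=
  c.sum fun x a => c.sum fun y b => star a * sphereKer g x.1 y.1 * b

/-- The polarization of a quadratic form on the analytic functions. -/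
def polar4 {V : Type*} [AddCommGroup V] [Module ℂ V] (Q : V → ℂ) (x y : V) : ℂ :=
  (Q (x + y) - Q (x - y) + (Q (x - Complex.I • y) - Q (x + Complex.I • y)) * Complex.I) / 4

/-- Polarization reduces the isometry to an equality of norms, and it commutes with the limit over
the sets W. -/
theorem inner_eq_polar4 {V K : Type*} [AddCommGroup V] [Module ℂ V] [NormedAddCommGroup K]
    [InnerProductSpace ℂ K] {Q : V → ℂ} {T : V →ₗ[ℂ] K}
    (h : ∀ x, ((‖T x‖ ^ 2 : ℝ) : ℂ) = Q x) (x y : V) :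
    inner ℂ (T x) (T y) = polar4 Q x y := by
  rw [inner_eq_sum_norm_sq_div_four, polar4, ← h, ← h, ← h, ← h]
  simp only [map_add, map_sub, map_smul]
  push_cast
  rfl

/-- A map into a space of functions is linear when its values are. -/
theorem exists_linear_of_values {K : Type*} [NormedAddCommGroup K] [InnerProductSpace ℂ K]
    [CompleteSpace K] {A : Set ℂ} [RKHS ℂ K (Exterior A) ℂ] {T : ExtAnalytic Ω → K}
    (hT : ∀ f (x : Exterior A), T f x = x.1.elim 0 f.1) :
    ∃ T' : ExtAnalytic Ω →ₗ[ℂ] K, ∀ f, T' f = T f := by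
  refine ⟨{ toFun := T, map_add' := fun f g => RKHS.ext fun x => ?_,
            map_smul' := fun c f => RKHS.ext fun x => ?_ }, fun f => rfl⟩
  · rw [← inner_kerVec x (T f + T g), inner_add_right, inner_kerVec, inner_kerVec, hT, hT, hT]
    obtain ⟨x, hx⟩ := x
    induction x using OnePoint.rec <;> simp
  · rw [RingHom.id_apply, ← inner_kerVec x (c • T f), inner_smul_right, inner_kerVec, hT, hT]
    obtain ⟨x, hx⟩ := x
    induction x using OnePoint.rec <;> simp

theorem infty_exterior (A : Set ℂ) :
    OnePoint.infty ∉ ((↑) : ℂ → OnePoint ℂ) '' closure A := by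
  rintro ⟨a, -, h⟩
  exact OnePoint.coe_ne_infty a h

open scoped ComplexOrder in
/-- The properties of the sesquilinear form of a good neighbourhood. -/
theorem pairing_hull (hΩ : IsOpen Ω) (hb : Bornology.IsBounded Ω) (hW : IsClosed W)
    (hΩW : closure Ω ⊆ W) (hR : W ⊆ Metric.ball 0 R)
    (hI : IntegrableOn (fun v => decay v * Real.exp ((cpair (setDensity W) v v).re / 2)) Wᶜ) :
    (∀ f : ExtAnalytic Ω, ∃ N : ℝ, 0 ≤ N ∧ ((N ^ 2 : ℝ) : ℂ) = pairing (setDensity W) f f ∧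
      (∀ c : Exterior Ω →₀ ℂ, (∀ x ∈ c.support, x.1 ∉ ((↑) : ℂ → OnePoint ℂ) '' W) →
        ‖c.sum fun x a => a * conj (exteriorValue f x)‖ ^ 2 ≤
          N ^ 2 * (kerQuad (setDensity W) c).re) ∧
      ∀ (K : Type) [NormedAddCommGroup K] [InnerProductSpace ℂ K] [CompleteSpace K]
        [RKHS ℂ K (Exterior Ω) ℂ],
        (∀ x y : Exterior Ω, inner ℂ (kerVec K x) (kerVec K y) =
          sphereKer (setDensity Ω) x.1 y.1) →
        ∀ F : K, (∀ x, F x = exteriorValue f x) → N ≤ ‖F‖) ∧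
    ∀ f g : ExtAnalytic Ω, pairing (setDensity W) f g =
      polar4 (fun h => pairing (setDensity W) h h) g f := by
  have hD := isDensity_setDensity hW.measurableSet hR
  have hΩW' : Ω ⊆ W := subset_closure.trans hΩW
  have hDΩ := isDensity_setDensity hΩ.measurableSet (hΩW'.trans hR)
  have hle : ∀ ζ, setDensity Ω ζ ≤ setDensity W ζ := fun ζ =>
    Set.indicator_le_indicator_of_subset hΩW' (fun _ => zero_le_one) ζ
  obtain ⟨KW, _, _, _, _, hKW⟩ := exists_rkhs_kernel
    (Matrix.of fun x y : Exterior W => sphereKer (setDensity W) x.1 y.1)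
    (posSemidef_sphereKer hD _ isFar_exterior)
  simp only [Matrix.of_apply] at hKW
  have hex : ∀ f : ExtAnalytic Ω, ∃ Ψ : KW, (∀ x : Exterior W, Ψ x = x.1.elim 0 f.1) ∧
      ∀ (g : ExtAnalytic Ω) (Φ : KW), (∀ x : Exterior W, Φ x = x.1.elim 0 g.1) →
        inner ℂ Φ Ψ = pairing (setDensity W) f g := fun f => by
    obtain ⟨ε, hε, hball⟩ := exists_ball_subset hΩ hb f
    exact exists_mem_rkhs hb hW hR hKW hI f hε fun z hz => (hball z hz).trans hΩW'
  choose T hT hTp using hex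
  have hnorm : ∀ f, ((‖T f‖ ^ 2 : ℝ) : ℂ) = pairing (setDensity W) f f := fun f => by
    rw [← hTp f f _ (hT f), inner_self_eq_norm_sq_to_K]
    push_cast
    rfl
  refine ⟨fun f => ⟨‖T f‖, norm_nonneg _, hnorm f, fun c hc => ?_, ?_⟩, fun f g => ?_⟩
  · classical
    -- Points of the exterior of Ω that lie in W are sent to ∞ as a default; the condition on the
    -- support of `c` keeps them out of the sums. The estimate is then Cauchy–Schwarz in the space
    -- of W.
    let q : Exterior Ω → Exterior W := fun x =>
      if h : x.1 ∉ ((↑) : ℂ → OnePoint ℂ) '' closure W then ⟨x.1, h⟩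
      else ⟨OnePoint.infty, infty_exterior W⟩
    have hq : ∀ x ∈ c.support, (q x).1 = x.1 := fun x hx => by
      have h := hc x hx
      rw [← hW.closure_eq] at h
      simp only [q, dif_pos h]
    have h1 := norm_sum_mul_conj_apply_le q (T f) c
    have h2 : (c.sum fun x a => a * conj (exteriorValue f x)) =
        c.sum fun x a => a * conj (T f (q x)) :=
      Finset.sum_congr rfl fun x hx => by
        simp only []
        rw [hT, hq x hx]
        rfl
    have h3 : kerQuad (setDensity W) c =
        ((‖c.sum fun x a => a • kerVec KW (q x)‖ ^ 2 : ℝ) : ℂ) := by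
      rw [norm_sq_sum_kerVec_comp]
      refine Finset.sum_congr rfl fun x hx => Finset.sum_congr rfl fun y hy => ?_
      simp only []
      rw [hKW, hq x hx, hq y hy]
    rw [h2, h3, Complex.ofReal_re, ← mul_pow]
    exact pow_le_pow_left₀ (norm_nonneg _) h1 2
  · intro K _ _ _ _ hK F hF
    -- The kernel of W dominates that of Ω on the exterior of W, so restriction there does not
    -- increase norms.
    let q : Exterior W → Exterior Ω := fun x => ⟨x.1, fun h => x.2
      (Set.image_mono (hΩW.trans subset_closure) h)⟩
    obtain ⟨F', hF', hn⟩ := exists_rkhs_of_le (K' := KW) q (by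
      simp only [hKW, hK]
      exact posSemidef_sphereKer_sub hDΩ hD hle (fun x : Exterior W => x.1) isFar_exterior) F
    have : T f = F' := RKHS.ext fun x => by
      rw [hT, hF', hF]
      rfl
    rw [this]
    exact hn
  · obtain ⟨T', hT'⟩ := exists_linear_of_values hT
    rw [← hTp f g _ (hT g), ← hT', ← hT']
    exact inner_eq_polar4 (fun h => by rw [hT', hnorm]) g f

end HullForm

/-! ### Passage to the limit W → closure of Ω, and the isometry -/

section Completion

variable {Ω : Set ℂ} {R : ℝ}

theorem exists_hull_seq (hb : Bornology.IsBounded Ω) :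
    ∃ (R : ℝ) (W : ℕ → Set ℂ), ∀ n, IsClosed (W n) ∧ closure Ω ⊆ W n ∧ W n ⊆ Metric.ball 0 R ∧
      W n ⊆ Metric.thickening (1 / ((n : ℝ) + 1)) (closure Ω) ∧
      IntegrableOn (fun v => decay v * Real.exp ((cpair (setDensity (W n)) v v).re / 2))
        (W n)ᶜ := by
  obtain ⟨R, hR0, hR⟩ := (hb.closure.thickening (δ := 1)).subset_ball_lt 0 0
  have h1 : ∀ n : ℕ, 1 / ((n : ℝ) + 1) ≤ 1 := fun n => by
    rw [div_le_one (by positivity)]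
    have : (0 : ℝ) ≤ n := n.cast_nonneg
    linarith
  have h := fun n : ℕ => exists_hull hR0.le hR (δ := 1 / ((n : ℝ) + 1)) (by positivity) (h1 n)
  choose W hW using h
  exact ⟨R, W, fun n => ⟨(hW n).1, (hW n).2.1,
    (hW n).2.2.1.trans ((Metric.thickening_mono (h1 n) _).trans hR), (hW n).2.2.1, (hW n).2.2.2⟩⟩

theorem eventually_ball_disjoint {W : ℕ → Set ℂ}
    (hW : ∀ n, W n ⊆ Metric.thickening (1 / ((n : ℝ) + 1)) (closure Ω)) {b : ℂ}
    (hb : b ∉ closure Ω) : ∃ δ > 0, ∀ᶠ n in atTop, ∀ ζ ∈ Metric.ball b δ, ζ ∉ W n := by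
  obtain ⟨d, hd, hsub⟩ := Metric.isOpen_iff.1 isClosed_closure.isOpen_compl b hb
  refine ⟨d / 2, by positivity, ?_⟩
  filter_upwards [tendsto_one_div_add_atTop_nhds_zero_nat.eventually
    (gt_mem_nhds (half_pos hd))] with n hn ζ hζ h
  obtain ⟨y, hy, hζy⟩ := Metric.mem_thickening_iff.1 (hW n h)
  refine hsub (Metric.mem_ball.2 ?_) hy
  rw [Metric.mem_ball, dist_comm] at hζ
  have := dist_triangle b ζ y
  rw [dist_comm]
  linarith

/-- Zero area of the boundary enters here: sets shrinking to the closure of Ω have densities that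
converge almost everywhere to the density of Ω itself. -/
theorem setDensity_closure_ae_eq (hΩ : IsOpen Ω) (hbdry : volume (frontier Ω) = 0) :
    ∀ᵐ ζ, ζ ∉ closure Ω ∨ ζ ∈ Ω := by
  have h : ∀ᵐ ζ, ζ ∉ frontier Ω := measure_eq_zero_iff_ae_notMem.1 hbdry
  filter_upwards [h] with ζ hζ
  rw [hΩ.frontier_eq] at hζ
  by_cases h : ζ ∈ Ω
  · exact .inr h
  · exact .inl fun hc => hζ ⟨hc, h⟩

theorem tendsto_polar4 {V : Type*} [AddCommGroup V] [Module ℂ V] {Q : ℕ → V → ℂ} {Q' : V → ℂ}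
    (h : ∀ x, Tendsto (fun n => Q n x) atTop (𝓝 (Q' x))) (x y : V) :
    Tendsto (fun n => polar4 (Q n) x y) atTop (𝓝 (polar4 Q' x y)) :=
  (((h _).sub (h _)).add (((h _).sub (h _)).mul_const _)).div_const _

/-- The isometric embedding of the analytic functions in the space of the exterior kernel. -/
theorem exists_embedding (hΩ : IsOpen Ω) (hb : Bornology.IsBounded Ω)
    (hbdry : volume (frontier Ω) = 0) {K : Type} [NormedAddCommGroup K] [InnerProductSpace ℂ K]
    [CompleteSpace K] [RKHS ℂ K (Exterior Ω) ℂ]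
    (hK : ∀ x y : Exterior Ω, inner ℂ (kerVec K x) (kerVec K y) =
      sphereKer (setDensity Ω) x.1 y.1) :
    ∃ ι : ExtAnalytic Ω →ₗ[ℂ] K, (∀ f g, inner ℂ (ι g) (ι f) = innerO f g) ∧
      ∀ f (z : Exterior Ω), ι f z = exteriorValue f z := by
  obtain ⟨R, W, hW⟩ := exists_hull_seq hb
  have hD : ∀ n, IsDensity R (setDensity (W n)) := fun n =>
    isDensity_setDensity (hW n).1.measurableSet (hW n).2.2.1
  have hR : Ω ⊆ Metric.ball 0 R := subset_closure.trans ((hW 0).2.1.trans (hW 0).2.2.1)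
  have hone : ∀ n, ∀ ζ ∈ Ω, setDensity (W n) ζ = 1 := fun n ζ hζ =>
    setDensity_of_mem ((hW n).2.1 (subset_closure hζ))
  have hdis : ∀ b ∉ closure Ω, ∃ δ > 0, ∀ᶠ n in atTop, ∀ ζ ∈ Metric.ball b δ, ζ ∉ W n :=
    fun b => eventually_ball_disjoint fun n => (hW n).2.2.2.1
  have hlim : ∀ᵐ ζ, Tendsto (fun n => setDensity (W n) ζ) atTop (𝓝 (setDensity Ω ζ)) := by
    filter_upwards [setDensity_closure_ae_eq hΩ hbdry] with ζ hζ
    rcases hζ with hζ | hζ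
    · obtain ⟨δ, hδ, h⟩ := hdis ζ hζ
      rw [setDensity_of_notMem fun h => hζ (subset_closure h)]
      refine tendsto_const_nhds.congr' ?_
      filter_upwards [h] with n hn
      exact (setDensity_of_notMem (hn ζ (Metric.mem_ball_self hδ))).symm
    · simp only [hone _ ζ hζ, setDensity_of_mem hζ]
      exact tendsto_const_nhds
  have hpair : ∀ f g : ExtAnalytic Ω,
      Tendsto (fun n => pairing (setDensity (W n)) f g) atTop (𝓝 (innerO f g)) := fun f g => by
    rw [innerO_eq_pairing hΩ hR]
    exact tendsto_pairing hΩ hb hD hone hlim f g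
  have hhull := fun n => pairing_hull hΩ hb (hW n).1 (hW n).2.1 (hW n).2.2.1 (hW n).2.2.2.2
  have hpolar : ∀ f g : ExtAnalytic Ω, innerO f g = polar4 (fun h => innerO h h) g f :=
    fun f g => tendsto_nhds_unique (hpair f g)
      ((tendsto_polar4 (fun h => hpair h h) g f).congr fun n => ((hhull n).2 f g).symm)
  have hker : ∀ x y : Exterior Ω, Tendsto (fun n => sphereKer (setDensity (W n)) x.1 y.1) atTop
      (𝓝 (sphereKer (setDensity Ω) x.1 y.1)) := fun x y => by
    refine tendsto_sphereKer hD hlim x.1 fun b hy => ?_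
    obtain ⟨δ, hδ, h⟩ := hdis b (mem_closure_of_exterior y hy)
    exact ⟨δ, hδ, h.mono fun n hn ζ hζ => setDensity_of_notMem (hn ζ hζ)⟩
  have hquad : ∀ c : Exterior Ω →₀ ℂ, Tendsto (fun n => (kerQuad (setDensity (W n)) c).re) atTop
      (𝓝 (‖c.sum fun x a => a • kerVec K x‖ ^ 2)) := fun c => by
    have h1 : kerQuad (setDensity Ω) c = ((‖c.sum fun x a => a • kerVec K x‖ ^ 2 : ℝ) : ℂ) := by
      have h2 := norm_sq_sum_kerVec_comp (K := K) id c
      simp only [id_eq, hK] at h2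
      exact h2.symm
    have h3 : Tendsto (fun n => kerQuad (setDensity (W n)) c) atTop
        (𝓝 (kerQuad (setDensity Ω) c)) := by
      simp only [kerQuad, Finsupp.sum]
      exact tendsto_finsetSum _ fun x _ => tendsto_finsetSum _ fun y _ =>
        ((hker x y).const_mul _).mul_const _
    rw [h1] at h3
    exact (Complex.continuous_re.tendsto _).comp h3
  have hfar : ∀ c : Exterior Ω →₀ ℂ, ∀ᶠ n in atTop, ∀ x ∈ c.support,
      x.1 ∉ ((↑) : ℂ → OnePoint ℂ) '' W n := fun c => by
    refine (Filter.eventually_all_finset c.support).2 fun x _ => ?_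
    obtain ⟨x, hx⟩ := x
    induction x using OnePoint.rec with
    | infty =>
      refine .of_forall fun n => ?_
      rintro ⟨a, -, h⟩
      exact OnePoint.coe_ne_infty a h
    | coe b =>
      obtain ⟨δ, hδ, h⟩ := hdis b (mem_closure_of_exterior ⟨(b : OnePoint ℂ), hx⟩ rfl)
      filter_upwards [h] with n hn
      rintro ⟨a, ha, hab⟩
      rw [OnePoint.coe_injective hab] at ha
      exact hn b (Metric.mem_ball_self hδ) ha
  have hex : ∀ f : ExtAnalytic Ω, ∃ F : K, (∀ x, F x = exteriorValue f x) ∧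
      ((‖F‖ ^ 2 : ℝ) : ℂ) = innerO f f := by
    intro f
    choose N hN0 hN hup hlow using fun n => (hhull n).1 f
    have hN2 : Tendsto (fun n => N n ^ 2) atTop (𝓝 (innerO f f).re) := by
      have h1 := (Complex.continuous_re.tendsto _).comp (hpair f f)
      refine h1.congr fun n => ?_
      rw [Function.comp_apply, ← hN n, Complex.ofReal_re]
    -- The form at (f, f) is a limit of the squares N(n)², hence real and nonnegative.
    have hreal : (((innerO f f).re : ℝ) : ℂ) = innerO f f :=
      tendsto_nhds_unique (((Complex.continuous_ofReal.tendsto _).comp hN2).congr fun n => hN n)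
        (hpair f f)
    have hA : 0 ≤ (innerO f f).re := ge_of_tendsto' hN2 fun n => sq_nonneg _
    -- Upper bound: for a fixed combination of kernel functions its points leave W(n) for large n,
    -- and the Cauchy–Schwarz estimates of the spaces of W(n) pass to the limit.
    obtain ⟨F, hF, hFn⟩ := exists_rkhs_of_bound (K := K) (exteriorValue f)
      (Real.sqrt (innerO f f).re) (Real.sqrt_nonneg _) fun c => by
        refine (pow_le_pow_iff_left₀ (norm_nonneg _) (by positivity) two_ne_zero).1 ?_
        rw [mul_pow, Real.sq_sqrt hA]
        exact ge_of_tendsto (hN2.mul (hquad c)) ((hfar c).mono fun n hn => hup n c hn)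
    refine ⟨F, hF, ?_⟩
    rw [← hreal]
    congr 1
    -- Lower bound: N(n) ≤ ‖F‖ for every n, by restriction to the exterior of W(n).
    refine le_antisymm ?_ (le_of_tendsto' hN2 fun n =>
      pow_le_pow_left₀ (hN0 n) (hlow n K hK F hF) 2)
    exact (pow_le_pow_left₀ (norm_nonneg _) hFn 2).trans_eq (Real.sq_sqrt hA)
  choose T hT hTn using hex
  obtain ⟨ι, hι⟩ := exists_linear_of_values (Ω := Ω) (A := Ω) hT
  refine ⟨ι, fun f g => ?_, fun f z => by rw [hι, hT]⟩
  rw [hpolar f g]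
  exact inner_eq_polar4 (fun h => by rw [hι, hTn]) g f

end Completion

/-! ### Kernel functions as limits of analytic functions -/

section Approximation

variable {Ω : Set ℂ} {R : ℝ}

/-- The exponent is analytic off the closed support of g, hence on the complement of Ω, and tends to
0 at infinity. It is smooth everywhere because g is smooth and vanishes near the pole b. -/
theorem exp_cpair_mem_extAnalytic {g : ℂ → ℝ} (hg : IsDensity R g) (hs : ContDiff ℝ ∞ g)
    (ht : tsupport g ⊆ Ω) {b : ℂ} {δ : ℝ} (hδ : 0 < δ) (hb : ∀ ζ ∈ Metric.ball b δ, g ζ = 0) :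
    (fun v => Complex.exp (cpair g v b) - 1) ∈ ExtAnalytic Ω := by
  have hsm : ContDiff ℝ ∞ fun ζ => (g ζ : ℂ) * (conj ζ - conj b)⁻¹ := by
    refine contDiff_iff_contDiffAt.2 fun ζ => ?_
    rcases eq_or_ne ζ b with rfl | hne
    · have : (fun ζ' => (g ζ' : ℂ) * (conj ζ' - conj ζ)⁻¹) =ᶠ[𝓝 ζ] fun _ => 0 := by
        filter_upwards [Metric.ball_mem_nhds ζ hδ] with ζ' hζ'
        simp [hb ζ' hζ']
      exact contDiffAt_const.congr_of_eventuallyEq this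
    · refine (Complex.ofRealCLM.contDiff.comp hs).contDiffAt.mul (ContDiffAt.inv
        (Complex.conjCLE.contDiff.contDiffAt.sub contDiffAt_const) ?_)
      change conj ζ - conj b ≠ 0
      rw [← map_sub, map_ne_zero, sub_ne_zero]; exact hne
  refine ⟨?_, fun z hz => ?_, ?_⟩
  · have h : ContDiff ℝ ∞ fun v => cpair g v b := contDiff_iff_contDiffAt.2 fun u =>
      (hg.cpair_local one_pos hsm.contDiffOn (.inr ⟨δ, hδ, hb⟩)).1
    exact h.cexp.sub contDiff_const
  · have hopen : IsOpen (tsupport g)ᶜ := (isClosed_tsupport g).isOpen_compl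
    obtain ⟨r, hr, hsub⟩ := Metric.isOpen_iff.1 hopen z fun h => hz (ht h)
    exact (hg.analyticAt_cpair b hr fun ζ hζ =>
      image_eq_zero_of_notMem_tsupport (hsub hζ)).cexp.sub analyticAt_const
  · have h := (hg.tendsto_cpair_cocompact b).cexp.sub_const 1
    simpa using h

theorem exists_ext_sphereKer {g : ℂ → ℝ} (hg : IsDensity R g) (hs : ContDiff ℝ ∞ g)
    (ht : tsupport g ⊆ Ω) (w : Exterior Ω) :
    ∃ f : ExtAnalytic Ω, ∀ z : Exterior Ω, exteriorValue f z = sphereKer g z.1 w.1 := by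
  have hw := isFar_exterior w
  obtain ⟨w, hw'⟩ := w
  induction w using OnePoint.rec with
  | infty =>
    refine ⟨0, fun z => ?_⟩
    obtain ⟨z, hz⟩ := z
    induction z using OnePoint.rec <;> simp [exteriorValue, sphereKer]
  | coe b =>
    obtain ⟨δ, hδ, h⟩ := hw b rfl
    have hgb : ∀ ζ ∈ Metric.ball b δ, g ζ = 0 := fun ζ hζ => by
      by_contra hne
      have h1 := h ζ hζ
      rw [setDensity_of_mem (ht (subset_tsupport g hne))] at h1
      exact one_ne_zero h1
    refine ⟨⟨_, exp_cpair_mem_extAnalytic hg hs ht hδ hgb⟩, fun z => ?_⟩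
    obtain ⟨z, hz⟩ := z
    induction z using OnePoint.rec with
    | infty => simp [exteriorValue, sphereKer]
    | coe a => rfl

/-- The kernel functions are limits of analytic functions. -/
theorem exists_seq_tendsto_kerVec (hΩ : IsOpen Ω) (hR : Ω ⊆ Metric.ball 0 R) {K : Type}
    [NormedAddCommGroup K] [InnerProductSpace ℂ K] [CompleteSpace K] [RKHS ℂ K (Exterior Ω) ℂ]
    (hK : ∀ x y : Exterior Ω, inner ℂ (kerVec K x) (kerVec K y) =
      sphereKer (setDensity Ω) x.1 y.1) {ι : ExtAnalytic Ω →ₗ[ℂ] K}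
    (hι : ∀ f (z : Exterior Ω), ι f z = exteriorValue f z) (w : Exterior Ω) :
    ∃ f : ℕ → ExtAnalytic Ω, Tendsto (fun n => ι (f n)) atTop (𝓝 (kerVec K w)) := by
  obtain ⟨g, hg, hs, ht, hlim⟩ := exists_smooth_densities_open hΩ hR
  have hD := isDensity_setDensity hΩ.measurableSet hR
  have hz : ∀ n ζ, setDensity Ω ζ = 0 → g n ζ = 0 := fun n ζ h0 => by
    by_contra hne
    rw [setDensity_of_mem ((ht n).2 (subset_tsupport (g n) hne))] at h0
    exact one_ne_zero h0
  have hle : ∀ n ζ, g n ζ ≤ setDensity Ω ζ := fun n ζ => by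
    by_cases h : ζ ∈ Ω
    · rw [setDensity_of_mem h]; exact (hg n).le_one ζ
    · rw [hz n ζ (setDensity_of_notMem h)]; exact hD.nonneg ζ
  choose f hf using fun n => exists_ext_sphereKer (hg n) (hs n) (ht n).2 w
  refine ⟨f, ?_⟩
  have hker : Tendsto (fun n => (sphereKer (g n) w.1 w.1).re) atTop
      (𝓝 (sphereKer (setDensity Ω) w.1 w.1).re) := by
    refine (Complex.continuous_re.tendsto _).comp
      (tendsto_sphereKer hg (.of_forall hlim) w.1 fun b hb => ?_)
    obtain ⟨δ, hδ, h⟩ := isFar_exterior w b hb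
    exact ⟨δ, hδ, .of_forall fun n ζ hζ => hz n ζ (h ζ hζ)⟩
  -- `f n` is the kernel function at w in the space of the density `g n`. Since `g n` lies below the
  -- density of Ω, passing to `K` does not increase its norm.
  have hnorm : ∀ n, ‖ι (f n)‖ ^ 2 ≤ (sphereKer (g n) w.1 w.1).re := fun n => by
    obtain ⟨Kn, _, _, _, _, hKn⟩ := exists_rkhs_kernel
      (Matrix.of fun x y : Exterior Ω => sphereKer (g n) x.1 y.1)
      (posSemidef_sphereKer (hg n) _ fun x => (isFar_exterior x).mono (hz n))
    simp only [Matrix.of_apply] at hKn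
    obtain ⟨F, hF, hFn⟩ := exists_rkhs_of_le (K := Kn) (K' := K) (id : Exterior Ω → Exterior Ω) (by
      simp only [hKn, hK, id_eq]
      exact posSemidef_sphereKer_sub (hg n) hD (hle n) (fun x : Exterior Ω => x.1)
        isFar_exterior) (kerVec Kn w)
    have e : ι (f n) = F := RKHS.ext fun z => by
      rw [hι, hf, hF, ← inner_kerVec, hKn, id_eq]
    have h1 := inner_self_eq_norm_sq (𝕜 := ℂ) (kerVec Kn w)
    rw [hKn] at h1
    rw [e]
    exact (pow_le_pow_left₀ (norm_nonneg _) hFn 2).trans_eq h1.symm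
  -- In the expanded square the cross term is −2 Re f_n(w), twice the value that bounds ‖ι f_n‖²;
  -- one copy survives with a minus sign.
  have hdist : ∀ n, ‖ι (f n) - kerVec K w‖ ^ 2 ≤
      (sphereKer (setDensity Ω) w.1 w.1).re - (sphereKer (g n) w.1 w.1).re := fun n => by
    rw [norm_sub_sq (𝕜 := ℂ), ← inner_conj_symm, inner_kerVec, hι, hf,
      ← inner_self_eq_norm_sq (𝕜 := ℂ) (kerVec K w), hK, RCLike.conj_re]
    have := hnorm n
    simp only [RCLike.re_to_complex]
    linarith
  have h0 : Tendsto (fun n => ‖ι (f n) - kerVec K w‖ ^ 2) atTop (𝓝 0) := by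
    refine squeeze_zero (fun n => sq_nonneg _) hdist ?_
    have := hker.const_sub (sphereKer (setDensity Ω) w.1 w.1).re
    rwa [sub_self] at this
  have h1 := h0.sqrt
  simp only [Real.sqrt_sq (norm_nonneg _), Real.sqrt_zero] at h1
  exact tendsto_iff_norm_sub_tendsto_zero.2 h1

end Approximation
end

/-! ### The completion and its reproducing kernel -/

theorem mainTheorem3 (Ω : Set ℂ) (hopen : IsOpen Ω) (hbdd : Bornology.IsBounded Ω)
    (hbdry : volume (frontier Ω) = 0) :
    (∃ (K : Type) (_ : NormedAddCommGroup K) (_ : InnerProductSpace ℂ K) (_ : CompleteSpace K)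
      (_ : RKHS ℂ K (Exterior Ω) ℂ), IsCompletionO Ω K) ∧
    ∀ (K : Type*) [NormedAddCommGroup K] [InnerProductSpace ℂ K] [CompleteSpace K]
      [RKHS ℂ K (Exterior Ω) ℂ], IsCompletionO Ω K →
      ∀ w : Exterior Ω, ∃ L : K,
        (∀ z : Exterior Ω, L z = 1 / expTransformSphere Ω z.1 w.1 - 1) ∧
        ∀ f : K, f w = inner ℂ L f := by
  obtain ⟨R, hR⟩ := hbdd.subset_ball (0 : ℂ)
  have hD := isDensity_setDensity hopen.measurableSet hR
  obtain ⟨H, _, _, _, _, hH⟩ := exists_rkhs_kernel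
    (Matrix.of fun x y : Exterior Ω => sphereKer (setDensity Ω) x.1 y.1)
    (posSemidef_sphereKer hD _ isFar_exterior)
  simp only [Matrix.of_apply] at hH
  obtain ⟨ι, hι, hval⟩ := exists_embedding hopen hbdd hbdry hH
  have happ := exists_seq_tendsto_kerVec hopen hR hH hval
  have hd : Dense ((LinearMap.range ι : Submodule ℂ H) : Set H) := dense_span_kerVec fun w => by
    obtain ⟨f, hf⟩ := happ w
    exact mem_closure_of_tendsto hf (.of_forall fun n => LinearMap.mem_range_self ι (f n))
  have hcompl : IsCompletionO Ω H := ⟨ι, by rwa [LinearMap.coe_range] at hd, hι, hval⟩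
  refine ⟨⟨H, inferInstance, inferInstance, inferInstance, inferInstance, hcompl⟩, ?_⟩
  rintro K _ _ _ _ ⟨κ, hdense, hκ, hκval⟩ w
  obtain ⟨f, hf⟩ := happ w
  -- Both maps realize the same inner product, so the sequence approximating the kernel function in
  -- `H` is Cauchy in the given completion `K` as well.
  have hnorm : ∀ u, ‖κ u‖ = ‖ι u‖ := fun u => by
    rw [norm_eq_sqrt_re_inner (𝕜 := ℂ), norm_eq_sqrt_re_inner (𝕜 := ℂ), hκ, hι]
  have hcauchy : CauchySeq fun n => κ (f n) := by
    refine Metric.cauchySeq_iff.2 fun ε hε => ?_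
    obtain ⟨N, hN⟩ := Metric.cauchySeq_iff.1 hf.cauchySeq ε hε
    refine ⟨N, fun m hm n hn => ?_⟩
    have h := hN m hm n hn
    rw [dist_eq_norm, ← map_sub] at h ⊢
    rwa [hnorm]
  obtain ⟨L, hL⟩ := cauchySeq_tendsto_of_complete hcauchy
  refine ⟨L, fun z => ?_, fun u => ?_⟩
  -- The functions κ(f n) and ι(f n) have the same values, and point evaluation is continuous in
  -- both spaces.
  · rw [one_div_expTransformSphere hopen.measurableSet hR, ← hH, ← inner_kerVec]
    have h1 : Tendsto (fun n => inner ℂ (kerVec K z) (κ (f n))) atTop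
        (𝓝 (inner ℂ (kerVec K z) L)) := tendsto_const_nhds.inner hL
    have h2 : Tendsto (fun n => inner ℂ (kerVec H z) (ι (f n))) atTop
        (𝓝 (inner ℂ (kerVec H z) (kerVec H w))) := tendsto_const_nhds.inner hf
    refine tendsto_nhds_unique h1 (h2.congr fun n => ?_)
    rw [inner_kerVec, inner_kerVec, hval, hκval]
  -- Both sides are continuous in u, so equality on the dense image of the analytic functions
  -- suffices; there it is transported from `H`.
  · have h : (fun u : K => inner ℂ (kerVec K w) u) = fun u => inner ℂ L u := by
      refine hdense.equalizer (by fun_prop) (by fun_prop) (funext fun v => ?_)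
      simp only [Function.comp_apply]
      rw [inner_kerVec, hκval, ← hval, ← inner_kerVec]
      have h1 : Tendsto (fun n => inner ℂ (κ (f n)) (κ v)) atTop (𝓝 (inner ℂ L (κ v))) :=
        hL.inner tendsto_const_nhds
      have h2 : Tendsto (fun n => inner ℂ (ι (f n)) (ι v)) atTop
          (𝓝 (inner ℂ (kerVec H w) (ι v))) := hf.inner tendsto_const_nhds
      exact tendsto_nhds_unique h2 (h1.congr fun n => by rw [hκ, hι])
    rw [← inner_kerVec]
    exact congrFun h u
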